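/- Let $M$ be a connected smooth manifold of dimension $2n$, $n>2$, with an almost Hermitian structure $(g,J)$ (that is, $g$ is a Riemannian metric, $J$ is an almost complex structure and $g(Jx,Jy)=g(x,y)$; all objects are smooth). Let $\nabla$ be the Levi-Civita connection, let $R(x,y,z,u)=g(R(x,y)z,u)$ with $R(x,y)z=\nabla_x\nabla_yz-\nabla_y\nabla_xz-\nabla_{[x,y]}z$ be the curvature tensor, and let $F(x,y)=g(x,Jy)$ be the fundamental form. For a tensor $P$ of type $(0,2)$ put $$\varphi(P)(x,y,z,u)=g(x,u)P(y,z)-g(x,z)P(y,u)+g(y,z)P(x,u)-g(y,u)P(x,z),$$ $$\begin{aligned}\psi(P)(x,y,z,u)={}&g(x,Ju)P(y,Jz)-g(x,Jz)P(y,Ju)-2g(x,Jy)P(z,Ju)\\&+g(y,Jz)P(x,Ju)-g(y,Ju)P(x,Jz)-2g(z,Ju)P(x,Jy),\end{aligned}$$ and $\pi_1=\tfrac12\varphi(g)$, $\pi_2=\tfrac12\psi(g)$. Theorem 1. Suppose that $M$ is semi-Kähler, i.e. $\delta F=0$, where $\delta$ is the coderivative, and that $$R=\varphi(P)+f\pi_1+h\pi_2,$$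 where $P$ is a smooth symmetric tensor field of type $(0,2)$ and $f,h$ are smooth functions on $M$. Then $h$ is constant. If $h=0$, then $M$ is conformally flat, i.e. every point has an open neighbourhood $U$ and a smooth function $w$ on $U$ such that the metric $e^{2w}g$ on $U$ is flat. If $h\neq 0$, then $M$ is Kähler, i.e. $\nabla J=0$, and of constant holomorphic sectional curvature, i.e. the sectional curvature of the plane spanned by $x$ and $Jx$ is the same for all nonzero tangent vectors $x$ at all points of $M$. -/

import Mathlib

open scoped Manifold ContDiff Topology

namespace AlmostHermitian

noncomputable section

/-! ### Algebra on one tangent space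

`V` is a tangent space, `g` its inner product, `J` its complex structure, `P` a bilinear form. -/

section Algebra

variable {V : Type*} [AddCommGroup V] [Module ℝ V] [TopologicalSpace V]

/-- The operator `φ`:
`φ(P)(x,y,z,u) = g(x,u)P(y,z) - g(x,z)P(y,u) + g(y,z)P(x,u) - g(y,u)P(x,z)`. -/
def phi (g P : V →L[ℝ] V →L[ℝ] ℝ) (x y z u : V) : ℝ :=
  g x u * P y z - g x z * P y u + g y z * P x u - g y u * P x z

/-- The operator `ψ`. -/
def psi (g : V →L[ℝ] V →L[ℝ] ℝ) (J : V →L[ℝ] V) (P : V →L[ℝ] V →L[ℝ] ℝ) (x y z u : V) : ℝ :=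
  g x (J u) * P y (J z) - g x (J z) * P y (J u) - 2 * g x (J y) * P z (J u)
    + g y (J z) * P x (J u) - g y (J u) * P x (J z) - 2 * g z (J u) * P x (J y)

/-- `π₁ = ½ φ(g)`. -/
def pi1 (g : V →L[ℝ] V →L[ℝ] ℝ) (x y z u : V) : ℝ := 1 / 2 * phi g g x y z u

/-- `π₂ = ½ ψ(g)`. -/
def pi2 (g : V →L[ℝ] V →L[ℝ] ℝ) (J : V →L[ℝ] V) (x y z u : V) : ℝ := 1 / 2 * psi g J g x y z u

end Algebra

/-! ### Local coordinates on a smooth manifold -/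

/-- The model space `ℝᵐ`. -/
abbrev Coord (m : ℕ) : Type := EuclideanSpace ℝ (Fin m)

/-- The `i`-th partial derivative of a function on `ℝᵐ`. -/
def pderiv {m : ℕ} (i : Fin m) (F : Coord m → ℝ) (y : Coord m) : ℝ :=
  fderiv ℝ F y (EuclideanSpace.single i 1)

section Manifold

variable {m : ℕ} {M : Type*} [TopologicalSpace M] [ChartedSpace (Coord m) M]

variable (m M) in
/-- Fields of bilinear forms on the tangent spaces, i.e. (not necessarily smooth) tensor fields
of type (0,2). -/
abbrev TwoTensor : Type _ :=
  (p : M) → TangentSpace (𝓡 m) p →L[ℝ] TangentSpace (𝓡 m) p →L[ℝ] ℝ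

variable (m M) in
/-- Fields of endomorphisms of the tangent spaces, i.e. (not necessarily smooth) tensor fields
of type (1,1). -/
abbrev EndTensor : Type _ :=
  (p : M) → TangentSpace (𝓡 m) p →L[ℝ] TangentSpace (𝓡 m) p

/-- Smoothness of a tensor field of type (0,2). -/
def SmoothTwoTensor [IsManifold (𝓡 m) ∞ M] (P : TwoTensor m M) : Prop :=
  ContMDiff (𝓡 m) ((𝓡 m).prod 𝓘(ℝ, Coord m →L[ℝ] Coord m →L[ℝ] ℝ)) ∞
    (fun p : M ↦ Bundle.TotalSpace.mk' (Coord m →L[ℝ] Coord m →L[ℝ] ℝ)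
      (E := fun p : M ↦ TangentSpace (𝓡 m) p →L[ℝ] TangentSpace (𝓡 m) p →L[ℝ] ℝ) p (P p))

/-- Smoothness of a tensor field of type (1,1). -/
def SmoothEndTensor [IsManifold (𝓡 m) ∞ M] (J : EndTensor m M) : Prop :=
  ContMDiff (𝓡 m) ((𝓡 m).prod 𝓘(ℝ, Coord m →L[ℝ] Coord m)) ∞
    (fun p : M ↦ Bundle.TotalSpace.mk' (Coord m →L[ℝ] Coord m)
      (E := fun p : M ↦ TangentSpace (𝓡 m) p →L[ℝ] TangentSpace (𝓡 m) p) p (J p))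

/-- The coordinate vector `∂ᵢ` of the chart `c`, at the point with coordinates `y`. -/
def coordVec (c : OpenPartialHomeomorph M (Coord m)) (i : Fin m) (y : Coord m) :
    TangentSpace (𝓡 m) (c.symm y) :=
  mfderiv (𝓡 m) (𝓡 m) c.symm y ((NormedSpace.fromTangentSpace y).symm (EuclideanSpace.single i 1))

/-- The `i`-th component `vⁱ` in the chart `c` of a tangent vector `v = ∑ vⁱ ∂ᵢ` at `p`. -/
def coordComp (c : OpenPartialHomeomorph M (Coord m)) (p : M) (v : TangentSpace (𝓡 m) p)
    (i : Fin m) : ℝ :=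
  NormedSpace.fromTangentSpace (c p) (mfderiv (𝓡 m) (𝓡 m) c p v) i

/-- The components `Tᵢⱼ = T(∂ᵢ, ∂ⱼ)`, as functions of the coordinates. -/
def coeff (T : TwoTensor m M) (c : OpenPartialHomeomorph M (Coord m)) (i j : Fin m)
    (y : Coord m) : ℝ :=
  T (c.symm y) (coordVec c i y) (coordVec c j y)

/-- The components `Jⁱⱼ` of an endomorphism field, `J ∂ⱼ = ∑ᵢ Jⁱⱼ ∂ᵢ`. -/
def endCoeff (J : EndTensor m M) (c : OpenPartialHomeomorph M (Coord m)) (i j : Fin m)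
    (y : Coord m) : ℝ :=
  coordComp c (c.symm y) (J (c.symm y) (coordVec c j y)) i

/-- The inverse matrix `gⁱʲ` of the metric. -/
def invCoeff (g : TwoTensor m M) (c : OpenPartialHomeomorph M (Coord m)) (i j : Fin m)
    (y : Coord m) : ℝ :=
  (Matrix.of fun a b ↦ coeff g c a b y)⁻¹ i j

/-- The Christoffel symbols `Γᵏᵢⱼ` of the Levi-Civita connection, `∇_{∂ᵢ} ∂ⱼ = ∑ₖ Γᵏᵢⱼ ∂ₖ`. -/
def christoffel (g : TwoTensor m M) (c : OpenPartialHomeomorph M (Coord m)) (k i j : Fin m)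
    (y : Coord m) : ℝ :=
  1 / 2 * ∑ l, invCoeff g c k l y *
    (pderiv i (coeff g c j l) y + pderiv j (coeff g c i l) y - pderiv l (coeff g c i j) y)

/-- The components of the curvature operator:
`∇_{∂ᵢ} ∇_{∂ⱼ} ∂ₖ - ∇_{∂ⱼ} ∇_{∂ᵢ} ∂ₖ = R(∂ᵢ,∂ⱼ)∂ₖ = ∑ₗ (curvUp l i j k) ∂ₗ`. -/
def curvUp (g : TwoTensor m M) (c : OpenPartialHomeomorph M (Coord m)) (l i j k : Fin m)
    (y : Coord m) : ℝ :=
  pderiv i (christoffel g c l j k) y - pderiv j (christoffel g c l i k) y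
    + ∑ a, (christoffel g c l i a y * christoffel g c a j k y
      - christoffel g c l j a y * christoffel g c a i k y)

/-- The components `Rᵢⱼₖₗ = g(R(∂ᵢ,∂ⱼ)∂ₖ, ∂ₗ)` of the curvature tensor of type (0,4). -/
def curvCoeff (g : TwoTensor m M) (c : OpenPartialHomeomorph M (Coord m)) (i j k l : Fin m)
    (y : Coord m) : ℝ :=
  ∑ a, curvUp g c a i j k y * coeff g c a l y

/-- The curvature tensor `R(x,y,z,u) = g(R(x,y)z,u)` of the metric `g` at the point `p`,
computed in the chart `c` around `p`. -/
def curvature (g : TwoTensor m M) (c : OpenPartialHomeomorph M (Coord m)) (p : M)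
    (x y z u : TangentSpace (𝓡 m) p) : ℝ :=
  ∑ i, ∑ j, ∑ k, ∑ l, curvCoeff g c i j k l (c p)
    * coordComp c p x i * coordComp c p y j * coordComp c p z k * coordComp c p u l

/-- The components `(∇ₖF)(∂ᵢ,∂ⱼ)` of the covariant derivative of a tensor field of type (0,2). -/
def covDerivForm (g F : TwoTensor m M) (c : OpenPartialHomeomorph M (Coord m)) (k i j : Fin m)
    (y : Coord m) : ℝ :=
  pderiv k (coeff F c i j) y
    - ∑ a, (christoffel g c a k i y * coeff F c a j y + christoffel g c a k j y * coeff F c i a y)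

/-- The components `(∇ₖJ)ⁱⱼ` of the covariant derivative of a tensor field of type (1,1). -/
def covDerivEnd (g : TwoTensor m M) (J : EndTensor m M)
    (c : OpenPartialHomeomorph M (Coord m)) (k i j : Fin m) (y : Coord m) : ℝ :=
  pderiv k (endCoeff J c i j) y
    + ∑ a, (christoffel g c i k a y * endCoeff J c a j y
      - christoffel g c a k j y * endCoeff J c i a y)

/-- The components of the coderivative `(δF)(v) = -∑ₐ (∇_{eₐ}F)(eₐ, v)` (`eₐ` orthonormal). -/
def coderiv (g F : TwoTensor m M) (c : OpenPartialHomeomorph M (Coord m)) (j : Fin m)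
    (y : Coord m) : ℝ :=
  -∑ a, ∑ b, invCoeff g c a b y * covDerivForm g F c a b j y

/-- The metric `g` is flat on `U`: its curvature tensor vanishes at every point of `U`. -/
def FlatOn (g : TwoTensor m M) (U : Set M) : Prop :=
  ∀ c ∈ atlas (Coord m) M, ∀ p ∈ c.source ∩ U, ∀ x y z u : TangentSpace (𝓡 m) p,
    curvature g c p x y z u = 0

/-- The metric `g` is conformally flat: around every point there is a smooth function `w` for which
the conformally related metric `e^{2w} g` is flat. -/
def ConformallyFlat (g : TwoTensor m M) : Prop :=
  ∀ p : M, ∃ U : Set M, IsOpen U ∧ p ∈ U ∧ ∃ w : M → ℝ,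
    ContMDiffOn (𝓡 m) 𝓘(ℝ, ℝ) ∞ w U ∧ FlatOn (fun q ↦ Real.exp (2 * w q) • g q) U

end Manifold

/-! ### Almost Hermitian manifolds -/

/-- An almost Hermitian structure on a smooth manifold: a Riemannian metric and a compatible almost
complex structure, both smooth. -/
structure AlmostHermitianStructure (m : ℕ) (M : Type*) [TopologicalSpace M]
    [ChartedSpace (Coord m) M] [IsManifold (𝓡 m) ∞ M] where
  /-- the Riemannian metric -/
  metric : Bundle.ContMDiffRiemannianMetric (𝓡 m) ∞ (Coord m)
    (fun p : M ↦ TangentSpace (𝓡 m) p)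
  /-- the almost complex structure -/
  J : EndTensor m M
  smooth_J : SmoothEndTensor J
  J_J : ∀ (p : M) (v : TangentSpace (𝓡 m) p), J p (J p v) = -v
  metric_J_J : ∀ (p : M) (v w : TangentSpace (𝓡 m) p),
    metric.inner p (J p v) (J p w) = metric.inner p v w

namespace AlmostHermitianStructure

variable {m : ℕ} {M : Type*} [TopologicalSpace M] [ChartedSpace (Coord m) M]
  [IsManifold (𝓡 m) ∞ M]

/-- The metric tensor. -/
def g (S : AlmostHermitianStructure m M) : TwoTensor m M := S.metric.inner

/-- The fundamental form `F(x,y) = g(x,Jy)`. -/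
def fundForm (S : AlmostHermitianStructure m M) : TwoTensor m M :=
  fun p ↦ (ContinuousLinearMap.precomp ℝ (S.J p)).comp (S.g p)

/-- Semi-Kähler: `δF = 0`. -/
def IsSemiKahler (S : AlmostHermitianStructure m M) : Prop :=
  ∀ c ∈ atlas (Coord m) M, ∀ p ∈ c.source, ∀ j : Fin m, coderiv S.g S.fundForm c j (c p) = 0

/-- Kähler: `∇J = 0`. -/
def IsKahler (S : AlmostHermitianStructure m M) : Prop :=
  ∀ c ∈ atlas (Coord m) M, ∀ p ∈ c.source, ∀ k i j : Fin m, covDerivEnd S.g S.J c k i j (c p) = 0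

/-- Constant holomorphic sectional curvature: the sectional curvature of the plane spanned by
`x` and `Jx` is the same for all nonzero tangent vectors `x` at all points. -/
def HasConstHolSectionalCurvature (S : AlmostHermitianStructure m M) : Prop :=
  ∃ k : ℝ, ∀ c ∈ atlas (Coord m) M, ∀ p ∈ c.source, ∀ x : TangentSpace (𝓡 m) p, x ≠ 0 →
    curvature S.g c p x (S.J p x) (S.J p x) x
      / (S.g p x x * S.g p (S.J p x) (S.J p x) - S.g p x (S.J p x) ^ 2) = k

/-- The curvature tensor has the form `R = φ(P) + f π₁ + h π₂`. -/
def HasCurvatureForm (S : AlmostHermitianStructure m M) (P : TwoTensor m M) (f h : M → ℝ) : Prop :=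
  ∀ c ∈ atlas (Coord m) M, ∀ p ∈ c.source, ∀ x y z u : TangentSpace (𝓡 m) p,
    curvature S.g c p x y z u
      = phi (S.g p) (P p) x y z u + f p * pi1 (S.g p) x y z u + h p * pi2 (S.g p) (S.J p) x y z u

end AlmostHermitianStructure

end

end AlmostHermitian

open scoped Manifold ContDiff Topology

set_option linter.unusedSimpArgs false
set_option maxSynthPendingDepth 3

/-! Put `Q = P + (f/2) g`, so that `R = φ(Q) + h π₂`. The second Bianchi identity then involves only
`∇Q`, `dh` and `B = ∇F`, and it is evaluated on vectors that are orthogonal together with their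
images under `J`. Three such directions exist because `n > 2`.

Where all `∇Q`-terms drop out, it gives `dh(w) = h (B(x,x,Jw) + B(Jx,Jx,Jw))`
(`bianchi_trace_term`). Summed over a unitary frame starting with `w`, the condition `δF = 0` turns
this into `(n-1) dh(w) = 0` (`bianchi_dh_eq_zero`), so `h` is constant on the connected manifold.

With `dh = 0`, further evaluations show that `h B` is alternating and that the skew part of `∇Q` is
`8 h B(w,x,Jy)`. A cyclic sum removes the left side, since `Q` is symmetric, and leaves `h B = 0`
(`bianchi_fundDeriv_eq_zero`). If `h ≠ 0`, then `∇J = 0`; hence `R(x,y,Jz,Ju) = R(x,y,z,u)`, which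
forces `Q = (h/2) g` (`eq_half_smul_metric_of_kahler_symmetry`). Thus `R = h (π₁ + π₂)`, with
holomorphic sectional curvature `4h`.

If `h = 0`, then `R = φ(Q)` and the Bianchi identity makes `Q` a Codazzi tensor
(`bianchi_cotton_eq_zero`). The metric `e^{2w} g` is flat once `∇dw = dw ⊗ dw - ½ |dw|² g + Q`
(`conformal_flat`). The substitution `σ = e^{-w}` linearises this to `∇dσ = -σ Q + ρ g`, `dρ =
-Q(grad σ)`. The integrability conditions of this system follow from `R = φ(Q)` and the Codazzi
equation, and a Frobenius theorem (`exists_parallel_section`) solves it locally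
(`exists_conformal_factor`).

The analysis takes place on open subsets of a vector space. Charts transfer it to the manifold, and
`pullback_conformal_factor` moves the conformal factor between charts. -/

namespace AlmostHermitian

/-! ### Hermitian linear algebra: complex-orthogonal vectors and unitary frames. -/

section PointwiseAlgebra

variable {V : Type*} [NormedAddCommGroup V] [NormedSpace ℝ V]

/-- `g` is an inner product on `V` and `J` an orthogonal complex structure. -/
structure IsHermitianPair (g : V →L[ℝ] V →L[ℝ] ℝ) (J : V →L[ℝ] V) : Prop where
  symm : ∀ x y, g x y = g y x
  pos : ∀ x, x ≠ 0 → 0 < g x x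
  sq : ∀ x, J (J x) = -x
  compat : ∀ x y, g (J x) (J y) = g x y

/-- `x` is orthogonal to `y` and to `J y`. -/
def CPerp (g : V →L[ℝ] V →L[ℝ] ℝ) (J : V →L[ℝ] V) (x y : V) : Prop :=
  g x y = 0 ∧ g x (J y) = 0

/-- The vectors `e i` and `J (e i)`, `i < n`, are orthonormal. -/
def IsUnitaryFrame (g : V →L[ℝ] V →L[ℝ] ℝ) (J : V →L[ℝ] V) (n : ℕ) (e : ℕ → V) : Prop :=
  ∀ i < n, ∀ j < n, g (e i) (e j) = (if i = j then 1 else 0) ∧ g (e i) (J (e j)) = 0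

namespace IsHermitianPair

variable {g : V →L[ℝ] V →L[ℝ] ℝ} {J : V →L[ℝ] V} (H : IsHermitianPair g J)
include H

lemma J_left (x y : V) : g (J x) y = -g x (J y) := by
  have := H.compat x (J y)
  rw [H.sq, map_neg] at this
  linarith

lemma self_J (x : V) : g x (J x) = 0 := by
  have h1 := H.J_left x x
  rw [H.symm] at h1
  linarith

lemma J_swap (x y : V) : g x (J y) = -g y (J x) := by
  rw [H.symm, H.J_left]

lemma cperp_symm {x y : V} (h : CPerp g J x y) : CPerp g J y x := by
  refine ⟨by rw [H.symm, h.1], ?_⟩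
  rw [H.J_swap, h.2, neg_zero]

lemma cperp_J_right {x y : V} (h : CPerp g J x y) : CPerp g J x (J y) :=
  ⟨h.2, by rw [H.sq, map_neg, h.1, neg_zero]⟩

lemma cperp_J_left {x y : V} (h : CPerp g J x y) : CPerp g J (J x) y :=
  H.cperp_symm (H.cperp_J_right (H.cperp_symm h))

variable [FiniteDimensional ℝ V]

/-- Orthogonality to all `v i` and `J (v i)` is `2k` linear equations, so the solution space is
nonzero and a solution can be normalised. -/
lemma exists_unit_cperp {k : ℕ} (v : Fin k → V) (hk : 2 * k < Module.finrank ℝ V) :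
    ∃ z, g z z = 1 ∧ ∀ i, CPerp g J z (v i) := by
  let L : V →ₗ[ℝ] (Fin k → ℝ) × (Fin k → ℝ) :=
    (LinearMap.pi fun i ↦ ((g (v i) : V →L[ℝ] ℝ) : V →ₗ[ℝ] ℝ)).prod
      (LinearMap.pi fun i ↦ ((g (J (v i)) : V →L[ℝ] ℝ) : V →ₗ[ℝ] ℝ))
  have hL : LinearMap.ker L ≠ ⊥ := by
    apply LinearMap.ker_ne_bot_of_finrank_lt
    simpa [two_mul] using hk
  obtain ⟨z, hz, hz0⟩ := (Submodule.ne_bot_iff _).1 hL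
  have hpos := H.pos z hz0
  have hs : 0 < √(g z z) := Real.sqrt_pos.2 hpos
  rw [LinearMap.mem_ker] at hz
  have h1 : ∀ i, g (v i) z = 0 := fun i ↦ congrFun (congrArg Prod.fst hz) i
  have h2 : ∀ i, g (J (v i)) z = 0 := fun i ↦ congrFun (congrArg Prod.snd hz) i
  refine ⟨(√(g z z))⁻¹ • z, ?_, fun i ↦ ⟨?_, ?_⟩⟩
  · simp only [map_smul, _root_.smul_apply, smul_eq_mul]
    field_simp
    rw [Real.sq_sqrt hpos.le]
  · simp [H.symm z, h1]
  · simp [H.symm z, h2]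

lemma exists_unitaryFrame {n : ℕ} (hn : 2 * n ≤ Module.finrank ℝ V) (hn0 : 0 < n) {v : V}
    (hv : g v v = 1) : ∃ e : ℕ → V, e 0 = v ∧ IsUnitaryFrame g J n e := by
  induction n, hn0 using Nat.le_induction with
  | base =>
    refine ⟨fun _ ↦ v, rfl, fun i hi j hj ↦ ?_⟩
    obtain rfl : i = 0 := by omega
    obtain rfl : j = 0 := by omega
    simp [hv, H.self_J]
  | succ n hn0 ih =>
    obtain ⟨e, he0, he⟩ := ih (by omega)
    obtain ⟨z, hz1, hz⟩ := H.exists_unit_cperp (fun i : Fin n ↦ e i) (by omega)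
    have hz' : ∀ i < n, CPerp g J z (e i) := fun i hi ↦ hz ⟨i, hi⟩
    refine ⟨Function.update e n z, ?_, fun i hi j hj ↦ ?_⟩
    · rw [Function.update_of_ne (by omega), he0]
    · rcases eq_or_ne i n with rfl | hi' <;> rcases eq_or_ne j i with rfl | hj'
      · simp [hz1, H.self_J]
      · have := hz' j (by omega)
        simp [Function.update_of_ne hj', this.1, this.2, hj'.symm]
      · simp [Function.update_of_ne hi', (he j (by omega) j (by omega)).1, H.self_J]
      · rw [Function.update_of_ne hi']
        rcases eq_or_ne j n with rfl | hj''
        · have := H.cperp_symm (hz' i (by omega))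
          simp [this.1, this.2, hi']
        · rw [Function.update_of_ne hj'']
          exact he i (by omega) j (by omega)

end IsHermitianPair

/-! ### The second Bianchi identity as algebra on one tangent space. -/

/-- The algebraic properties of `B w x y = (∇_w F)(x, y)`. -/
structure IsFundDeriv (J : V →L[ℝ] V) (B : V → V → V → ℝ) : Prop where
  add_left : ∀ a b x y, B (a + b) x y = B a x y + B b x y
  smul_left : ∀ (t : ℝ) a x y, B (t • a) x y = t * B a x y
  add_right : ∀ w x a b, B w x (a + b) = B w x a + B w x b
  smul_right : ∀ (t : ℝ) w x a, B w x (t • a) = t * B w x a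
  skew : ∀ w x y, B w x y = -B w y x
  anti : ∀ w x y, B w (J x) (J y) = -B w x y

/-- The component of `∇_w R`, `R = φ(Q) + h π₂`, where `D w = ∇_w Q`, `a = dh`, `B w = ∇_w F`. -/
noncomputable def curvDeriv (g : V →L[ℝ] V →L[ℝ] ℝ) (J : V →L[ℝ] V)
    (D : V → V → V → ℝ) (a : V → ℝ) (h : ℝ) (B : V → V → V → ℝ) (w x y z u : V) : ℝ :=
  g x u * D w y z - g x z * D w y u + g y z * D w x u - g y u * D w x z
  + a w * (g x (J u) * g y (J z) - g x (J z) * g y (J u) - 2 * g x (J y) * g z (J u))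
  + h * (B w x u * g y (J z) + g x (J u) * B w y z - B w x z * g y (J u) - g x (J z) * B w y u
    - 2 * B w x y * g z (J u) - 2 * g x (J y) * B w z u)

namespace IsFundDeriv

variable {J : V →L[ℝ] V} {B : V → V → V → ℝ} (hB : IsFundDeriv J B)
include hB

lemma self (w x : V) : B w x x = 0 := by linarith [hB.skew w x x]

lemma neg_right (w x y : V) : B w x (-y) = -B w x y := by
  simpa using hB.smul_right (-1) w x y

lemma add_mid (w a b y : V) : B w (a + b) y = B w a y + B w b y := by
  rw [hB.skew, hB.add_right, hB.skew w a, hB.skew w b]; ring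

lemma smul_mid (t : ℝ) (w a y : V) : B w (t • a) y = t * B w a y := by
  rw [hB.skew, hB.smul_right, hB.skew w a]; ring

end IsFundDeriv

section Bianchi

variable {g : V →L[ℝ] V →L[ℝ] ℝ} {J : V →L[ℝ] V} (H : IsHermitianPair g J)
  {D B : V → V → V → ℝ} {a : V →L[ℝ] ℝ} {h : ℝ}
include H

lemma IsFundDeriv.J_mid (hB : IsFundDeriv J B) (w x y : V) : B w (J x) y = B w x (J y) := by
  have := hB.anti w x (J y)
  rw [H.sq, hB.neg_right] at this
  linarith

lemma IsFundDeriv.self_J (hB : IsFundDeriv J B) (w x : V) : B w x (J x) = 0 := by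
  have := hB.J_mid H w x x
  rw [hB.skew] at this
  linarith

variable (hB : IsFundDeriv J B)
  (hE : ∀ w x y z u, curvDeriv g J D a h B w x y z u + curvDeriv g J D a h B x y w z u
    + curvDeriv g J D a h B y w x z u = 0)
include hB hE

/-- The identity is evaluated on `(w, x, Jx; z, Jz)` with `z` complex-orthogonal to `w` and `x`.
Since `z`, `Jz` are orthogonal to the first three arguments, no `D`-term survives. Dimension 6 makes
room for `z`. -/
lemma bianchi_trace_term [FiniteDimensional ℝ V] (hV : 6 ≤ Module.finrank ℝ V) {w x : V}
    (hx : g x x = 1) (hwx : CPerp g J w x) :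
    a w = h * (B x x (J w) + B (J x) (J x) (J w)) := by
  obtain ⟨z, hz1, hz⟩ := H.exists_unit_cperp ![w, x] (by omega)
  have hzw : CPerp g J z w := hz 0
  have hzx : CPerp g J z x := hz 1
  have hwz := H.cperp_symm hzw
  have hxz := H.cperp_symm hzx
  have hxw := H.cperp_symm hwx
  have e := hE w x (J x) z (J z)
  simp only [curvDeriv, H.J_left, H.sq, map_neg, hzw.1, hzw.2, hzx.1, hzx.2, hwz.1, hwz.2, hxz.1,
    hxz.2, hxw.1, hxw.2, hwx.1, hwx.2, hx, hz1, H.self_J, hB.self_J H, hB.neg_right] at e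
  have e1 : B (J x) w x = B (J x) (J x) (J w) := by
    rw [hB.anti, hB.skew]
  have e2 : B x (J x) w = B x x (J w) := hB.J_mid H _ _ _
  linear_combination (-1/2) * e + h * e1 + h * e2

/-- In a unitary frame with `e 0 = w`, the term `i = 0` of the trace at `v = Jw` vanishes, and each
of the other `n - 1` terms, multiplied by `h`, equals `a w`. So `(n-1) a w = 0`. -/
lemma bianchi_dh_eq_zero [FiniteDimensional ℝ V] {n : ℕ} (hn : 2 < n)
    (hV : 2 * n ≤ Module.finrank ℝ V)
    (htr : ∀ e, IsUnitaryFrame g J n e → ∀ v,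
      ∑ i ∈ Finset.range n, (B (e i) (e i) v + B (J (e i)) (J (e i)) v) = 0) (w : V) : a w = 0 := by
  have key : ∀ w, g w w = 1 → a w = 0 := by
    intro w hw
    obtain ⟨e, he0, he⟩ := H.exists_unitaryFrame hV (by omega) hw
    have h1 := htr e he (J w)
    obtain ⟨k, rfl⟩ : ∃ k, n = k + 1 := ⟨n - 1, by omega⟩
    rw [Finset.sum_range_succ', he0, hB.self_J H, hB.self] at h1
    have h2 : ∀ i ∈ Finset.range k,
        h * (B (e (i + 1)) (e (i + 1)) (J w) + B (J (e (i + 1))) (J (e (i + 1))) (J w)) = a w := by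
      intro i hi
      have hi := Finset.mem_range.1 hi
      rw [bianchi_trace_term H hB hE (by omega)]
      · have := he (i + 1) (by omega) (i + 1) (by omega)
        simpa using this.1
      · have := he 0 (by omega) (i + 1) (by omega)
        rw [he0] at this
        exact ⟨by simpa using this.1, this.2⟩
    have h3 := Finset.sum_congr rfl h2
    rw [← Finset.mul_sum, Finset.sum_const, Finset.card_range, nsmul_eq_mul] at h3
    have h4 : (k : ℝ) * a w = 0 := by rw [← h3]; linear_combination h * h1
    have : (k : ℝ) ≠ 0 := by
      have : k ≠ 0 := by omega
      exact_mod_cast this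
    exact (mul_eq_zero.1 h4).resolve_left this
  rcases eq_or_ne w 0 with rfl | hw0
  · simp
  have hp := H.pos w hw0
  have h1 := key ((√(g w w))⁻¹ • w) (by
    simp only [map_smul, _root_.smul_apply, smul_eq_mul]
    field_simp
    rw [Real.sq_sqrt hp.le])
  rw [map_smul, smul_eq_mul] at h1
  exact (mul_eq_zero.1 h1).resolve_left (inv_ne_zero (Real.sqrt_pos.2 hp).ne')

end Bianchi

end PointwiseAlgebra

/-! ### The Bianchi identity once `dh = 0`, and the algebra of Kähler curvature. -/

section PointwiseAlgebra

variable {V : Type*} [NormedAddCommGroup V] [NormedSpace ℝ V]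
variable {g : V →L[ℝ] V →L[ℝ] ℝ} {J : V →L[ℝ] V} (H : IsHermitianPair g J)
  {D B : V → V → V → ℝ} {a : V →L[ℝ] ℝ} {h : ℝ}
include H

lemma IsHermitianPair.exists_eq_smul_unit {x : V} (hx : x ≠ 0) :
    ∃ (t : ℝ) (x' : V), x = t • x' ∧ g x' x' = 1 := by
  have hp := H.pos x hx
  have hs := (Real.sqrt_pos.2 hp).ne'
  refine ⟨√(g x x), (√(g x x))⁻¹ • x, by rw [smul_smul, mul_inv_cancel₀ hs, one_smul], ?_⟩
  simp only [map_smul, _root_.smul_apply, smul_eq_mul]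
  field_simp
  rw [Real.sq_sqrt hp.le]

lemma IsHermitianPair.cperp_sub {w : V} (hw : g w w = 1) (v : V) :
    CPerp g J w (v - (g w v) • w - (g (J w) v) • J w) := by
  refine ⟨?_, ?_⟩
  · simp [hw, H.self_J]
  · simp only [map_sub, map_smul, H.sq, smul_neg, map_neg, H.self_J, smul_eq_mul, hw, H.J_left w v]
    ring

variable (hB : IsFundDeriv J B)
  (hE : ∀ w x y z u, curvDeriv g J D a h B w x y z u + curvDeriv g J D a h B x y w z u
    + curvDeriv g J D a h B y w x z u = 0)
include hB hE

section

variable [FiniteDimensional ℝ V] (hV : 6 ≤ Module.finrank ℝ V)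
  (ha : ∀ w, a w = 0)
include ha hV

/-- For a third direction `w`, the identity on `(w, Jw, z; Jz, Ju)` expresses `h B(z,z,u)` through
`h (B(w,w,u) + B(Jw,Jw,u))`, and this vanishes by `bianchi_trace_term` because `dh = 0`. -/
lemma bianchi_diag_of_cperp {z u : V} (hz : g z z = 1) (hzu : CPerp g J z u) :
    h * B z z u = 0 := by
  obtain ⟨w, hw1, hw⟩ := H.exists_unit_cperp ![z, u] (by omega)
  have hwz : CPerp g J w z := hw 0
  have hwu : CPerp g J w u := hw 1
  have hzw := H.cperp_symm hwz
  have huw := H.cperp_symm hwu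
  have huz := H.cperp_symm hzu
  have e1 := bianchi_trace_term H hB hE hV hw1 (H.cperp_J_left huw)
  rw [ha, H.sq, hB.neg_right, hB.neg_right] at e1
  have e := hE w (J w) z (J z) (J u)
  simp only [curvDeriv, H.J_left, H.sq, map_neg, hzw.1, hzw.2, hzu.1, hzu.2, hwz.1, hwz.2, huz.1,
    huz.2, huw.1, huw.2, hwu.1, hwu.2, hz, hw1, H.self_J, hB.self_J H, hB.neg_right, ha]
    at e
  have e2 : B w (J w) (J u) = -B w w u := hB.anti _ _ _
  have e3 : B (J w) w (J u) = B (J w) (J w) u := (hB.J_mid H _ _ _).symm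
  have e4 : B z (J z) (J u) = -B z z u := hB.anti _ _ _
  rw [e2, e3, e4] at e
  linear_combination (-1 / 2) * e + (1 / 2) * e1

lemma bianchi_diag (w v : V) : h * B w w v = 0 := by
  rcases eq_or_ne w 0 with rfl | hw0
  · have := hB.smul_left 0 0 0 v
    rw [zero_smul, zero_mul] at this
    rw [this, mul_zero]
  obtain ⟨t, w, rfl, hw⟩ := H.exists_eq_smul_unit hw0
  have h1 := bianchi_diag_of_cperp H hB hE hV ha hw (H.cperp_sub hw v)
  have h2 : v = (v - (g w v) • w - (g (J w) v) • J w) + ((g w v) • w + (g (J w) v) • J w) := by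
    abel
  rw [h2, hB.add_right, hB.add_right, hB.smul_right, hB.smul_right, hB.smul_left, hB.smul_mid,
    hB.smul_left, hB.smul_mid, hB.smul_left, hB.smul_mid, hB.self, hB.self_J H]
  linear_combination t * t * h1

/-- Polarisation of `bianchi_diag`. Together with skewness in the last two slots it makes `h B`
alternating. -/
lemma bianchi_skew (w x v : V) : h * B w x v = -(h * B x w v) := by
  have h1 := bianchi_diag H hB hE hV ha (w + x) v
  rw [hB.add_left, hB.add_mid, hB.add_mid] at h1
  linear_combination h1 - bianchi_diag H hB hE hV ha w v - bianchi_diag H hB hE hV ha x v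

/-- The identity on `(w, x, y; y, Jy)`; since `h B` is alternating, all its terms collect into one
multiple of `h B(w,x,y)`. -/
lemma bianchi_cotton {w x y : V} (hy : g y y = 1) (hwx : CPerp g J w x) (hwy : CPerp g J w y)
    (hxy : CPerp g J x y) : D w x (J y) - D x w (J y) = -8 * h * B w x y := by
  have hxw := H.cperp_symm hwx
  have hyw := H.cperp_symm hwy
  have hyx := H.cperp_symm hxy
  have e := hE w x y y (J y)
  simp only [curvDeriv, H.J_left, H.sq, map_neg, hwx.1, hwx.2, hwy.1, hwy.2, hxy.1, hxy.2, hxw.1,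
    hxw.2, hyw.1, hyw.2, hyx.1, hyx.2, hy, H.self_J, hB.self_J H, hB.neg_right, ha] at e
  have e1 := bianchi_skew H hB hE hV ha x y w
  have e2 := bianchi_skew H hB hE hV ha y w x
  have e3 := bianchi_skew H hB hE hV ha w x y
  have e4 := congrArg (h * ·) (hB.skew w x y)
  have e5 := congrArg (h * ·) (hB.skew x y w)
  have e6 := congrArg (h * ·) (hB.skew y w x)
  linarith

lemma bianchi_cotton' {w x y : V} (hy : g y y = 1) (hwx : CPerp g J w x)
    (hwy : CPerp g J w y) (hxy : CPerp g J x y) :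
    D w x y - D x w y = 8 * h * B w x (J y) := by
  have hn : ∀ {v}, CPerp g J v y → CPerp g J v (-J y) := fun {v} hv ↦
    ⟨by rw [map_neg, hv.2, neg_zero], by rw [map_neg, H.sq, neg_neg, hv.1]⟩
  have := bianchi_cotton H hB hE hV ha (y := -J y) (by simp [H.compat, hy]) hwx (hn hwy) (hn hxy)
  rw [map_neg, H.sq, neg_neg, hB.neg_right] at this
  linarith

/-- The three cyclic instances of `bianchi_cotton'` have the same right side, because `h B` is
alternating and `J` moves freely between the last two slots. Their left sides add up to zero by the
symmetry of `D`. -/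
lemma bianchi_triple_of_unit (hD : ∀ w x y, D w x y = D w y x) {w x y : V}
    (hw : g w w = 1) (hx : g x x = 1) (hy : g y y = 1)
    (hwx : CPerp g J w x) (hwy : CPerp g J w y) (hxy : CPerp g J x y) :
    h * B w x (J y) = 0 := by
  have hxw := H.cperp_symm hwx
  have hyw := H.cperp_symm hwy
  have hyx := H.cperp_symm hxy
  have sk := bianchi_skew H hB hE hV ha
  have e1 := bianchi_cotton' H hB hE hV ha hy hwx hwy hxy
  have e2 := bianchi_cotton' H hB hE hV ha hw hxy hxw hyw
  have e3 := bianchi_cotton' H hB hE hV ha hx hyw hyx hwx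
  rw [hD w x y, hD x w y] at e1
  rw [hD y x w] at e2
  have f1 : h * B y w (J x) = h * B w x (J y) := by
    rw [sk, hB.skew, hB.J_mid H, mul_neg, neg_neg]
  have f2 : h * B x y (J w) = h * B y w (J x) := by
    rw [hB.skew, mul_neg, sk, neg_neg, hB.skew, mul_neg, sk, neg_neg, hB.J_mid H]
  linarith

/-- Reduction to complex-orthogonal unit triples. The components of `x`, `y` along `w`, `Jw`, and
then of `y` along `x`, `Jx`, only produce terms in which two arguments lie on one complex line, and
these vanish. -/
lemma bianchi_fundDeriv_eq_zero (hD : ∀ w x y, D w x y = D w y x) (w x y : V) :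
    h * B w x y = 0 := by
  have diag := bianchi_diag H hB hE hV ha
  have sk := bianchi_skew H hB hE hV ha
  have z1 : ∀ w x, h * B w x w = 0 := fun w x ↦ by rw [hB.skew, mul_neg, diag, neg_zero]
  have z2 : ∀ w y, h * B w (J w) y = 0 := fun w y ↦ by rw [hB.J_mid H, diag]
  have z3 : ∀ w x, h * B w x (J w) = 0 := fun w x ↦ by rw [← hB.J_mid H, z1]
  have zero_left : ∀ x y, B 0 x y = 0 := fun x y ↦ by simpa using hB.smul_left 0 0 x y
  have zero_mid : ∀ w y, B w 0 y = 0 := fun w y ↦ by simpa using hB.smul_mid 0 w 0 y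
  have zero_right : ∀ w x, B w x 0 = 0 := fun w x ↦ by simpa using hB.smul_right 0 w x 0
  have s1 : ∀ w x y, CPerp g J w x → CPerp g J w y → CPerp g J x y → h * B w x y = 0 := by
    intro w x y hwx hwy hxy
    rcases eq_or_ne w 0 with rfl | hw0
    · rw [zero_left, mul_zero]
    rcases eq_or_ne x 0 with rfl | hx0
    · rw [zero_mid, mul_zero]
    rcases eq_or_ne y 0 with rfl | hy0
    · rw [zero_right, mul_zero]
    obtain ⟨r, w', rfl, hw⟩ := H.exists_eq_smul_unit hw0
    obtain ⟨s, x', rfl, hx⟩ := H.exists_eq_smul_unit hx0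
    obtain ⟨t, y', rfl, hy⟩ := H.exists_eq_smul_unit hy0
    have hr : r ≠ 0 := by rintro rfl; simp at hw0
    have hs : s ≠ 0 := by rintro rfl; simp at hx0
    have ht : t ≠ 0 := by rintro rfl; simp at hy0
    have red : ∀ {a b : V} {r s : ℝ}, r ≠ 0 → s ≠ 0 → CPerp g J (r • a) (s • b) →
        CPerp g J a b := by
      intro a b r s hr hs hab
      have h1 := hab.1
      have h2 := hab.2
      simp only [map_smul, _root_.smul_apply, smul_eq_mul] at h1 h2
      exact ⟨by simpa [hr, hs] using h1, by simpa [hr, hs] using h2⟩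
    have := bianchi_triple_of_unit H hB hE hV ha hD (y := J y') hw hx (by rw [H.compat, hy])
      (red hr hs hwx) (H.cperp_J_right (red hr ht hwy)) (H.cperp_J_right (red hs ht hxy))
    rw [H.sq, hB.neg_right] at this
    rw [hB.smul_left, hB.smul_mid, hB.smul_right]
    linear_combination -r * s * t * this
  have s2 : ∀ w x y, CPerp g J w x → CPerp g J w y → h * B w x y = 0 := by
    intro w x y hwx hwy
    rcases eq_or_ne x 0 with rfl | hx0
    · rw [zero_mid, mul_zero]
    obtain ⟨s, x, rfl, hx⟩ := H.exists_eq_smul_unit hx0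
    have hs : s ≠ 0 := by rintro rfl; simp at hx0
    have hwx' : CPerp g J w x := by
      have h1 := hwx.1
      have h2 := hwx.2
      simp only [map_smul, smul_eq_mul] at h1 h2
      exact ⟨by simpa [hs] using h1, by simpa [hs] using h2⟩
    have h1 := s1 w x (y - (g x y) • x - (g (J x) y) • J x) hwx' (by
      have h2 := hwx'.1
      have h3 := hwx'.2
      have h4 := hwy.1
      have h5 := hwy.2
      constructor <;> simp [h2, h3, h4, h5, H.sq]) (H.cperp_sub hx y)
    have h2 : y = (y - (g x y) • x - (g (J x) y) • J x) + ((g x y) • x + (g (J x) y) • J x) := by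
      abel
    rw [h2, hB.smul_mid, hB.add_right, hB.add_right, hB.smul_right, hB.smul_right, hB.self,
      hB.self_J H]
    linear_combination s * h1
  rcases eq_or_ne w 0 with rfl | hw0
  · rw [zero_left, mul_zero]
  obtain ⟨r, w, rfl, hw⟩ := H.exists_eq_smul_unit hw0
  have h1 := s2 w _ _ (H.cperp_sub hw x) (H.cperp_sub hw y)
  have h2 : x = (x - (g w x) • w - (g (J w) x) • J w) + ((g w x) • w + (g (J w) x) • J w) := by
    abel
  have h3 : y = (y - (g w y) • w - (g (J w) y) • J w) + ((g w y) • w + (g (J w) y) • J w) := by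
    abel
  set x' := x - (g w x) • w - (g (J w) x) • J w
  set y' := y - (g w y) • w - (g (J w) y) • J w
  rw [h2, h3, hB.smul_left]
  simp only [hB.add_mid, hB.add_right, hB.smul_mid, hB.smul_right, hB.self, hB.self_J H]
  linear_combination r * h1 + r * g w x * diag w y' + r * g (J w) x * z2 w y'
    + r * g w y * z1 w x' + r * g (J w) y * z3 w x' + r * g (J w) x * g w y * z2 w w
end

omit hB hE

lemma IsHermitianPair.exists_unit_perp [FiniteDimensional ℝ V] {k : ℕ} (v : Fin k → V)
    (hk : k < Module.finrank ℝ V) : ∃ z, g z z = 1 ∧ ∀ i, g z (v i) = 0 := by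
  let L : V →ₗ[ℝ] (Fin k → ℝ) := LinearMap.pi fun i ↦ ((g (v i) : V →L[ℝ] ℝ) : V →ₗ[ℝ] ℝ)
  have hL : LinearMap.ker L ≠ ⊥ := by
    apply LinearMap.ker_ne_bot_of_finrank_lt
    simpa using hk
  obtain ⟨z, hz, hz0⟩ := (Submodule.ne_bot_iff _).1 hL
  rw [LinearMap.mem_ker] at hz
  obtain ⟨t, z', rfl, hz'⟩ := H.exists_eq_smul_unit hz0
  have ht : t ≠ 0 := by rintro rfl; simp at hz0
  refine ⟨z', hz', fun i ↦ ?_⟩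
  have h1 : g (v i) (t • z') = 0 := congrFun hz i
  rw [H.symm]
  simpa [ht] using h1

/-- Taking `u = x`, a unit vector orthogonal to `w`, `y`, `z`, writes the skew part of `D` through
the values `D w x x - D x w x`. Such a value changes sign between any two orthonormal vectors
orthogonal to `w`; three of these force it to be zero. -/
lemma bianchi_cotton_eq_zero [FiniteDimensional ℝ V] (hV : 6 ≤ Module.finrank ℝ V)
    (ha : ∀ w, a w = 0)
    (hE : ∀ w x y z u, curvDeriv g J D a 0 B w x y z u + curvDeriv g J D a 0 B x y w z u
      + curvDeriv g J D a 0 B y w x z u = 0) (w y z : V) : D w y z = D y w z := by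
  have formula : ∀ {x w y z}, g x x = 1 → g x w = 0 → g x y = 0 → g x z = 0 →
      D w y z - D y w z = g y z * (D x w x - D w x x) + g w z * (D y x x - D x y x) := by
    intro x w y z hx hw hy hz
    have e := hE w x y z x
    simp only [curvDeriv, ha, hx, hw, hy, hz, H.symm w x, H.symm y x] at e
    linear_combination e
  have swap : ∀ {w x y}, g x x = 1 → g y y = 1 → g x w = 0 → g x y = 0 → g y w = 0 →
      D w y y - D y w y = -(D w x x - D x w x) := by
    intro w x y hx hy hxw hxy hyw
    have := formula hx hxw hxy hxy
    rw [hy, H.symm w y, hyw] at this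
    linear_combination this
  have zero : ∀ {w y}, g y y = 1 → g y w = 0 → D w y y - D y w y = 0 := by
    intro w y hy hyw
    obtain ⟨x, hx, hx'⟩ := H.exists_unit_perp ![w, y] (by omega)
    obtain ⟨v, hv, hv'⟩ := H.exists_unit_perp ![w, y, x] (by omega)
    have hxw : g x w = 0 := hx' 0
    have hxy : g x y = 0 := hx' 1
    have hvw : g v w = 0 := hv' 0
    have hvy : g v y = 0 := hv' 1
    have hvx : g v x = 0 := hv' 2
    linarith [swap hx hy hxw hxy hyw, swap hv hy hvw hvy hyw, swap hv hx hvw hvx hxw]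
  obtain ⟨x, hx, hx'⟩ := H.exists_unit_perp ![w, y, z] (by omega)
  have hxw : g x w = 0 := hx' 0
  have hxy : g x y = 0 := hx' 1
  have hxz : g x z = 0 := hx' 2
  linear_combination formula hx hxw hxy hxz - g y z * zero hx hxw + g w z * zero hx hxy

/-- If `φ(Q) + h π₂` has the symmetry of the curvature of a Kähler metric, then `Q = ½ h g`. -/
lemma eq_half_smul_metric_of_kahler_symmetry [FiniteDimensional ℝ V]
    (hV : 6 ≤ Module.finrank ℝ V) {Q : V →L[ℝ] V →L[ℝ] ℝ} (hQ : ∀ x y, Q x y = Q y x)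
    (hK : ∀ x y z u, phi g Q x y (J z) (J u) + h * pi2 g J x y (J z) (J u)
      = phi g Q x y z u + h * pi2 g J x y z u) (x y : V) : Q x y = h / 2 * g x y := by
  -- At `z = y`, `u = x` one side reduces to `h`, coming from `π₂`, and the other to `Q y y + Q x
  -- x`. Three mutually complex-orthogonal unit vectors then determine each value.
  have pair : ∀ {x y}, g x x = 1 → g y y = 1 → CPerp g J x y →
      Q y y + Q x x = h := by
    intro x y hx hy hxy
    have hyx := H.cperp_symm hxy
    have e := hK x y y x
    simp only [phi, pi2, psi, H.J_left, H.sq, map_neg, hx, hy, hxy.1, hxy.2, hyx.1, hyx.2,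
      H.self_J] at e
    linear_combination -e
  have unit : ∀ {x}, g x x = 1 → Q x x = h / 2 := by
    intro x hx
    obtain ⟨y, hy, hy'⟩ := H.exists_unit_cperp ![x] (by omega)
    obtain ⟨z, hz, hz'⟩ := H.exists_unit_cperp ![x, y] (by omega)
    linarith [pair hy hx (hy' 0), pair hz hx (hz' 0), pair hz hy (hz' 1)]
  have diag : ∀ x, Q x x = h / 2 * g x x := by
    intro x
    rcases eq_or_ne x 0 with rfl | hx0
    · simp
    obtain ⟨t, x, rfl, hx⟩ := H.exists_eq_smul_unit hx0
    simp [unit hx, hx]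
    ring
  have h1 := diag (x + y)
  simp only [map_add, _root_.add_apply, hQ y x, H.symm y x, diag x, diag y] at h1
  linarith

/-- Here `φ(Q) = h π₁`. On a holomorphic plane `π₁` contributes 1 and `π₂` contributes 3. -/
lemma hol_sectional_of_eq {Q : V →L[ℝ] V →L[ℝ] ℝ} (hQ : ∀ x y, Q x y = h / 2 * g x y) {x : V}
    (hx : x ≠ 0) :
    (phi g Q x (J x) (J x) x + h * pi2 g J x (J x) (J x) x)
      / (g x x * g (J x) (J x) - g x (J x) ^ 2) = 4 * h := by
  have hp := (H.pos x hx).ne'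
  simp only [phi, pi2, psi, hQ, H.J_left, H.sq, map_neg, H.self_J]
  field_simp
  ring

end PointwiseAlgebra

/-! ### Connections and curvature on an open subset of a vector space. -/

section LocalGeometry

variable {E : Type*} [NormedAddCommGroup E] [NormedSpace ℝ E]
  {F : Type*} [NormedAddCommGroup F] [NormedSpace ℝ F]

/-- Tensor fields are differentiated along lines, on fixed vectors. An identity valid on `Ω` is then
differentiated by uniqueness of the derivative at `t = 0`. -/
lemma hasDerivAt_line {f : E → F} {y : E} (hf : DifferentiableAt ℝ f y) (a : E) :
    HasDerivAt (fun t : ℝ ↦ f (y + t • a)) (fderiv ℝ f y a) 0 := by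
  have h1 : HasDerivAt (fun t : ℝ ↦ y + t • a) a 0 := by
    simpa using ((hasDerivAt_id (0 : ℝ)).smul_const a).const_add y
  have h2 : HasFDerivAt f (fderiv ℝ f y) (y + (0 : ℝ) • a) := by simpa using hf.hasFDerivAt
  exact h2.comp_hasDerivAt 0 h1

lemma eventually_line {Ω : Set E} (hΩ : IsOpen Ω) {y : E} (hy : y ∈ Ω) (a : E) :
    ∀ᶠ t : ℝ in 𝓝 0, y + t • a ∈ Ω := by
  have h1 : Continuous (fun t : ℝ ↦ y + t • a) := by fun_prop
  have h2 : (fun t : ℝ ↦ y + t • a) 0 ∈ Ω := by simpa using hy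
  exact h1.continuousAt.preimage_mem_nhds (hΩ.mem_nhds h2)

lemma hasDerivAt_line_of_eqOn {Ω : Set E} (hΩ : IsOpen Ω) {f g : E → F} (h : Set.EqOn f g Ω)
    {y : E} (hy : y ∈ Ω) {a : E} {f' : F} (hf : HasDerivAt (fun t : ℝ ↦ f (y + t • a)) f' 0) :
    HasDerivAt (fun t : ℝ ↦ g (y + t • a)) f' 0 := by
  refine hf.congr_of_eventuallyEq ?_
  filter_upwards [eventually_line hΩ hy a] with t ht
  exact (h ht).symm

lemma fderiv_fderiv_comm {Ω : Set E} (hΩ : IsOpen Ω) {f : E → F} (hf : ContDiffOn ℝ ∞ f Ω)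
    {y : E} (hy : y ∈ Ω) (a b : E) :
    fderiv ℝ (fderiv ℝ f) y a b = fderiv ℝ (fderiv ℝ f) y b a := by
  have h := (hf.contDiffAt (hΩ.mem_nhds hy)).isSymmSndFDerivAt (by simpa using ENat.LEInfty.out)
  exact h a b

lemma differentiableAt_of_contDiffOn {Ω : Set E} (hΩ : IsOpen Ω) {f : E → F}
    (hf : ContDiffOn ℝ ∞ f Ω) {y : E} (hy : y ∈ Ω) : DifferentiableAt ℝ f y :=
  (hf.contDiffAt (hΩ.mem_nhds hy)).differentiableAt (by simp)

lemma contDiffOn_fderiv {Ω : Set E} (hΩ : IsOpen Ω) {f : E → F}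
    (hf : ContDiffOn ℝ ∞ f Ω) : ContDiffOn ℝ ∞ (fderiv ℝ f) Ω :=
  hf.fderiv_of_isOpen hΩ (by simp)

/-- `Γ` is the Levi-Civita connection of the metric `G` on the open set `Ω`. -/
structure IsLeviCivita (Ω : Set E) (G : E → E →L[ℝ] E →L[ℝ] ℝ) (Γ : E → E →L[ℝ] E →L[ℝ] E) :
    Prop where
  isOpen : IsOpen Ω
  contDiffOn_metric : ContDiffOn ℝ ∞ G Ω
  contDiffOn_conn : ContDiffOn ℝ ∞ Γ Ω
  metric_symm : ∀ y ∈ Ω, ∀ u v, G y u v = G y v u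
  metric_pos : ∀ y ∈ Ω, ∀ u, u ≠ 0 → 0 < G y u u
  conn_symm : ∀ y ∈ Ω, ∀ u v, Γ y u v = Γ y v u
  compat : ∀ y ∈ Ω, ∀ w u v, fderiv ℝ G y w u v = G y (Γ y w u) v + G y u (Γ y w v)

/-- The curvature operator of the connection `Γ`. -/
noncomputable def curvOp (Γ : E → E →L[ℝ] E →L[ℝ] E) (y u v w : E) : E :=
  fderiv ℝ Γ y u v w - fderiv ℝ Γ y v u w + Γ y u (Γ y v w) - Γ y v (Γ y u w)

/-- The covariant derivative `(∇_w T)(u, v)` of a bilinear form. -/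
noncomputable def covForm (Γ : E → E →L[ℝ] E →L[ℝ] E) (T : E → E →L[ℝ] E →L[ℝ] ℝ)
    (y w u v : E) : ℝ :=
  fderiv ℝ T y w u v - T y (Γ y w u) v - T y u (Γ y w v)

/-- The covariant derivative `(∇_w J) u` of an endomorphism. -/
noncomputable def covEnd (Γ : E → E →L[ℝ] E →L[ℝ] E) (J : E → E →L[ℝ] E) (y w u : E) : E :=
  fderiv ℝ J y w u + Γ y w (J y u) - J y (Γ y w u)

variable {Ω : Set E} {G : E → E →L[ℝ] E →L[ℝ] ℝ} {Γ : E → E →L[ℝ] E →L[ℝ] E}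

lemma hasDerivAt_line_apply₂ {T : E → E →L[ℝ] E →L[ℝ] F} {y : E} (hT : DifferentiableAt ℝ T y)
    (a : E) {u v : ℝ → E} {u' v' : E} (hu : HasDerivAt u u' 0) (hv : HasDerivAt v v' 0) :
    HasDerivAt (fun t : ℝ ↦ T (y + t • a) (u t) (v t))
      (fderiv ℝ T y a (u 0) (v 0) + T y u' (v 0) + T y (u 0) v') 0 := by
  have := ((hasDerivAt_line hT a).clm_apply hu).clm_apply hv
  simpa using this

lemma pi2_eq (g : E →L[ℝ] E →L[ℝ] ℝ) (J : E →L[ℝ] E) (x y z u : E) :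
    pi2 g J x y z u
      = g x (J u) * g y (J z) - g x (J z) * g y (J u) - 2 * (g x (J y) * g z (J u)) := by
  rw [pi2, psi]; ring

lemma curvOp_swap (y a b w : E) : curvOp Γ y a b w = -curvOp Γ y b a w := by
  rw [curvOp, curvOp]; abel

/-- The left side is the ordinary derivative of `φ(Q) + h π₂` on constant vectors, with the
derivative of the metric already expressed by `γ = Γ_a`. The right side splits it into the four
terms with `γ` applied to one argument and the covariant derivative. -/
lemma curvDeriv_leibniz (g q q' : E →L[ℝ] E →L[ℝ] ℝ) (j j' γ : E →L[ℝ] E) (h' h : ℝ)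
    (a b c w z : E) :
    (g (γ b) z + g b (γ z)) * q c w + g b z * q' c w
      - ((g (γ b) w + g b (γ w)) * q c z + g b w * q' c z)
      + ((g (γ c) w + g c (γ w)) * q b z + g c w * q' b z)
      - ((g (γ c) z + g c (γ z)) * q b w + g c z * q' b w)
      + (h' * (g b (j z) * g c (j w) - g b (j w) * g c (j z) - 2 * (g b (j c) * g w (j z)))
        + h * ((g (γ b) (j z) + g b (γ (j z)) + g b (j' z)) * g c (j w)
            + g b (j z) * (g (γ c) (j w) + g c (γ (j w)) + g c (j' w))
          - ((g (γ b) (j w) + g b (γ (j w)) + g b (j' w)) * g c (j z)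
            + g b (j w) * (g (γ c) (j z) + g c (γ (j z)) + g c (j' z)))
          - 2 * ((g (γ b) (j c) + g b (γ (j c)) + g b (j' c)) * g w (j z)
            + g b (j c) * (g (γ w) (j z) + g w (γ (j z)) + g w (j' z)))))
    = (phi g q b c w (γ z) + h * pi2 g j b c w (γ z))
      + (phi g q b c (γ w) z + h * pi2 g j b c (γ w) z)
      + (phi g q (γ b) c w z + h * pi2 g j (γ b) c w z)
      + (phi g q b (γ c) w z + h * pi2 g j b (γ c) w z)
      + curvDeriv g j (fun _ x u ↦ q' x u - q (γ x) u - q x (γ u)) (fun _ ↦ h') h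
        (fun _ x u ↦ g x (j' u + γ (j u) - j (γ u))) a b c w z := by
  simp only [curvDeriv, phi, pi2_eq, map_add, map_sub]
  ring

namespace IsLeviCivita

variable (L : IsLeviCivita Ω G Γ)
include L

lemma differentiableAt_conn {y : E} (hy : y ∈ Ω) : DifferentiableAt ℝ Γ y :=
  differentiableAt_of_contDiffOn L.isOpen L.contDiffOn_conn hy

lemma differentiableAt_metric {y : E} (hy : y ∈ Ω) : DifferentiableAt ℝ G y :=
  differentiableAt_of_contDiffOn L.isOpen L.contDiffOn_metric hy

lemma hasDerivAt_conn_conn {y : E} (hy : y ∈ Ω) (a b c w : E) :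
    HasDerivAt (fun t : ℝ ↦ Γ (y + t • a) b (Γ (y + t • a) c w))
      (fderiv ℝ Γ y a b (Γ y c w) + Γ y b (fderiv ℝ Γ y a c w)) 0 := by
  have hΓ := L.differentiableAt_conn hy
  have h1 := hasDerivAt_line_apply₂ hΓ a (hasDerivAt_const 0 c) (hasDerivAt_const 0 w)
  have h2 := hasDerivAt_line_apply₂ hΓ a (hasDerivAt_const 0 b) h1
  simpa using h2

lemma hasDerivAt_curvOp {y : E} (hy : y ∈ Ω) (a b c w : E) :
    HasDerivAt (fun t : ℝ ↦ curvOp Γ (y + t • a) b c w)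
      (fderiv ℝ (fderiv ℝ Γ) y a b c w - fderiv ℝ (fderiv ℝ Γ) y a c b w
        + (fderiv ℝ Γ y a b (Γ y c w) + Γ y b (fderiv ℝ Γ y a c w))
        - (fderiv ℝ Γ y a c (Γ y b w) + Γ y c (fderiv ℝ Γ y a b w))) 0 := by
  have hΓ' := differentiableAt_of_contDiffOn L.isOpen (contDiffOn_fderiv L.isOpen L.contDiffOn_conn)
    hy
  have h3 : ∀ b c, HasDerivAt (fun t : ℝ ↦ fderiv ℝ Γ (y + t • a) b c w)
      (fderiv ℝ (fderiv ℝ Γ) y a b c w) 0 := by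
    intro b c
    have := (((hasDerivAt_line hΓ' a).clm_apply (hasDerivAt_const 0 b)).clm_apply
      (hasDerivAt_const 0 c)).clm_apply (hasDerivAt_const 0 w)
    simpa using this
  exact (((h3 b c).sub (h3 c b)).add (L.hasDerivAt_conn_conn hy a b c w)).sub
    (L.hasDerivAt_conn_conn hy a c b w)

/-- A parallel bilinear form is annihilated by the curvature. -/
lemma curvOp_parallel {T : E → E →L[ℝ] E →L[ℝ] ℝ} (hT : ContDiffOn ℝ ∞ T Ω)
    (hpar : ∀ y ∈ Ω, ∀ w u v, covForm Γ T y w u v = 0) {y : E} (hy : y ∈ Ω) (a b u v : E) :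
    T y (curvOp Γ y a b u) v + T y u (curvOp Γ y a b v) = 0 := by
  have hT1 := differentiableAt_of_contDiffOn L.isOpen hT hy
  have hT2 := differentiableAt_of_contDiffOn L.isOpen (contDiffOn_fderiv L.isOpen hT) hy
  have hΓ := L.differentiableAt_conn hy
  have hpar' : ∀ y ∈ Ω, ∀ w u v, fderiv ℝ T y w u v = T y (Γ y w u) v + T y u (Γ y w v) := by
    intro y hy w u v
    have := hpar y hy w u v
    rw [covForm] at this
    linarith
  -- The equation for a parallel form is differentiated once more. Second derivatives of `T` are
  -- symmetric in `a`, `b`, and exchanging these leaves exactly the curvature terms.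
  have key : ∀ a b, fderiv ℝ (fderiv ℝ T) y a b u v =
      fderiv ℝ T y a (Γ y b u) v + T y (fderiv ℝ Γ y a b u) v
        + (fderiv ℝ T y a u (Γ y b v) + T y u (fderiv ℝ Γ y a b v)) := by
    intro a b
    have h1 : HasDerivAt (fun t : ℝ ↦ fderiv ℝ T (y + t • a) b u v)
        (fderiv ℝ (fderiv ℝ T) y a b u v) 0 := by
      have := (((hasDerivAt_line hT2 a).clm_apply (hasDerivAt_const 0 b)).clm_apply
        (hasDerivAt_const 0 u)).clm_apply (hasDerivAt_const 0 v)
      simpa using this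
    have hΓw : ∀ w, HasDerivAt (fun t : ℝ ↦ Γ (y + t • a) b w) (fderiv ℝ Γ y a b w) 0 := by
      intro w
      simpa using hasDerivAt_line_apply₂ hΓ a (hasDerivAt_const 0 b) (hasDerivAt_const 0 w)
    have h2 := (hasDerivAt_line_apply₂ hT1 a (hΓw u) (hasDerivAt_const 0 v)).add
      (hasDerivAt_line_apply₂ hT1 a (hasDerivAt_const 0 u) (hΓw v))
    have h3 := hasDerivAt_line_of_eqOn L.isOpen
      (f := fun y ↦ fderiv ℝ T y b u v) (g := fun y ↦ T y (Γ y b u) v + T y u (Γ y b v))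
      (fun z hz ↦ hpar' z hz b u v) hy h1
    have := h3.unique h2
    simpa using this
  have h1 := key a b
  have h2 := key b a
  rw [hpar' y hy, hpar' y hy] at h1 h2
  have h3 : fderiv ℝ (fderiv ℝ T) y a b u v = fderiv ℝ (fderiv ℝ T) y b a u v := by
    rw [fderiv_fderiv_comm L.isOpen hT hy]
  simp only [curvOp, map_add, map_sub, _root_.add_apply, _root_.sub_apply]
  linarith

lemma curvOp_skew {y : E} (hy : y ∈ Ω) (a b u v : E) :
    G y (curvOp Γ y a b u) v = -G y (curvOp Γ y a b v) u := by
  have := L.curvOp_parallel L.contDiffOn_metric (fun y hy w u v ↦ by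
    rw [covForm, L.compat y hy]; ring) hy a b u v
  rw [L.metric_symm y hy u] at this
  linarith

/-- This is `d^∇ R = 0` for `R` as an endomorphism-valued 2-form: `Γ` corrects only the action on
`w`, not the form slots, so the symmetry of `Γ` plays no role. Second derivatives of `Γ` cancel in
pairs. -/
lemma bianchi_second {y : E} (hy : y ∈ Ω) (a b c w : E) {k : E → E → E → E → E}
    (hk : ∀ a b c w, HasDerivAt (fun t : ℝ ↦ curvOp Γ (y + t • a) b c w) (k a b c w) 0) :
    (k a b c w + Γ y a (curvOp Γ y b c w) - curvOp Γ y b c (Γ y a w))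
      + (k b c a w + Γ y b (curvOp Γ y c a w) - curvOp Γ y c a (Γ y b w))
      + (k c a b w + Γ y c (curvOp Γ y a b w) - curvOp Γ y a b (Γ y c w)) = 0 := by
  rw [(hk a b c w).unique (L.hasDerivAt_curvOp hy a b c w),
    (hk b c a w).unique (L.hasDerivAt_curvOp hy b c a w),
    (hk c a b w).unique (L.hasDerivAt_curvOp hy c a b w)]
  rw [fderiv_fderiv_comm L.isOpen L.contDiffOn_conn hy b a,
    fderiv_fderiv_comm L.isOpen L.contDiffOn_conn hy c a,
    fderiv_fderiv_comm L.isOpen L.contDiffOn_conn hy c b]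
  simp only [curvOp, map_add, map_sub]
  abel

/-- The second Bianchi identity for a metric whose curvature is `φ(Q) + h π₂`. -/
theorem bianchi_curvDeriv {Q : E → E →L[ℝ] E →L[ℝ] ℝ} {J : E → E →L[ℝ] E} {h : E → ℝ}
    {y : E} (hy : y ∈ Ω) (hQ : DifferentiableAt ℝ Q y) (hJ : DifferentiableAt ℝ J y)
    (hh : DifferentiableAt ℝ h y)
    (hR : ∀ y ∈ Ω, ∀ b c w z, G y (curvOp Γ y b c w) z
      = phi (G y) (Q y) b c w z + h y * pi2 (G y) (J y) b c w z) (a b c w z : E) :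
    curvDeriv (G y) (J y) (covForm Γ Q y) (fderiv ℝ h y) (h y)
        (fun w x u ↦ G y x (covEnd Γ J y w u)) a b c w z
      + curvDeriv (G y) (J y) (covForm Γ Q y) (fderiv ℝ h y) (h y)
        (fun w x u ↦ G y x (covEnd Γ J y w u)) b c a w z
      + curvDeriv (G y) (J y) (covForm Γ Q y) (fderiv ℝ h y) (h y)
        (fun w x u ↦ G y x (covEnd Γ J y w u)) c a b w z = 0 := by
  have hG := L.differentiableAt_metric hy
  have key : ∀ a b c,
      G y (fderiv ℝ (fderiv ℝ Γ) y a b c w - fderiv ℝ (fderiv ℝ Γ) y a c b w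
        + (fderiv ℝ Γ y a b (Γ y c w) + Γ y b (fderiv ℝ Γ y a c w))
        - (fderiv ℝ Γ y a c (Γ y b w) + Γ y c (fderiv ℝ Γ y a b w))) z
        + G y (Γ y a (curvOp Γ y b c w)) z - G y (curvOp Γ y b c (Γ y a w)) z
      = curvDeriv (G y) (J y) (covForm Γ Q y) (fderiv ℝ h y) (h y)
        (fun w x u ↦ G y x (covEnd Γ J y w u)) a b c w z
        + G y (curvOp Γ y (Γ y a b) c w) z + G y (curvOp Γ y b (Γ y a c) w) z := by
    intro a b c
    have h0 := hasDerivAt_line_apply₂ hG a (L.hasDerivAt_curvOp hy a b c w)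
      (hasDerivAt_const (0 : ℝ) z)
    simp only [zero_smul, add_zero, map_zero] at h0
    rw [L.compat y hy] at h0
    have dG : ∀ x u, HasDerivAt (fun t : ℝ ↦ G (y + t • a) x u)
        (G y (Γ y a x) u + G y x (Γ y a u)) 0 := by
      intro x u
      have := hasDerivAt_line_apply₂ hG a (hasDerivAt_const (0 : ℝ) x) (hasDerivAt_const (0 : ℝ) u)
      simpa [L.compat y hy] using this
    have dQ : ∀ x u, HasDerivAt (fun t : ℝ ↦ Q (y + t • a) x u) (fderiv ℝ Q y a x u) 0 := by
      intro x u
      have := hasDerivAt_line_apply₂ hQ a (hasDerivAt_const (0 : ℝ) x) (hasDerivAt_const (0 : ℝ) u)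
      simpa using this
    have dF : ∀ x u, HasDerivAt (fun t : ℝ ↦ G (y + t • a) x (J (y + t • a) u))
        (G y (Γ y a x) (J y u) + G y x (Γ y a (J y u)) + G y x (fderiv ℝ J y a u)) 0 := by
      intro x u
      have := hasDerivAt_line_apply₂ hG a (hasDerivAt_const (0 : ℝ) x)
        ((hasDerivAt_line hJ a).clm_apply (hasDerivAt_const (0 : ℝ) u))
      simpa [L.compat y hy] using this
    have dh := hasDerivAt_line hh a
    have h1 := (((((dG b z).mul (dQ c w)).sub ((dG b w).mul (dQ c z))).add
      ((dG c w).mul (dQ b z))).sub ((dG c z).mul (dQ b w))).add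
      (dh.mul ((((dF b z).mul (dF c w)).sub ((dF b w).mul (dF c z))).sub
        (((dF b c).mul (dF w z)).const_mul 2)))
    have h2 := hasDerivAt_line_of_eqOn L.isOpen
      (f := fun y ↦ G y (curvOp Γ y b c w) z)
      (g := fun y ↦ G y b z * Q y c w - G y b w * Q y c z + G y c w * Q y b z - G y c z * Q y b w
        + h y * (G y b (J y z) * G y c (J y w) - G y b (J y w) * G y c (J y z)
          - 2 * (G y b (J y c) * G y w (J y z))))
      (fun y hy ↦ by simp only [hR y hy, phi, pi2_eq]) hy h0
    have h3 := h2.unique h1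
    simp only [zero_smul, add_zero, Pi.mul_apply, Pi.sub_apply] at h3
    have h5 := h3.trans (curvDeriv_leibniz (G y) (Q y) (fderiv ℝ Q y a) (J y) (fderiv ℝ J y a)
      (Γ y a) (fderiv ℝ h y a) (h y) a b c w z)
    have h4 := hR y hy
    rw [← h4, ← h4, ← h4, ← h4] at h5
    change _ = G y (curvOp Γ y b c w) (Γ y a z) + G y (curvOp Γ y b c (Γ y a w)) z
      + G y (curvOp Γ y (Γ y a b) c w) z + G y (curvOp Γ y b (Γ y a c) w) z
      + curvDeriv (G y) (J y) (covForm Γ Q y) (fderiv ℝ h y) (h y)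
        (fun w x u ↦ G y x (covEnd Γ J y w u)) a b c w z at h5
    linarith only [h5]
  have h1 := congrArg (fun v ↦ G y v z) (L.bianchi_second hy a b c w (L.hasDerivAt_curvOp hy))
  simp only [map_add, _root_.add_apply, map_sub, _root_.sub_apply, map_zero, _root_.zero_apply] at h1
  have k1 := key a b c
  have k2 := key b c a
  have k3 := key c a b
  -- The corrections in the form slots, such as `R(Γ_a b, c)`, cancel in the cyclic sum because `Γ`
  -- is symmetric and `R` is skew.
  rw [L.conn_symm y hy b a, curvOp_swap y c (Γ y a b)] at k2
  rw [L.conn_symm y hy c a, L.conn_symm y hy c b, curvOp_swap y (Γ y a c) b,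
    curvOp_swap y a (Γ y b c)] at k3
  simp only [map_add, _root_.add_apply, map_sub, _root_.sub_apply, map_neg, _root_.neg_apply]
    at k1 k2 k3
  linear_combination h1 - k1 - k2 - k3

end IsLeviCivita

end LocalGeometry

/-! ### Almost Hermitian structures with the prescribed curvature, locally. -/

section LocalGeometry

variable {E : Type*} [NormedAddCommGroup E] [NormedSpace ℝ E]

-- The algebra behind the uniqueness of the Levi-Civita connection: applying the two symmetries
-- alternately returns to the start with the opposite sign.
omit [NormedAddCommGroup E] [NormedSpace ℝ E] in
lemma eq_zero_of_symm_of_skew {t : E → E → E → ℝ} (hs : ∀ u v w, t u v w = t v u w)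
    (hk : ∀ u v w, t u v w = -t u w v) (u v w : E) : t u v w = 0 := by
  linarith [hs u v w, hk v u w, hs v w u, hk w v u, hs w u v, hk u w v]

/-- An almost Hermitian structure `(G, J)` with Levi-Civita connection `Γ` on the open set `Ω`
whose curvature is `φ(Q) + h π₂`. -/
structure HasLocalCurvatureForm (Ω : Set E) (G : E → E →L[ℝ] E →L[ℝ] ℝ)
    (Γ : E → E →L[ℝ] E →L[ℝ] E) (J : E → E →L[ℝ] E) (Q : E → E →L[ℝ] E →L[ℝ] ℝ) (h : E → ℝ) :
    Prop extends IsLeviCivita Ω G Γ where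
  contDiffOn_J : ContDiffOn ℝ ∞ J Ω
  contDiffOn_Q : ContDiffOn ℝ ∞ Q Ω
  contDiffOn_h : ContDiffOn ℝ ∞ h Ω
  hermitian : ∀ y ∈ Ω, IsHermitianPair (G y) (J y)
  Q_symm : ∀ y ∈ Ω, ∀ u v, Q y u v = Q y v u
  curvature_eq : ∀ y ∈ Ω, ∀ b c w z, G y (curvOp Γ y b c w) z
      = phi (G y) (Q y) b c w z + h y * pi2 (G y) (J y) b c w z

namespace HasLocalCurvatureForm

variable {Ω : Set E} {G : E → E →L[ℝ] E →L[ℝ] ℝ} {Γ : E → E →L[ℝ] E →L[ℝ] E}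
  {J : E → E →L[ℝ] E} {Q : E → E →L[ℝ] E →L[ℝ] ℝ} {h : E → ℝ}
  (C : HasLocalCurvatureForm Ω G Γ J Q h)
include C

lemma differentiableAt_J {y : E} (hy : y ∈ Ω) : DifferentiableAt ℝ J y :=
  differentiableAt_of_contDiffOn C.isOpen C.contDiffOn_J hy

lemma hasDerivAt_form {y : E} (hy : y ∈ Ω) (a x u : E) :
    HasDerivAt (fun t : ℝ ↦ G (y + t • a) x (J (y + t • a) u))
      (G y (Γ y a x) (J y u) + G y x (Γ y a (J y u)) + G y x (fderiv ℝ J y a u)) 0 := by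
  have := hasDerivAt_line_apply₂ (C.differentiableAt_metric hy) a (hasDerivAt_const (0 : ℝ) x)
    ((hasDerivAt_line (C.differentiableAt_J hy) a).clm_apply (hasDerivAt_const (0 : ℝ) u))
  simpa [C.compat y hy] using this

/-- Skewness is the derivative of `F(x,u) + F(u,x) = 0`; the rule for `J` is the derivative of `J² =
-1`. -/
lemma isFundDeriv {y : E} (hy : y ∈ Ω) :
    IsFundDeriv (J y) (fun w x u ↦ G y x (covEnd Γ J y w u)) where
  add_left a b x u := by simp [covEnd]; ring
  smul_left t a x u := by simp [covEnd]; ring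
  add_right w x a b := by simp [covEnd]; ring
  smul_right t w x a := by simp [covEnd]; ring
  skew w x u := by
    have h1 := (C.hasDerivAt_form hy w x u).add (C.hasDerivAt_form hy w u x)
    have h2 := hasDerivAt_line_of_eqOn C.isOpen
      (f := fun y ↦ G y x (J y u) + G y u (J y x)) (g := fun _ ↦ (0 : ℝ))
      (fun y hy ↦ by simp only [(C.hermitian y hy).J_swap x u, neg_add_cancel]) hy h1
    have h3 := h2.unique (hasDerivAt_const _ _)
    have H := C.hermitian y hy
    simp only [covEnd, map_add, map_sub]
    have h4 := H.J_swap x (Γ y w u)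
    have h5 := H.J_swap u (Γ y w x)
    linarith
  anti w x u := by
    have H := C.hermitian y hy
    have h1 : HasDerivAt (fun t : ℝ ↦ J (y + t • w) (J (y + t • w) u))
        (fderiv ℝ J y w (J y u) + J y (fderiv ℝ J y w u)) 0 := by
      have hJ := hasDerivAt_line (C.differentiableAt_J hy) w
      simpa using hJ.clm_apply (hJ.clm_apply (hasDerivAt_const (0 : ℝ) u))
    have h2 := hasDerivAt_line_of_eqOn C.isOpen
      (f := fun y ↦ J y (J y u)) (g := fun _ ↦ -u)
      (fun y hy ↦ (C.hermitian y hy).sq u) hy h1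
    have h3 := h2.unique (hasDerivAt_const _ _)
    have h4 : covEnd Γ J y w (J y u) = -J y (covEnd Γ J y w u) := by
      rw [covEnd, covEnd, eq_neg_of_add_eq_zero_left h3]
      simp only [map_add, map_sub, H.sq, map_neg]
      abel
    rw [h4, map_neg, H.compat]

/-- Semi-Kähler: the trace of `∇F` vanishes. -/
def IsTraceFree (_ : HasLocalCurvatureForm Ω G Γ J Q h) (n : ℕ) : Prop :=
  ∀ y ∈ Ω, ∀ e, IsUnitaryFrame (G y) (J y) n e → ∀ v,
    ∑ i ∈ Finset.range n, (G y (e i) (covEnd Γ J y (e i) v)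
      + G y (J y (e i)) (covEnd Γ J y (J y (e i)) v)) = 0

lemma curvDeriv_cyclic {y : E} (hy : y ∈ Ω) (a b c w z : E) :
    curvDeriv (G y) (J y) (covForm Γ Q y) (fderiv ℝ h y) (h y)
        (fun w x u ↦ G y x (covEnd Γ J y w u)) a b c w z
      + curvDeriv (G y) (J y) (covForm Γ Q y) (fderiv ℝ h y) (h y)
        (fun w x u ↦ G y x (covEnd Γ J y w u)) b c a w z
      + curvDeriv (G y) (J y) (covForm Γ Q y) (fderiv ℝ h y) (h y)
        (fun w x u ↦ G y x (covEnd Γ J y w u)) c a b w z = 0 :=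
  C.bianchi_curvDeriv hy (differentiableAt_of_contDiffOn C.isOpen C.contDiffOn_Q hy)
    (C.differentiableAt_J hy) (differentiableAt_of_contDiffOn C.isOpen C.contDiffOn_h hy)
    C.curvature_eq a b c w z

lemma covForm_symm {y : E} (hy : y ∈ Ω) (w x u : E) :
    covForm Γ Q y w x u = covForm Γ Q y w u x := by
  have hQ := differentiableAt_of_contDiffOn C.isOpen C.contDiffOn_Q hy
  have h1 : ∀ x u, HasDerivAt (fun t : ℝ ↦ Q (y + t • w) x u) (fderiv ℝ Q y w x u) 0 := by
    intro x u
    simpa using hasDerivAt_line_apply₂ hQ w (hasDerivAt_const (0 : ℝ) x)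
      (hasDerivAt_const (0 : ℝ) u)
  have h2 := hasDerivAt_line_of_eqOn C.isOpen
      (f := fun y ↦ Q y x u) (g := fun y ↦ Q y u x) (fun y hy ↦ C.Q_symm y hy x u) hy (h1 x u)
  rw [covForm, covForm, h2.unique (h1 u x), C.Q_symm y hy x, C.Q_symm y hy (Γ y w x)]
  ring

variable [FiniteDimensional ℝ E] {n : ℕ}

lemma fderiv_eq_zero (hn : 2 < n) (hE : 2 * n ≤ Module.finrank ℝ E) (ht : C.IsTraceFree n)
    {y : E} (hy : y ∈ Ω) : fderiv ℝ h y = 0 := by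
  ext w
  exact bianchi_dh_eq_zero (C.hermitian y hy) (C.isFundDeriv hy) (C.curvDeriv_cyclic hy) hn hE
    (ht y hy) w

lemma covEnd_eq_zero (hn : 2 < n) (hE : 2 * n ≤ Module.finrank ℝ E) (ht : C.IsTraceFree n)
    {y : E} (hy : y ∈ Ω) (hh : h y ≠ 0) (w u : E) : covEnd Γ J y w u = 0 := by
  have h1 := bianchi_fundDeriv_eq_zero (C.hermitian y hy) (C.isFundDeriv hy)
    (C.curvDeriv_cyclic hy) (by omega) (fun w ↦ by rw [C.fderiv_eq_zero hn hE ht hy]; rfl)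
    (C.covForm_symm hy) w (covEnd Γ J y w u) u
  by_contra hne
  exact ((C.metric_pos y hy _ hne).ne') ((mul_eq_zero.1 h1).resolve_left hh)

lemma covForm_cotton (hE : 6 ≤ Module.finrank ℝ E)
    (hh : ∀ y ∈ Ω, h y = 0) {y : E} (hy : y ∈ Ω) (w u v : E) :
    covForm Γ Q y w u v = covForm Γ Q y u w v := by
  have h0 : fderiv ℝ h y = 0 := by
    have : h =ᶠ[𝓝 y] fun _ ↦ 0 := by
      filter_upwards [C.isOpen.mem_nhds hy] with z hz using hh z hz
    rw [this.fderiv_eq, fderiv_const_apply]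
  have h1 := C.curvDeriv_cyclic hy
  rw [hh y hy] at h1
  exact bianchi_cotton_eq_zero (C.hermitian y hy) hE (fun w ↦ by rw [h0]; rfl)
    h1 w u v

/-- The fundamental form `T` is parallel, so the curvature annihilates it. This is the symmetry
`R(a,b,Jc,Jd) = R(a,b,c,d)`. -/
lemma Q_eq_of_parallel (hE : 6 ≤ Module.finrank ℝ E)
    (hJ : ∀ y ∈ Ω, ∀ w u, covEnd Γ J y w u = 0) {y : E} (hy : y ∈ Ω) (u v : E) :
    Q y u v = h y / 2 * G y u v := by
  have H := C.hermitian y hy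
  let T : E → E →L[ℝ] E →L[ℝ] ℝ := fun y ↦ (ContinuousLinearMap.precomp ℝ (J y)).comp (G y)
  have hT : ∀ y u v, T y u v = G y u (J y v) := fun y u v ↦ rfl
  have hTs : ContDiffOn ℝ ∞ T Ω := by
    refine contDiffOn_clm_apply.2 fun u ↦ contDiffOn_clm_apply.2 fun v ↦ ?_
    simp only [hT]
    exact (C.contDiffOn_metric.clm_apply contDiffOn_const).clm_apply
      (C.contDiffOn_J.clm_apply contDiffOn_const)
  have hpar : ∀ y ∈ Ω, ∀ w u v, covForm Γ T y w u v = 0 := by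
    intro y hy w u v
    have h1 : HasDerivAt (fun t : ℝ ↦ T (y + t • w) u v) (fderiv ℝ T y w u v) 0 := by
      simpa using hasDerivAt_line_apply₂ (differentiableAt_of_contDiffOn C.isOpen hTs hy) w
        (hasDerivAt_const (0 : ℝ) u) (hasDerivAt_const (0 : ℝ) v)
    have h2 := h1.unique (C.hasDerivAt_form hy w u v)
    have h3 := hJ y hy w v
    rw [covForm, h2, hT, hT]
    rw [covEnd] at h3
    have h4 := congrArg (G y u) h3
    simp only [map_add, map_sub, map_zero] at h4
    linarith
  refine eq_half_smul_metric_of_kahler_symmetry H hE (C.Q_symm y hy) (fun a b c d ↦ ?_) u v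
  have e1 := C.curvOp_parallel hTs hpar hy a b (J y c) d
  simp only [hT] at e1
  rw [H.compat, H.symm c, C.curvOp_skew hy a b d c] at e1
  rw [← C.curvature_eq y hy, ← C.curvature_eq y hy]
  linarith

end HasLocalCurvatureForm

/-! ### Conformal change of the metric. -/

namespace IsLeviCivita

variable {Ω : Set E} {G G' : E → E →L[ℝ] E →L[ℝ] ℝ} {Γ Γ' : E → E →L[ℝ] E →L[ℝ] E}

/-- The Levi-Civita connection of the conformally related metric `e^{2w} G`; here `X` is the
gradient of `w`. -/
lemma conformal_conn (L : IsLeviCivita Ω G Γ) {w : E → ℝ} (hw : ContDiffOn ℝ ∞ w Ω)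
    (L' : IsLeviCivita Ω G' Γ') (hG' : ∀ y ∈ Ω, G' y = Real.exp (2 * w y) • G y)
    {X : E → E} (hX : ∀ y ∈ Ω, ∀ u, G y (X y) u = fderiv ℝ w y u) {y : E} (hy : y ∈ Ω)
    (u v : E) :
    Γ' y u v = Γ y u v + G y (X y) u • v + G y (X y) v • u - G y u v • X y := by
  have hder : ∀ a u v, fderiv ℝ G' y a u v
      = Real.exp (2 * w y) * (2 * G y (X y) a * G y u v + fderiv ℝ G y a u v) := by
    intro a u v
    have h1 : HasDerivAt (fun t : ℝ ↦ G' (y + t • a) u v) (fderiv ℝ G' y a u v) 0 := by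
      simpa using hasDerivAt_line_apply₂ (L'.differentiableAt_metric hy) a
        (hasDerivAt_const (0 : ℝ) u) (hasDerivAt_const (0 : ℝ) v)
    have h2 : HasDerivAt (fun t : ℝ ↦ G (y + t • a) u v) (fderiv ℝ G y a u v) 0 := by
      simpa using hasDerivAt_line_apply₂ (L.differentiableAt_metric hy) a
        (hasDerivAt_const (0 : ℝ) u) (hasDerivAt_const (0 : ℝ) v)
    have h3 := (((hasDerivAt_line (differentiableAt_of_contDiffOn L.isOpen hw hy) a).const_mul
      2).exp).mul h2
    have h4 := hasDerivAt_line_of_eqOn L.isOpen (f := fun y ↦ G' y u v)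
      (g := fun y ↦ Real.exp (2 * w y) * G y u v) (fun z hz ↦ by simp [hG' z hz]) hy h1
    have h5 := h4.unique h3
    simp only [zero_smul, add_zero] at h5
    rw [h5, hX y hy]
    ring
  -- The difference from the claimed formula, lowered by `G`, is symmetric in `u`, `v` (no torsion)
  -- and skew in `v`, `z` (metric compatibility).
  have key : ∀ u v z, G y (Γ' y u v
      - (Γ y u v + G y (X y) u • v + G y (X y) v • u - G y u v • X y)) z = 0 := by
    refine eq_zero_of_symm_of_skew (fun u v z ↦ ?_) (fun u v z ↦ ?_)
    · rw [L.conn_symm y hy u v, L'.conn_symm y hy u v, L.metric_symm y hy u v,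
        add_right_comm (Γ y v u)]
    · have h1 := hder u v z
      rw [L.compat y hy, L'.compat y hy, hG' y hy] at h1
      simp only [_root_.smul_apply, smul_eq_mul, ← mul_add] at h1
      have h2 := mul_left_cancel₀ (Real.exp_pos _).ne' h1
      simp only [map_add, map_sub, map_smul, _root_.add_apply, _root_.sub_apply, _root_.smul_apply,
        smul_eq_mul]
      have s1 := L.metric_symm y hy (Γ' y u z) v
      have s2 := L.metric_symm y hy (Γ y u z) v
      have s3 := L.metric_symm y hy z v
      have s4 := L.metric_symm y hy u v
      rw [s1, s2, s3]
      linear_combination h2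
  have h0 := fun z ↦ key u v z
  by_contra hne
  exact (L.metric_pos y hy _ (sub_ne_zero.2 hne)).ne' (h0 _)

/-- The pointwise algebra of `conformal_flat`. Here `d₁`, `d₂` are the derivatives of `Γ`, `X'` is
the derivative of the gradient, and the conclusion is the new curvature after the product rule. The
Hessian equation makes the correction cancel `φ(q)`. -/
lemma conformal_curvature {g q : E →L[ℝ] E →L[ℝ] ℝ} {γ γ' : E →L[ℝ] E →L[ℝ] E}
    {X' : E →L[ℝ] E} {X a b c z d₁ d₂ : E} (hg : ∀ u v, g u v = g v u)
    (hγ : ∀ u v, γ u v = γ v u) (hq : ∀ u v, q u v = q v u)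
    (hess : ∀ u v, g (X' u + γ u X) v = g X u * g X v - 1 / 2 * g X X * g u v + q u v)
    (hr : g (d₁ - d₂ + γ a (γ b c) - γ b (γ a c)) z = phi g q a b c z)
    (hγ' : ∀ u v, γ' u v = γ u v + g X u • v + g X v • u - g u v • X) :
    g ((d₁ + (g (X' a + γ a X) b + g X (γ a b)) • c + (g (X' a + γ a X) c + g X (γ a c)) • b
        - ((g (γ a b) c + g b (γ a c)) • X + g b c • X' a))
      - (d₂ + (g (X' b + γ b X) a + g X (γ b a)) • c + (g (X' b + γ b X) c + g X (γ b c)) • a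
        - ((g (γ b a) c + g a (γ b c)) • X + g a c • X' b))
      + γ' a (γ' b c) - γ' b (γ' a c)) z = 0 := by
  have t5 := hess a z
  have t6 := hess b z
  rw [hess a b, hess b a, hess a c, hess b c, hq b a]
  simp only [phi, hγ', map_add, map_sub, map_smul, _root_.add_apply, _root_.sub_apply,
    _root_.smul_apply, smul_eq_mul] at hr t5 t6 ⊢
  rw [hγ b a, hg b a, hg a X, hg b X]
  linear_combination hr - t5 * g b c + t6 * g a c

/-- If the curvature of `G` is `φ(Q)` and `∇dw = dw ⊗ dw - ½ |dw|² G + Q`, then `e^{2w} G` is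
flat. -/
theorem conformal_flat (L : IsLeviCivita Ω G Γ) {w : E → ℝ} (hw : ContDiffOn ℝ ∞ w Ω)
    (L' : IsLeviCivita Ω G' Γ') (hG' : ∀ y ∈ Ω, G' y = Real.exp (2 * w y) • G y)
    {X : E → E} (hXs : ContDiffOn ℝ ∞ X Ω) (hX : ∀ y ∈ Ω, ∀ u, G y (X y) u = fderiv ℝ w y u)
    {Q : E → E →L[ℝ] E →L[ℝ] ℝ} (hQ : ∀ y ∈ Ω, ∀ u v, Q y u v = Q y v u)
    (hR : ∀ y ∈ Ω, ∀ b c w z, G y (curvOp Γ y b c w) z = phi (G y) (Q y) b c w z)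
    (hess : ∀ y ∈ Ω, ∀ u v, G y (fderiv ℝ X y u + Γ y u (X y)) v
      = G y (X y) u * G y (X y) v - 1 / 2 * G y (X y) (X y) * G y u v + Q y u v)
    {y : E} (hy : y ∈ Ω) (a b c : E) : curvOp Γ' y a b c = 0 := by
  have hX' := differentiableAt_of_contDiffOn L.isOpen hXs hy
  have hG := L.differentiableAt_metric hy
  have hΓ := L.differentiableAt_conn hy
  have key : ∀ a b, fderiv ℝ Γ' y a b c = fderiv ℝ Γ y a b c
      + (G y (fderiv ℝ X y a + Γ y a (X y)) b + G y (X y) (Γ y a b)) • c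
      + (G y (fderiv ℝ X y a + Γ y a (X y)) c + G y (X y) (Γ y a c)) • b
      - ((G y (Γ y a b) c + G y b (Γ y a c)) • X y + G y b c • fderiv ℝ X y a) := by
    intro a b
    have hc : ∀ v : E, HasDerivAt (fun _ : ℝ ↦ v) 0 0 := fun v ↦ hasDerivAt_const _ _
    have h1 := hasDerivAt_line_apply₂ (L'.differentiableAt_conn hy) a (hc b) (hc c)
    have h2 := hasDerivAt_line_apply₂ hΓ a (hc b) (hc c)
    have h3 := hasDerivAt_line_apply₂ hG a (hasDerivAt_line hX' a) (hc b)
    have h4 := hasDerivAt_line_apply₂ hG a (hasDerivAt_line hX' a) (hc c)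
    have h5 := hasDerivAt_line_apply₂ hG a (hc b) (hc c)
    have h6 := ((h2.add (h3.smul (hc c))).add (h4.smul (hc b))).sub
      (h5.smul (hasDerivAt_line hX' a))
    have h7 := hasDerivAt_line_of_eqOn L.isOpen (f := fun y ↦ Γ' y b c)
      (g := fun y ↦ Γ y b c + G y (X y) b • c + G y (X y) c • b - G y b c • X y)
      (fun z hz ↦ L.conformal_conn hw L' hG' hX hz b c) hy h1
    have h8 := h7.unique h6
    simp only [zero_smul, add_zero, map_zero, _root_.zero_apply, smul_zero, L.compat y hy] at h8
    rw [h8]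
    simp only [map_add, _root_.add_apply]
    module
  have zero : ∀ z, G y (curvOp Γ' y a b c) z = 0 := by
    intro z
    rw [curvOp, key, key]
    exact conformal_curvature (L.metric_symm y hy) (L.conn_symm y hy) (hQ y hy) (hess y hy)
      (hR y hy a b c z) (L.conformal_conn hw L' hG' hX hy)
  by_contra hne
  exact (L.metric_pos y hy _ hne).ne' (zero _)

end IsLeviCivita

end LocalGeometry

/-! ### A Frobenius theorem for linear systems. -/

section Frobenius

variable {E : Type*} [NormedAddCommGroup E] [NormedSpace ℝ E]
  {F : Type*} [NormedAddCommGroup F] [NormedSpace ℝ F]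

/-- A linear first-order system `dY = A Y` on a small ball can be solved along rays. -/
lemma exists_radial_solution [CompleteSpace F] {A : E → E →L[ℝ] F →L[ℝ] F} {p : E} {r M : ℝ}
    (hM : 0 ≤ M) (hA : ContinuousOn A (Metric.closedBall p r))
    (hAM : ∀ y ∈ Metric.closedBall p r, ‖A y‖ ≤ M) (Y₀ : F) {x : E} (hx : ‖x‖ ≤ r)
    (hsmall : M * ‖x‖ * (‖Y₀‖ + 1) ≤ 1) :
    ∃ γ : ℝ → F, γ 0 = Y₀ ∧ ∀ t ∈ Set.Icc (0 : ℝ) 1,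
      HasDerivWithinAt γ (A (p + t • x) x (γ t)) (Set.Icc 0 1) t := by
  have hmem : ∀ t ∈ Set.Icc (0 : ℝ) 1, p + t • x ∈ Metric.closedBall p r := by
    intro t ht
    rw [mem_closedBall_iff_norm, add_sub_cancel_left, norm_smul, Real.norm_of_nonneg ht.1]
    nlinarith [ht.2, norm_nonneg x]
  have hnorm : ∀ t ∈ Set.Icc (0 : ℝ) 1, ‖A (p + t • x) x‖ ≤ M * ‖x‖ := fun t ht ↦
    ((A (p + t • x)).le_opNorm x).trans
      (mul_le_mul_of_nonneg_right (hAM _ (hmem t ht)) (norm_nonneg _))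
  have hMx : 0 ≤ M * ‖x‖ := by positivity
  -- In the unit ball around `Y₀` the speed is at most 1 by `hsmall`, so existence is guaranteed up
  -- to time 1.
  have hPL : IsPicardLindelof (fun t v ↦ A (p + t • x) x v) (tmin := 0) (tmax := 1)
      ⟨0, by simp⟩ Y₀ 1 0 1 ⟨M * ‖x‖, hMx⟩ := by
    refine ⟨fun t ht ↦ ?_, fun v _ ↦ ?_, fun t ht v hv ↦ ?_, by simp⟩
    · refine LipschitzWith.lipschitzOnWith (((A (p + t • x) x).lipschitz).weaken ?_)
      exact hnorm t ht
    · have : ContinuousOn (fun t : ℝ ↦ A (p + t • x)) (Set.Icc 0 1) :=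
        hA.comp (by fun_prop) hmem
      exact (this.clm_apply continuousOn_const).clm_apply continuousOn_const
    · have hv' : ‖v‖ ≤ ‖Y₀‖ + 1 := by
        have h1 := norm_le_norm_add_norm_sub' v Y₀
        have h2 : ‖v - Y₀‖ ≤ 1 := by simpa [dist_eq_norm] using hv
        linarith
      calc ‖A (p + t • x) x v‖ ≤ ‖A (p + t • x) x‖ * ‖v‖ := ContinuousLinearMap.le_opNorm _ _
        _ ≤ (M * ‖x‖) * (‖Y₀‖ + 1) := by
            gcongr
            exact hnorm t ht
        _ ≤ _ := by simpa using hsmall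
  obtain ⟨γ, h0, h1⟩ := hPL.exists_eq_forall_mem_Icc_hasDerivWithinAt₀
  exact ⟨γ, h0, h1⟩

lemma norm_sub_le_of_fderiv_le {f : E → F} {s : Set E} (hs : Convex ℝ s) {M : ℝ}
    (hf : ∀ y ∈ s, DifferentiableAt ℝ f y) (hM : ∀ y ∈ s, ‖fderiv ℝ f y‖ ≤ M) {y z : E}
    (hy : y ∈ s) (hz : z ∈ s) : ‖f z - f y‖ ≤ M * ‖z - y‖ :=
  hs.norm_image_sub_le_of_norm_fderiv_le hf hM hy hz

lemma norm_taylor_le {f : E → F} {s : Set E} (hs : Convex ℝ s) {M : ℝ} (hM0 : 0 ≤ M)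
    (hf : ∀ y ∈ s, DifferentiableAt ℝ f y) (hf' : ∀ y ∈ s, DifferentiableAt ℝ (fderiv ℝ f) y)
    (hM : ∀ y ∈ s, ‖fderiv ℝ (fderiv ℝ f) y‖ ≤ M) {y z : E} (hy : y ∈ s) (hz : z ∈ s) :
    ‖f z - f y - fderiv ℝ f y (z - y)‖ ≤ M * ‖z - y‖ ^ 2 := by
  have hseg : segment ℝ y z ⊆ s := hs.segment_subset hy hz
  have := (convex_segment y z).norm_image_sub_le_of_norm_hasFDerivWithin_le'
    (f := f) (f' := fderiv ℝ f) (φ := fderiv ℝ f y) (C := M * ‖z - y‖)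
    (fun w hw ↦ (hf w (hseg hw)).hasFDerivAt.hasFDerivWithinAt) (fun w hw ↦ ?_)
    (left_mem_segment ℝ y z) (right_mem_segment ℝ y z)
  · calc _ ≤ _ := this
      _ = _ := by ring
  · refine (norm_sub_le_of_fderiv_le hs hf' hM hy (hseg hw)).trans ?_
    gcongr
    exact norm_sub_le_of_mem_segment hw

/-- The curve `t ↦ γ t + t A(p + t x)(k) γ(t)` nearly solves the equation along the ray of
direction `x + k`. -/
lemma flat_defect_bound {A₀ A₁ : E →L[ℝ] F →L[ℝ] F} {A' : E →L[ℝ] E →L[ℝ] F →L[ℝ] F} {x k : E}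
    {v : F} {M t : ℝ} (hM : 0 ≤ M) (ht : t ∈ Set.Icc (0 : ℝ) 1)
    (hflat : A' x k v + A₀ k (A₀ x v) = A' k x v + A₀ x (A₀ k v))
    (h0 : ‖A₀‖ ≤ M) (h1 : ‖A₁ - A₀‖ ≤ M * ‖k‖) (h2 : ‖A₁ - A₀ - A' (t • k)‖ ≤ M * ‖k‖ ^ 2)
    (hx : ‖x‖ ≤ 1) (hxk : ‖x + k‖ ≤ 1) :
    ‖(A₀ x v + (A₀ k v + t • (A' x k v + A₀ k (A₀ x v)))) - A₁ (x + k) (v + t • A₀ k v)‖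
      ≤ (2 * M + 2 * M ^ 2) * ‖v‖ * ‖k‖ ^ 2 := by
  -- The integrability condition cancels the part of the defect that is linear in `k`. What remains
  -- is a Taylor remainder and products of two factors of order `k`.
  have e : (A₀ x v + (A₀ k v + t • (A' x k v + A₀ k (A₀ x v)))) - A₁ (x + k) (v + t • A₀ k v)
      = -((A₁ - A₀ - A' (t • k)) x v + (A₁ - A₀) k v
        + t • ((A₁ - A₀) (x + k) (A₀ k v) + A₀ k (A₀ k v))) := by
    rw [hflat]
    simp only [map_add, map_smul, _root_.sub_apply, _root_.add_apply, _root_.smul_apply]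
    module
  have hk := norm_nonneg k
  have hv := norm_nonneg v
  have b : ∀ {B : E →L[ℝ] F →L[ℝ] F} {c d : ℝ} {u : E} {w : F}, ‖B‖ ≤ c → ‖u‖ ≤ d →
      ‖B u w‖ ≤ c * d * ‖w‖ := by
    intro B c d u w hB hu
    refine ((B u).le_opNorm w).trans ?_
    gcongr
    refine (B.le_opNorm u).trans ?_
    have := norm_nonneg B
    gcongr
    linarith
  have b1 := b (w := v) h2 hx
  have b2 := b (w := v) h1 (le_refl ‖k‖)
  have b3 := b (w := v) h0 (le_refl ‖k‖)
  have b4 := b (w := A₀ k v) h1 hxk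
  have b5 := b (w := A₀ k v) h0 (le_refl ‖k‖)
  rw [e, norm_neg]
  have b6 : ‖t • ((A₁ - A₀) (x + k) (A₀ k v) + A₀ k (A₀ k v))‖ ≤
      M * ‖k‖ * 1 * (M * ‖k‖ * ‖v‖) + M * ‖k‖ * (M * ‖k‖ * ‖v‖) := by
    rw [norm_smul, Real.norm_of_nonneg ht.1]
    calc _ ≤ 1 * ‖(A₁ - A₀) (x + k) (A₀ k v) + A₀ k (A₀ k v)‖ := by gcongr; exact ht.2
      _ ≤ ‖(A₁ - A₀) (x + k) (A₀ k v)‖ + ‖A₀ k (A₀ k v)‖ := by rw [one_mul]; exact norm_add_le _ _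
      _ ≤ M * ‖k‖ * 1 * ‖A₀ k v‖ + M * ‖k‖ * ‖A₀ k v‖ := add_le_add b4 b5
      _ ≤ _ := by gcongr
  refine (norm_add₃_le).trans ?_
  calc _ ≤ _ := add_le_add (add_le_add b1 b2) b6
    _ = _ := by ring

/-- **Frobenius theorem** for linear systems `dY = A Y` satisfying the integrability condition. -/
theorem exists_parallel_section [FiniteDimensional ℝ E] [CompleteSpace F] {Ω : Set E}
    (hΩ : IsOpen Ω) {A : E → E →L[ℝ] F →L[ℝ] F} (hA : ContDiffOn ℝ ∞ A Ω)
    (hflat : ∀ y ∈ Ω, ∀ u v w, fderiv ℝ A y u v w + A y v (A y u w)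
      = fderiv ℝ A y v u w + A y u (A y v w))
    {p : E} (hp : p ∈ Ω) (Y₀ : F) :
    ∃ U : Set E, IsOpen U ∧ p ∈ U ∧ U ⊆ Ω ∧ ∃ Y : E → F, Y p = Y₀ ∧ ContDiffOn ℝ ∞ Y U ∧
      ∀ y ∈ U, ∀ u, fderiv ℝ Y y u = A y u (Y y) := by
  have hA1 := contDiffOn_fderiv hΩ hA
  have hA2 := contDiffOn_fderiv hΩ hA1
  obtain ⟨r, hr0, hr⟩ : ∃ r > 0, Metric.closedBall p r ⊆ Ω :=
    Metric.nhds_basis_closedBall.mem_iff.1 (hΩ.mem_nhds hp)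
  have hcpt : IsCompact (Metric.closedBall p r) := isCompact_closedBall p r
  obtain ⟨M0, hM0⟩ := hcpt.exists_bound_of_continuousOn (hA.continuousOn.mono hr)
  obtain ⟨M1, hM1⟩ := hcpt.exists_bound_of_continuousOn (hA1.continuousOn.mono hr)
  obtain ⟨M2, hM2⟩ := hcpt.exists_bound_of_continuousOn (hA2.continuousOn.mono hr)
  obtain ⟨M, hM, h0M, h1M, h2M⟩ : ∃ M : ℝ, 1 ≤ M ∧ M0 ≤ M ∧ M1 ≤ M ∧ M2 ≤ M :=
    ⟨max 1 (max M0 (max M1 M2)), by simp, by simp, by simp, by simp⟩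
  replace hM0 := fun y hy ↦ (hM0 y hy).trans h0M
  replace hM1 := fun y hy ↦ (hM1 y hy).trans h1M
  replace hM2 := fun y hy ↦ (hM2 y hy).trans h2M
  have hconv : Convex ℝ (Metric.closedBall p r) := convex_closedBall p r
  have hd0 : ∀ y ∈ Metric.closedBall p r, DifferentiableAt ℝ A y := fun y hy ↦
    differentiableAt_of_contDiffOn hΩ hA (hr hy)
  have hd1 : ∀ y ∈ Metric.closedBall p r, DifferentiableAt ℝ (fderiv ℝ A) y := fun y hy ↦
    differentiableAt_of_contDiffOn hΩ hA1 (hr hy)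
  -- The last bound is the smallness required by `exists_radial_solution`; `ρ ≤ 1` serves the norm
  -- bounds of `flat_defect_bound`.
  obtain ⟨ρ, hρ0, hρr, hρ1, hρs⟩ : ∃ ρ > 0, ρ ≤ r ∧ ρ ≤ 1 ∧ M * ρ * (‖Y₀‖ + 1) ≤ 1 := by
    have hpos : 0 < M * (‖Y₀‖ + 1) := by positivity
    refine ⟨min r (min 1 (M * (‖Y₀‖ + 1))⁻¹), by positivity, by simp, by simp, ?_⟩
    calc _ = min r (min 1 (M * (‖Y₀‖ + 1))⁻¹) * (M * (‖Y₀‖ + 1)) := by ring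
      _ ≤ (M * (‖Y₀‖ + 1))⁻¹ * (M * (‖Y₀‖ + 1)) := by
        gcongr
        exact (min_le_right _ _).trans (min_le_right _ _)
      _ = 1 := inv_mul_cancel₀ hpos.ne'
  have hex : ∀ x : E, ∃ γ : ℝ → F, ‖x‖ < ρ → γ 0 = Y₀ ∧ ∀ t ∈ Set.Icc (0 : ℝ) 1,
      HasDerivWithinAt γ (A (p + t • x) x (γ t)) (Set.Icc 0 1) t := by
    intro x
    by_cases hx : ‖x‖ < ρ
    · obtain ⟨γ, hγ⟩ := exists_radial_solution (by linarith) (hA.continuousOn.mono hr) hM0 Y₀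
        (x := x) (by linarith) (le_trans (by gcongr) hρs)
      exact ⟨γ, fun _ ↦ hγ⟩
    · exact ⟨0, fun h ↦ absurd h hx⟩
  choose γ hγ using hex
  have hmem : ∀ {x : E} {t : ℝ}, ‖x‖ < ρ → t ∈ Set.Icc (0 : ℝ) 1 →
      p + t • x ∈ Metric.closedBall p r := by
    intro x t hx ht
    rw [mem_closedBall_iff_norm, add_sub_cancel_left, norm_smul, Real.norm_of_nonneg ht.1]
    nlinarith [ht.2, norm_nonneg x]
  -- The candidate is `Y (p + x) = γ x 1`. The solution in direction `x + k` is compared with the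
  -- curve `γ x t + t A(p + t x)(k) γ x t`; a quadratic error shows that `Y` is differentiable with
  -- `dY = A Y`.
  have hest : ∀ x, ‖x‖ < ρ → ∃ c, ∀ k, ‖x + k‖ < ρ →
      ‖γ (x + k) 1 - γ x 1 - A (p + x) k (γ x 1)‖ ≤ c * ‖k‖ ^ 2 := by
    intro x hx
    obtain ⟨h0, hγx⟩ := hγ x hx
    have hcont : ContinuousOn (γ x) (Set.Icc 0 1) := fun t ht ↦ (hγx t ht).continuousWithinAt
    obtain ⟨N, hN⟩ := isCompact_Icc.exists_bound_of_continuousOn hcont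
    have hN0 : 0 ≤ N := (norm_nonneg _).trans (hN 0 (by simp))
    -- Grönwall over unit time with Lipschitz constant `M`, zero initial distance and defect `(2M +
    -- 2M²) N ‖k‖²`.
    refine ⟨(2 * M + 2 * M ^ 2) * N / M * (Real.exp M - 1), fun k hk ↦ ?_⟩
    obtain ⟨h0k, hγk⟩ := hγ (x + k) hk
    have hW : ∀ t ∈ Set.Icc (0 : ℝ) 1,
        HasDerivWithinAt (fun t ↦ γ x t + t • A (p + t • x) k (γ x t))
          (A (p + t • x) x (γ x t) + (A (p + t • x) k (γ x t)
            + t • (fderiv ℝ A (p + t • x) x k (γ x t) + A (p + t • x) k (A (p + t • x) x (γ x t)))))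
          (Set.Icc 0 1) t := by
      intro t ht
      have h1 : HasDerivAt (fun t : ℝ ↦ p + t • x) x t := by
        simpa using ((hasDerivAt_id t).smul_const x).const_add p
      have h2 : HasDerivWithinAt (fun t : ℝ ↦ A (p + t • x)) (fderiv ℝ A (p + t • x) x)
          (Set.Icc 0 1) t :=
        ((hd0 _ (hmem hx ht)).hasFDerivAt.comp_hasDerivAt t h1).hasDerivWithinAt
      have h3 := (h2.clm_apply (hasDerivWithinAt_const t _ k)).clm_apply (hγx t ht)
      have h4 := (hγx t ht).add ((hasDerivWithinAt_id t _).smul h3)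
      simp only [map_zero, add_zero, id_eq, one_smul] at h4
      refine h4.congr_deriv ?_
      abel
    have hlip : ∀ t ∈ Set.Ico (0 : ℝ) 1, LipschitzOnWith ⟨M, by linarith⟩
        (fun v ↦ A (p + t • (x + k)) (x + k) v) Set.univ := by
      intro t ht
      refine LipschitzWith.lipschitzOnWith (((A (p + t • (x + k)) (x + k)).lipschitz).weaken ?_)
      change ‖_‖ ≤ M
      refine ((A (p + t • (x + k))).le_opNorm _).trans ?_
      calc _ ≤ M * 1 := by
            gcongr
            · exact hM0 _ (hmem hk ⟨ht.1, ht.2.le⟩)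
            · linarith
        _ = M := mul_one M
    have hgr := dist_le_of_approx_trajectories_ODE_of_mem (a := 0) (b := 1) (δ := 0) (εf := 0)
      (εg := (2 * M + 2 * M ^ 2) * N * ‖k‖ ^ 2) hlip
      (fun t ht ↦ (hγk t ht).continuousWithinAt)
      (fun t ht ↦ (hγk t ⟨ht.1, ht.2.le⟩).mono_of_mem_nhdsWithin (Icc_mem_nhdsGE_of_mem ht))
      (fun t ht ↦ by rw [dist_self]) (fun _ _ ↦ trivial)
      (fun t ht ↦ (hW t ht).continuousWithinAt)
      (fun t ht ↦ (hW t ⟨ht.1, ht.2.le⟩).mono_of_mem_nhdsWithin (Icc_mem_nhdsGE_of_mem ht))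
      (fun t ht ↦ ?_) (fun _ _ ↦ trivial) (by simp [h0, h0k]) 1 (by simp)
    · rw [gronwallBound_of_K_ne_0 (by change M ≠ 0; linarith)] at hgr
      simp only [one_smul, dist_eq_norm, zero_mul, zero_add, sub_zero, mul_one,
        NNReal.coe_mk] at hgr
      rw [← sub_sub] at hgr
      change _ ≤ (2 * M + 2 * M ^ 2) * N * ‖k‖ ^ 2 / M * (Real.exp M - 1) at hgr
      refine hgr.trans (le_of_eq ?_)
      ring
    · have ht' : t ∈ Set.Icc (0 : ℝ) 1 := ⟨ht.1, ht.2.le⟩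
      have hsub : p + t • (x + k) - (p + t • x) = t • k := by module
      have hle : ‖t • k‖ ≤ ‖k‖ := by
        rw [norm_smul, Real.norm_of_nonneg ht.1]
        nlinarith [ht.2, norm_nonneg k]
      have e1 := norm_sub_le_of_fderiv_le hconv hd0 hM1 (hmem hx ht') (hmem hk ht')
      have e2 := norm_taylor_le hconv (by linarith) hd0 hd1 hM2 (hmem hx ht') (hmem hk ht')
      rw [hsub] at e1 e2
      rw [dist_eq_norm]
      refine (flat_defect_bound (by linarith) ht' (hflat _ (hr (hmem hx ht')) x k _)
        (hM0 _ (hmem hx ht')) (e1.trans (by gcongr)) (e2.trans (by gcongr)) (by linarith)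
        (by linarith)).trans ?_
      gcongr
      exact hN t ht'
  have hder : ∀ y ∈ Metric.ball p ρ, HasFDerivAt (fun z ↦ γ (z - p) 1)
      ((A y).flip (γ (y - p) 1)) y := by
    intro y hy
    have hx : ‖y - p‖ < ρ := by rwa [← dist_eq_norm]
    obtain ⟨c, hc⟩ := hest _ hx
    rw [hasFDerivAt_iff_isLittleO_nhds_zero]
    refine Asymptotics.IsBigO.trans_isLittleO (g := fun k : E ↦ ‖k‖ ^ 2) ?_
      (Asymptotics.isLittleO_norm_pow_id one_lt_two)
    refine Asymptotics.IsBigO.of_bound c ?_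
    have hnear : ∀ᶠ k : E in 𝓝 0, ‖y - p + k‖ < ρ := by
      have : Continuous fun k : E ↦ ‖y - p + k‖ := by fun_prop
      exact this.continuousAt.eventually_lt_const (by simpa using hx)
    filter_upwards [hnear] with k hk
    have := hc k hk
    rw [add_sub_cancel] at this
    rw [Real.norm_of_nonneg (by positivity : 0 ≤ ‖k‖ ^ 2), add_sub_right_comm]
    exact this
  have hsub : Metric.ball p ρ ⊆ Ω := fun y hy ↦
    hr (Metric.closedBall_subset_closedBall hρr (Metric.ball_subset_closedBall hy))
  refine ⟨Metric.ball p ρ, Metric.isOpen_ball, Metric.mem_ball_self hρ0, hsub,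
    fun z ↦ γ (z - p) 1, ?_, ?_, fun y hy u ↦ by rw [(hder y hy).fderiv]; rfl⟩
  -- For `x = 0` the radial equation says that the derivative is zero, so the solution stays at
  -- `Y₀`.
  · have h1 := hγ 0 (by simpa using hρ0)
    have hc : ∀ t ∈ Set.Icc (0 : ℝ) 1, γ 0 t = γ 0 0 := by
      refine constant_of_derivWithin_zero (fun t ht ↦ (h1.2 t ht).differentiableWithinAt) ?_
      intro t ht
      have := (h1.2 t ⟨ht.1, ht.2.le⟩).derivWithin
        (uniqueDiffOn_Icc one_pos t ⟨ht.1, ht.2.le⟩)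
      simpa using this
    simp only [sub_self]
    rw [hc 1 (by simp), h1.1]
  -- Bootstrap: the equation `dY = A Y` gains one derivative at each step.
  · rw [contDiffOn_infty]
    intro n
    induction n with
    | zero =>
      exact contDiffOn_zero.2 fun y hy ↦ (hder y hy).continuousAt.continuousWithinAt
    | succ n ih =>
      rw [Nat.cast_succ]
      refine (contDiffOn_succ_iff_fderiv_of_isOpen Metric.isOpen_ball).2
        ⟨fun y hy ↦ (hder y hy).differentiableAt.differentiableWithinAt, by simp, ?_⟩
      have h1 : ContDiffOn ℝ n (fun y ↦ (A y).flip (γ (y - p) 1)) (Metric.ball p ρ) := by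
        refine ContDiffOn.clm_apply ?_ ih
        exact (ContinuousLinearMap.flipₗᵢ ℝ E F F).contDiff.comp_contDiffOn
          ((hA.mono hsub).of_le (by exact_mod_cast le_top))
      exact h1.congr fun y hy ↦ (hder y hy).fderiv

end Frobenius

/-! ### The Weyl–Schouten construction of the conformal factor. -/

section WeylSchouten

variable {E : Type*} [NormedAddCommGroup E] [NormedSpace ℝ E] [FiniteDimensional ℝ E]

lemma isInvertible_of_pos {g : E →L[ℝ] E →L[ℝ] ℝ} (hg : ∀ x, x ≠ 0 → 0 < g x x) :
    g.IsInvertible := by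
  have hinj : Function.Injective (g : E →ₗ[ℝ] E →L[ℝ] ℝ) := by
    rw [← LinearMap.ker_eq_bot, LinearMap.ker_eq_bot']
    intro x hx
    by_contra hne
    have h1 : g x = 0 := hx
    have := hg x hne
    rw [h1] at this
    simp at this
  have hdim : Module.finrank ℝ E = Module.finrank ℝ (E →L[ℝ] ℝ) := by
    rw [← (LinearMap.toContinuousLinearMap : (E →ₗ[ℝ] ℝ) ≃ₗ[ℝ] (E →L[ℝ] ℝ)).finrank_eq]
    exact (Subspace.dual_finrank_eq).symm
  refine ⟨(LinearEquiv.ofInjectiveOfFinrankEq _ hinj hdim).toContinuousLinearEquiv, ?_⟩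
  ext x y
  rfl

/-- Raising an index of a bilinear form field with a metric. -/
lemma exists_sharp {Ω : Set E} (hΩ : IsOpen Ω) {G Q : E → E →L[ℝ] E →L[ℝ] ℝ}
    (hG : ContDiffOn ℝ ∞ G Ω) (hQ : ContDiffOn ℝ ∞ Q Ω)
    (hpos : ∀ y ∈ Ω, ∀ x, x ≠ 0 → 0 < G y x x) :
    ∃ q : E → E →L[ℝ] E, ContDiffOn ℝ ∞ q Ω ∧ ∀ y ∈ Ω, ∀ u v, G y (q y u) v = Q y u v := by
  refine ⟨fun y ↦ (G y).inverse.comp (Q y), ?_, fun y hy u v ↦ ?_⟩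
  · refine ContDiffOn.clm_comp (fun y hy ↦ ContDiffAt.contDiffWithinAt ?_) hQ
    obtain ⟨e, he⟩ := isInvertible_of_pos (hpos y hy)
    have h1 : ContDiffAt ℝ ∞ ContinuousLinearMap.inverse (G y) := by
      rw [← he]; exact contDiffAt_map_inverse e
    exact h1.comp y (hG.contDiffAt (hΩ.mem_nhds hy))
  · have h1 := (isInvertible_of_pos (hpos y hy)).self_comp_inverse
    have h2 := congrArg (fun f : (E →L[ℝ] ℝ) →L[ℝ] (E →L[ℝ] ℝ) ↦ f (Q y u) v) h1
    exact h2

/-- The right-hand side of the linear system for `(σ, X, ρ)`, where `X` is the gradient of `σ`. -/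
noncomputable def conformalSystem (g Q : E →L[ℝ] E →L[ℝ] ℝ) (q : E →L[ℝ] E)
    (γ : E →L[ℝ] E →L[ℝ] E) : E →L[ℝ] (ℝ × E × ℝ) →L[ℝ] (ℝ × E × ℝ) :=
  LinearMap.toContinuousBilinearMap <| LinearMap.mk₂ ℝ
    (fun u Y ↦ (g Y.2.1 u, -γ u Y.2.1 - Y.1 • q u + Y.2.2 • u, -Q u Y.2.1))
    (fun u v Y ↦ by
      ext
      · simp
      · simp; module
      · simp; ring)
    (fun t u Y ↦ by
      ext
      · simp
      · simp; module
      · simp)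
    (fun u Y Z ↦ by
      ext
      · simp
      · simp; module
      · simp; ring)
    (fun t u Y ↦ by
      ext
      · simp
      · simp; module
      · simp)

lemma conformalSystem_apply (g Q : E →L[ℝ] E →L[ℝ] ℝ) (q : E →L[ℝ] E)
    (γ : E →L[ℝ] E →L[ℝ] E) (u : E) (Y : ℝ × E × ℝ) :
    conformalSystem g Q q γ u Y
      = (g Y.2.1 u, -γ u Y.2.1 - Y.1 • q u + Y.2.2 • u, -Q u Y.2.1) := rfl

namespace IsLeviCivita

variable {Ω : Set E} {G Q : E → E →L[ℝ] E →L[ℝ] ℝ} {Γ : E → E →L[ℝ] E →L[ℝ] E}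
  {q : E → E →L[ℝ] E}

lemma contDiffOn_conformalSystem (L : IsLeviCivita Ω G Γ) (hQ : ContDiffOn ℝ ∞ Q Ω)
    (hq : ContDiffOn ℝ ∞ q Ω) :
    ContDiffOn ℝ ∞ (fun y ↦ conformalSystem (G y) (Q y) (q y) (Γ y)) Ω := by
  refine contDiffOn_clm_apply.2 fun u ↦ contDiffOn_clm_apply.2 fun Y ↦ ?_
  simp only [conformalSystem_apply]
  have c : ∀ {T : E → E →L[ℝ] E →L[ℝ] ℝ}, ContDiffOn ℝ ∞ T Ω →
      ∀ u v, ContDiffOn ℝ ∞ (fun y ↦ T y u v) Ω := fun hT u v ↦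
    (hT.clm_apply contDiffOn_const).clm_apply contDiffOn_const
  refine (c L.contDiffOn_metric _ _).prodMk (ContDiffOn.prodMk ?_ (c hQ _ _).neg)
  exact (((L.contDiffOn_conn.clm_apply contDiffOn_const).clm_apply
    contDiffOn_const).neg.sub ((hq.clm_apply contDiffOn_const).const_smul Y.1)).add
    contDiffOn_const

/-- The first component follows from the symmetry of `Γ`, `Q`, `G`. The second combines `R = φ(Q)`,
applied to `X`, with the Codazzi equation, multiplied by `σ`. The third is the Codazzi equation
together with `Q(v, q u) = Q(u, q v)`. -/
lemma conformalSystem_integrable (L : IsLeviCivita Ω G Γ) (hQ : ContDiffOn ℝ ∞ Q Ω)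
    (hQs : ∀ y ∈ Ω, ∀ u v, Q y u v = Q y v u)
    (hq : ContDiffOn ℝ ∞ q Ω) (hqQ : ∀ y ∈ Ω, ∀ u v, G y (q y u) v = Q y u v)
    (hR : ∀ y ∈ Ω, ∀ b c w z, G y (curvOp Γ y b c w) z = phi (G y) (Q y) b c w z)
    (hcot : ∀ y ∈ Ω, ∀ u v w, covForm Γ Q y u v w = covForm Γ Q y v u w)
    {y : E} (hy : y ∈ Ω) (u v : E) (Y : ℝ × E × ℝ) :
    fderiv ℝ (fun y ↦ conformalSystem (G y) (Q y) (q y) (Γ y)) y u v Y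
      + conformalSystem (G y) (Q y) (q y) (Γ y) v (conformalSystem (G y) (Q y) (q y) (Γ y) u Y)
    = fderiv ℝ (fun y ↦ conformalSystem (G y) (Q y) (q y) (Γ y)) y v u Y
      + conformalSystem (G y) (Q y) (q y) (Γ y) u
        (conformalSystem (G y) (Q y) (q y) (Γ y) v Y) := by
  have hA := differentiableAt_of_contDiffOn L.isOpen (L.contDiffOn_conformalSystem hQ hq) hy
  have hQ' := differentiableAt_of_contDiffOn L.isOpen hQ hy
  have hq' := differentiableAt_of_contDiffOn L.isOpen hq hy
  obtain ⟨σ, X, ρ⟩ := Y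
  have key : ∀ u v, fderiv ℝ (fun y ↦ conformalSystem (G y) (Q y) (q y) (Γ y)) y u v (σ, X, ρ)
      = (fderiv ℝ G y u X v, -fderiv ℝ Γ y u v X - σ • fderiv ℝ q y u v,
        -fderiv ℝ Q y u v X) := by
    intro u v
    have hc : ∀ {H : Type _} [NormedAddCommGroup H] [NormedSpace ℝ H] (v : H),
      HasDerivAt (fun _ : ℝ ↦ v) 0 0 := fun v ↦ hasDerivAt_const _ _
    have h1 := ((hasDerivAt_line hA u).clm_apply (hc v)).clm_apply (hc ((σ, X, ρ) : ℝ × E × ℝ))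
    have h2 := hasDerivAt_line_apply₂ (L.differentiableAt_metric hy) u (hc X) (hc v)
    have h3 := hasDerivAt_line_apply₂ (L.differentiableAt_conn hy) u (hc v) (hc X)
    have h4 := hasDerivAt_line_apply₂ hQ' u (hc v) (hc X)
    have h5 := (hasDerivAt_line hq' u).clm_apply (hc v)
    have h6 := h2.prodMk (((h3.neg.sub (h5.const_smul σ)).add (hc (ρ • v))).prodMk h4.neg)
    have h7 := h1.unique h6
    simpa using h7
  have hder : ∀ u v z, G y (fderiv ℝ q y u v) z + G y (Γ y u (q y v)) z
      = covForm Γ Q y u v z + Q y (Γ y u v) z := by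
    intro u v z
    have hc : ∀ v : E, HasDerivAt (fun _ : ℝ ↦ v) 0 0 := fun v ↦ hasDerivAt_const _ _
    have h1 := hasDerivAt_line_apply₂ (L.differentiableAt_metric hy) u
      ((hasDerivAt_line hq' u).clm_apply (hc v)) (hc z)
    have h2 := hasDerivAt_line_of_eqOn L.isOpen (f := fun y ↦ G y (q y v) z)
      (g := fun y ↦ Q y v z) (fun y hy ↦ hqQ y hy v z) hy h1
    have h3 := h2.unique (hasDerivAt_line_apply₂ hQ' u (hc v) (hc z))
    simp only [zero_smul, add_zero, map_zero, _root_.zero_apply, L.compat y hy, hqQ y hy] at h3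
    rw [covForm]
    linarith
  have sg := L.metric_symm y hy
  have sQ := hQs y hy
  have sΓ := L.conn_symm y hy
  simp only [key, conformalSystem_apply]
  ext
  · simp only [Prod.fst_add, L.compat y hy, map_add, map_sub, map_neg, map_smul, _root_.add_apply,
      _root_.sub_apply, _root_.neg_apply, _root_.smul_apply, smul_eq_mul, hqQ y hy]
    rw [sΓ v u, sQ v u, sg v u]
    ring
  · simp only [Prod.fst_add, Prod.snd_add]
    rw [← sub_eq_zero]
    by_contra hne
    refine ((L.metric_pos y hy _ hne).ne') ?_
    have zero : ∀ z, G y (-fderiv ℝ Γ y u v X - σ • fderiv ℝ q y u v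
        + (-Γ y v (-Γ y u X - σ • q y u + ρ • u) - G y X u • q y v + -Q y u X • v)
        - (-fderiv ℝ Γ y v u X - σ • fderiv ℝ q y v u
        + (-Γ y u (-Γ y v X - σ • q y v + ρ • v) - G y X v • q y u + -Q y v X • u))) z = 0 := by
      intro z
      have h1 := hR y hy u v X z
      have h2 := hder u v z
      have h3 := hder v u z
      have h4 := hcot y hy u v z
      simp only [curvOp, phi, map_add, map_sub, map_neg, map_smul, _root_.add_apply,
        _root_.sub_apply, _root_.neg_apply, _root_.smul_apply, smul_eq_mul, hqQ y hy] at h1 ⊢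
      rw [sΓ v u] at h3 ⊢
      rw [sg X u, sg X v]
      linear_combination -h1 - σ * h2 + σ * h3 - σ * h4
    exact zero _
  · simp only [Prod.snd_add, map_add, map_sub, map_neg, map_smul, smul_eq_mul]
    have h1 := hcot y hy u v X
    have h2 := hqQ y hy v (q y u)
    have h3 := hqQ y hy u (q y v)
    rw [sg] at h2
    rw [covForm, covForm, sΓ v u] at h1
    rw [sQ v u]
    have h4 : Q y v (q y u) = Q y u (q y v) := by linarith
    rw [h4]
    linarith

/-- **Weyl–Schouten**: a metric with curvature `φ(Q)`, `Q` a Codazzi tensor, is locally conformally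
flat; the conformal factor is described through its gradient `X` and Hessian. -/
theorem exists_conformal_factor (L : IsLeviCivita Ω G Γ) (hQ : ContDiffOn ℝ ∞ Q Ω)
    (hQs : ∀ y ∈ Ω, ∀ u v, Q y u v = Q y v u)
    (hR : ∀ y ∈ Ω, ∀ b c w z, G y (curvOp Γ y b c w) z = phi (G y) (Q y) b c w z)
    (hcot : ∀ y ∈ Ω, ∀ u v w, covForm Γ Q y u v w = covForm Γ Q y v u w) {p : E} (hp : p ∈ Ω) :
    ∃ U : Set E, IsOpen U ∧ p ∈ U ∧ U ⊆ Ω ∧ ∃ (w : E → ℝ) (X : E → E), ContDiffOn ℝ ∞ w U ∧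
      ContDiffOn ℝ ∞ X U ∧ (∀ y ∈ U, ∀ u, G y (X y) u = fderiv ℝ w y u) ∧
      ∀ y ∈ U, ∀ u v, G y (fderiv ℝ X y u + Γ y u (X y)) v
        = G y (X y) u * G y (X y) v - 1 / 2 * G y (X y) (X y) * G y u v + Q y u v := by
  obtain ⟨q, hq, hqQ⟩ := exists_sharp L.isOpen L.contDiffOn_metric hQ L.metric_pos
  -- The initial value `(σ, X, ρ) = (1, 0, 0)` keeps `σ` positive near `p` and satisfies `2σρ =
  -- |X|²`.
  obtain ⟨U, hU, hpU, hUΩ, Y, hYp, hY, hY'⟩ := exists_parallel_section L.isOpen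
    (L.contDiffOn_conformalSystem hQ hq)
    (fun y hy u v ↦ L.conformalSystem_integrable hQ hQs hq hqQ hR hcot hy u v) hp (1, 0, 0)
  have hσcont : ContinuousAt (fun y ↦ (Y y).1) p :=
    continuous_fst.continuousAt.comp (hY.continuousOn.continuousAt (hU.mem_nhds hpU))
  have hpos : ∀ᶠ y in 𝓝 p, 0 < (Y y).1 :=
    hσcont.eventually_const_lt (by simp [hYp])
  obtain ⟨r, hr0, hr⟩ := Metric.mem_nhds_iff.1 (Filter.inter_mem (hU.mem_nhds hpU) hpos)
  have hrU : Metric.ball p r ⊆ U := fun y hy ↦ (hr hy).1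
  have hσ0 : ∀ y ∈ Metric.ball p r, 0 < (Y y).1 := fun y hy ↦ (hr hy).2
  have hpr : p ∈ Metric.ball p r := Metric.mem_ball_self hr0
  have hYr := hY.mono hrU
  have hline : ∀ y ∈ Metric.ball p r, ∀ u, HasDerivAt (fun t : ℝ ↦ Y (y + t • u))
      (conformalSystem (G y) (Q y) (q y) (Γ y) u (Y y)) 0 := by
    intro y hy u
    rw [← hY' y (hrU hy) u]
    exact hasDerivAt_line (differentiableAt_of_contDiffOn Metric.isOpen_ball hYr hy) u
  have hσ' : ∀ y ∈ Metric.ball p r, ∀ u, HasDerivAt (fun t : ℝ ↦ (Y (y + t • u)).1)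
      (G y (Y y).2.1 u) 0 := fun y hy u ↦ (hline y hy u).fst
  have hX' : ∀ y ∈ Metric.ball p r, ∀ u, HasDerivAt (fun t : ℝ ↦ (Y (y + t • u)).2.1)
      (-Γ y u (Y y).2.1 - (Y y).1 • q y u + (Y y).2.2 • u) 0 :=
    fun y hy u ↦ (hline y hy u).snd.fst
  have hρ' : ∀ y ∈ Metric.ball p r, ∀ u, HasDerivAt (fun t : ℝ ↦ (Y (y + t • u)).2.2)
      (-Q y u (Y y).2.1) 0 := fun y hy u ↦ (hline y hy u).snd.snd
  have sσ : ContDiffOn ℝ ∞ (fun y ↦ (Y y).1) (Metric.ball p r) := hYr.fst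
  have sX : ContDiffOn ℝ ∞ (fun y ↦ (Y y).2.1) (Metric.ball p r) := hYr.snd.fst
  have sρ : ContDiffOn ℝ ∞ (fun y ↦ (Y y).2.2) (Metric.ball p r) := hYr.snd.snd
  have hGr := L.contDiffOn_metric.mono (hrU.trans hUΩ)
  -- The function `2σρ - |X|²` is a first integral of the system and vanishes at `p`.
  have hconst : ∀ y ∈ Metric.ball p r, 2 * (Y y).1 * (Y y).2.2 = G y (Y y).2.1 (Y y).2.1 := by
    have sc : ContDiffOn ℝ ∞ (fun y ↦ 2 * (Y y).1 * (Y y).2.2 - G y (Y y).2.1 (Y y).2.1)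
        (Metric.ball p r) :=
      ((contDiffOn_const.mul sσ).mul sρ).sub ((hGr.clm_apply sX).clm_apply sX)
    intro y hy
    have h0 := Metric.isOpen_ball.is_const_of_fderiv_eq_zero (𝕜 := ℝ)
      (convex_ball p r).isPreconnected
      (fun y hy ↦ (differentiableAt_of_contDiffOn Metric.isOpen_ball sc hy).differentiableWithinAt)
      (fun y hy ↦ ?_) hy hpr
    · simp only [hYp, map_zero, mul_zero, sub_zero] at h0
      linarith
    · ext u
      have h1 := hasDerivAt_line (differentiableAt_of_contDiffOn Metric.isOpen_ball sc hy) u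
      have h2 := (((hσ' y hy u).const_mul 2).mul (hρ' y hy u)).sub
        (hasDerivAt_line_apply₂ (L.differentiableAt_metric (hUΩ (hrU hy))) u (hX' y hy u)
          (hX' y hy u))
      rw [h1.unique h2]
      have sg := L.metric_symm y (hUΩ (hrU hy))
      have sQ := hQs y (hUΩ (hrU hy))
      simp only [zero_smul, add_zero, L.compat y (hUΩ (hrU hy)), map_add, map_sub, map_neg,
        map_smul, _root_.add_apply, _root_.sub_apply, _root_.neg_apply, _root_.smul_apply,
        smul_eq_mul, hqQ y (hUΩ (hrU hy)), sg (Y y).2.1 (q y u), Pi.zero_apply,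
        _root_.zero_apply]
      rw [sg u]
      ring
  -- With `w = -log σ` one has `dw = -dσ/σ`, and `2σρ = |X|²` turns the `ρ`-term of the linear
  -- equation into `-½ |dw|² g`.
  refine ⟨Metric.ball p r, Metric.isOpen_ball, hpr, hrU.trans hUΩ,
    fun y ↦ -Real.log (Y y).1, fun y ↦ -((Y y).1⁻¹ • (Y y).2.1), ?_, ?_, ?_, ?_⟩
  · exact (sσ.log fun y hy ↦ (hσ0 y hy).ne').neg
  · exact ((sσ.inv fun y hy ↦ (hσ0 y hy).ne').smul sX).neg
  · intro y hy u
    have hw : DifferentiableAt ℝ (fun y ↦ -Real.log (Y y).1) y :=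
      differentiableAt_of_contDiffOn Metric.isOpen_ball
        (sσ.log fun y hy ↦ (hσ0 y hy).ne').neg hy
    have h1 := hasDerivAt_line hw u
    have h2 := ((hσ' y hy u).log (by simpa using (hσ0 y hy).ne')).neg
    rw [h1.unique h2]
    simp only [zero_smul, add_zero, map_neg, map_smul, _root_.neg_apply, _root_.smul_apply,
      smul_eq_mul]
    ring
  · intro y hy u v
    have hX : DifferentiableAt ℝ (fun y ↦ -((Y y).1⁻¹ • (Y y).2.1)) y :=
      differentiableAt_of_contDiffOn Metric.isOpen_ball
        ((sσ.inv fun y hy ↦ (hσ0 y hy).ne').smul sX).neg hy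
    have h1 := hasDerivAt_line hX u
    have h2 := (((hσ' y hy u).inv (by simpa using (hσ0 y hy).ne')).smul (hX' y hy u)).neg
    rw [h1.unique h2]
    have hne := (hσ0 y hy).ne'
    have hc := hconst y hy
    simp only [zero_smul, add_zero, map_add, map_sub, map_neg, map_smul, _root_.add_apply,
      _root_.sub_apply, _root_.neg_apply, _root_.smul_apply, smul_eq_mul,
      hqQ y (hUΩ (hrU hy)), ← hc, Pi.inv_apply]
    field_simp
    ring

end IsLeviCivita

end WeylSchouten

/-! ### Tensor fields read in a chart. -/

section Charts

variable {m : ℕ} {M : Type*} [TopologicalSpace M] [ChartedSpace (Coord m) M]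

/-- The derivative of the inverse of a chart. -/
noncomputable def chartVec (c : OpenPartialHomeomorph M (Coord m)) (y : Coord m) :
    Coord m →L[ℝ] TangentSpace (𝓡 m) (c.symm y) :=
  mfderiv (𝓡 m) (𝓡 m) c.symm y

/-- The derivative of a chart. -/
noncomputable def chartComp (c : OpenPartialHomeomorph M (Coord m)) (p : M) :
    TangentSpace (𝓡 m) p →L[ℝ] Coord m :=
  mfderiv (𝓡 m) (𝓡 m) c p

/-- A field of bilinear forms in a chart. -/
noncomputable def locForm (T : TwoTensor m M) (c : OpenPartialHomeomorph M (Coord m))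
    (y : Coord m) : Coord m →L[ℝ] Coord m →L[ℝ] ℝ :=
  (ContinuousLinearMap.precomp ℝ (chartVec c y)).comp ((T (c.symm y)).comp (chartVec c y))

/-- A field of endomorphisms in a chart. -/
noncomputable def locEnd (J : EndTensor m M) (c : OpenPartialHomeomorph M (Coord m))
    (y : Coord m) : Coord m →L[ℝ] Coord m :=
  (chartComp c (c.symm y)).comp ((J (c.symm y)).comp (chartVec c y))

lemma locForm_apply (T : TwoTensor m M) (c : OpenPartialHomeomorph M (Coord m)) (y u v : Coord m) :
    locForm T c y u v = T (c.symm y) (chartVec c y u) (chartVec c y v) := rfl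

lemma locEnd_apply (J : EndTensor m M) (c : OpenPartialHomeomorph M (Coord m)) (y u : Coord m) :
    locEnd J c y u = chartComp c (c.symm y) (J (c.symm y) (chartVec c y u)) := rfl

lemma coeff_eq (T : TwoTensor m M) (c : OpenPartialHomeomorph M (Coord m)) (i j : Fin m)
    (y : Coord m) :
    coeff T c i j y = locForm T c y (EuclideanSpace.single i 1) (EuclideanSpace.single j 1) := rfl

lemma endCoeff_eq (J : EndTensor m M) (c : OpenPartialHomeomorph M (Coord m)) (i j : Fin m)
    (y : Coord m) : endCoeff J c i j y = locEnd J c y (EuclideanSpace.single j 1) i := rfl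

variable [IsManifold (𝓡 m) ∞ M] {c : OpenPartialHomeomorph M (Coord m)}

lemma chart_mdifferentiable (hc : c ∈ atlas (Coord m) M) :
    c.MDifferentiable (𝓡 m) (𝓡 m) := by
  have : IsManifold (𝓡 m) 1 M := IsManifold.of_le (n := ∞) (by exact_mod_cast le_top)
  exact mdifferentiable_of_mem_atlas hc

lemma chartComp_chartVec (hc : c ∈ atlas (Coord m) M) {y : Coord m} (hy : y ∈ c.target)
    (u : Coord m) : chartComp c (c.symm y) (chartVec c y u) = u := by
  have h1 := (chart_mdifferentiable hc).comp_symm_deriv hy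
  exact congrArg (fun f : Coord m →L[ℝ] Coord m ↦ f u) h1

lemma chartVec_chartComp (hc : c ∈ atlas (Coord m) M) {y : Coord m} (hy : y ∈ c.target)
    (v : TangentSpace (𝓡 m) (c.symm y)) : chartVec c y (chartComp c (c.symm y) v) = v := by
  have hinj : Function.Injective (chartComp c (c.symm y)) :=
    (chart_mdifferentiable hc).mfderiv_injective (c.map_target hy)
  exact hinj (chartComp_chartVec hc hy _)

lemma chartVec_locEnd (hc : c ∈ atlas (Coord m) M) {y : Coord m} (hy : y ∈ c.target)
    (J : EndTensor m M) (u : Coord m) :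
    chartVec c y (locEnd J c y u) = J (c.symm y) (chartVec c y u) :=
  chartVec_chartComp hc hy _

lemma contMDiffOn_chart_symm (hc : c ∈ atlas (Coord m) M) :
    ContMDiffOn (𝓡 m) (𝓡 m) ∞ c.symm c.target :=
  contMDiffOn_symm_of_mem_maximalAtlas (IsManifold.subset_maximalAtlas hc)

lemma contMDiffOn_chart (hc : c ∈ atlas (Coord m) M) :
    ContMDiffOn (𝓡 m) (𝓡 m) ∞ c c.source :=
  contMDiffOn_of_mem_maximalAtlas (IsManifold.subset_maximalAtlas hc)

/-- The tangent map of the inverse chart, composed with a constant vector field. -/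
lemma contMDiffOn_chartVec (hc : c ∈ atlas (Coord m) M) (u : Coord m) :
    ContMDiffOn (𝓡 m) ((𝓡 m).prod 𝓘(ℝ, Coord m)) ∞
      (fun y ↦ Bundle.TotalSpace.mk' (Coord m) (E := fun p : M ↦ TangentSpace (𝓡 m) p)
        (c.symm y) (chartVec c y u)) c.target := by
  have : IsManifold (𝓡 m) 1 M := IsManifold.of_le (n := ∞) (by exact_mod_cast le_top)
  have h1 := (contMDiffOn_chart_symm hc).contMDiffOn_tangentMapWithin (m := ∞) (by simp)
    c.open_target.uniqueMDiffOn
  have h2 : ContMDiffOn (𝓡 m) ((𝓡 m).prod 𝓘(ℝ, Coord m)) ∞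
      (fun y : Coord m ↦ Bundle.TotalSpace.mk' (Coord m)
        (E := fun p : Coord m ↦ TangentSpace (𝓡 m) p) y u) c.target :=
    contMDiffOn_vectorSpace_iff_contDiffOn.2 contDiffOn_const
  refine (h1.comp h2 (fun y hy ↦ hy)).congr fun y hy ↦ ?_
  simp only [Function.comp_apply, tangentMapWithin, mfderivWithin_of_mem_nhds
    (c.open_target.mem_nhds hy)]
  rfl

lemma contDiffOn_form_apply (hc : c ∈ atlas (Coord m) M) {T : TwoTensor m M}
    (hT : SmoothTwoTensor T) {v w : (y : Coord m) → TangentSpace (𝓡 m) (c.symm y)}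
    (hv : ContMDiffOn (𝓡 m) ((𝓡 m).prod 𝓘(ℝ, Coord m)) ∞
      (fun y ↦ Bundle.TotalSpace.mk' (Coord m) (E := fun p : M ↦ TangentSpace (𝓡 m) p)
        (c.symm y) (v y)) c.target)
    (hw : ContMDiffOn (𝓡 m) ((𝓡 m).prod 𝓘(ℝ, Coord m)) ∞
      (fun y ↦ Bundle.TotalSpace.mk' (Coord m) (E := fun p : M ↦ TangentSpace (𝓡 m) p)
        (c.symm y) (w y)) c.target) :
    ContDiffOn ℝ ∞ (fun y ↦ T (c.symm y) (v y) (w y)) c.target := by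
  have : IsManifold (𝓡 m) 1 M := IsManifold.of_le (n := ∞) (by exact_mod_cast le_top)
  have h3 : ContMDiffOn (𝓡 m) ((𝓡 m).prod 𝓘(ℝ, ℝ)) ∞
      (fun y ↦ Bundle.TotalSpace.mk' ℝ (E := Bundle.Trivial M ℝ) (c.symm y)
        (T (c.symm y) (v y) (w y))) c.target := by
    apply ContMDiffOn.clm_bundle_apply₂ (F₁ := Coord m) (F₂ := Coord m)
    · exact ContMDiff.comp_contMDiffOn hT (contMDiffOn_chart_symm hc)
    · exact hv
    · exact hw
  rw [← contMDiffOn_iff_contDiffOn]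
  intro y hy
  have h4 := h3 y hy
  simp only [Bundle.contMDiffWithinAt_totalSpace] at h4
  exact h4.2

lemma contDiffOn_locForm (hc : c ∈ atlas (Coord m) M) {T : TwoTensor m M}
    (hT : SmoothTwoTensor T) : ContDiffOn ℝ ∞ (locForm T c) c.target := by
  refine contDiffOn_clm_apply.2 fun u ↦ contDiffOn_clm_apply.2 fun v ↦ ?_
  exact contDiffOn_form_apply hc hT (contMDiffOn_chartVec hc u) (contMDiffOn_chartVec hc v)

lemma contDiffOn_comp_chart_symm (hc : c ∈ atlas (Coord m) M) {f : M → ℝ}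
    (hf : ContMDiff (𝓡 m) 𝓘(ℝ, ℝ) ∞ f) : ContDiffOn ℝ ∞ (fun y ↦ f (c.symm y)) c.target := by
  rw [← contMDiffOn_iff_contDiffOn]
  exact hf.comp_contMDiffOn (contMDiffOn_chart_symm hc)

end Charts

namespace AlmostHermitianStructure

variable {m : ℕ} {M : Type*} [TopologicalSpace M] [ChartedSpace (Coord m) M]
  [IsManifold (𝓡 m) ∞ M] (S : AlmostHermitianStructure m M)
  {c : OpenPartialHomeomorph M (Coord m)} (hc : c ∈ atlas (Coord m) M)

lemma smooth_g : SmoothTwoTensor S.g := S.metric.contMDiff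

include hc

lemma isHermitianPair {y : Coord m} (hy : y ∈ c.target) :
    IsHermitianPair (locForm S.g c y) (locEnd S.J c y) where
  symm u v := S.metric.symm _ _ _
  pos u hu := by
    refine S.metric.pos _ _ fun h0 ↦ hu ?_
    have := chartComp_chartVec hc hy u
    rw [show chartVec c y u = 0 from h0, map_zero] at this
    exact this.symm
  sq u := by
    rw [locEnd_apply, chartVec_locEnd hc hy, S.J_J, map_neg, chartComp_chartVec hc hy]
  compat u v := by
    rw [locForm_apply, chartVec_locEnd hc hy, chartVec_locEnd hc hy]
    exact S.metric_J_J _ _ _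

lemma locForm_fundForm {y : Coord m} (hy : y ∈ c.target) (u v : Coord m) :
    locForm S.fundForm c y u v = locForm S.g c y u (locEnd S.J c y v) := by
  rw [locForm_apply, locForm_apply, chartVec_locEnd hc hy]
  rfl

lemma contDiffOn_locForm_fundForm : ContDiffOn ℝ ∞ (locForm S.fundForm c) c.target := by
  refine contDiffOn_clm_apply.2 fun u ↦ contDiffOn_clm_apply.2 fun v ↦ ?_
  have : IsManifold (𝓡 m) 1 M := IsManifold.of_le (n := ∞) (by exact_mod_cast le_top)
  refine contDiffOn_form_apply hc (T := S.g) (S.smooth_g) (contMDiffOn_chartVec hc u)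
    (w := fun y ↦ S.J (c.symm y) (chartVec c y v)) ?_
  apply ContMDiffOn.clm_bundle_apply (F₁ := Coord m) (F₂ := Coord m)
  · exact ContMDiff.comp_contMDiffOn S.smooth_J (contMDiffOn_chart_symm hc)
  · exact contMDiffOn_chartVec hc v

/-- `J` is recovered from the smooth form `F` by raising an index, since `g(Jv, u) = F(u, v)`; this
is why `F` is flipped. -/
lemma contDiffOn_locEnd : ContDiffOn ℝ ∞ (locEnd S.J c) c.target := by
  have hF : ContDiffOn ℝ ∞ (fun y ↦ (locForm S.fundForm c y).flip) c.target :=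
    (ContinuousLinearMap.flipₗᵢ ℝ (Coord m) (Coord m) ℝ).contDiff.comp_contDiffOn
      (S.contDiffOn_locForm_fundForm hc)
  obtain ⟨q, hq, hqF⟩ := exists_sharp c.open_target (contDiffOn_locForm hc (S.smooth_g)) hF
    (fun y hy ↦ (S.isHermitianPair hc hy).pos)
  refine hq.congr fun y hy ↦ ?_
  have H := S.isHermitianPair hc hy
  ext1 v
  by_contra hne
  refine (H.pos _ (sub_ne_zero.2 hne)).ne' ?_
  have key : ∀ u, locForm S.g c y (locEnd S.J c y v - q y v) u = 0 := by
    intro u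
    rw [map_sub, _root_.sub_apply, hqF y hy, ContinuousLinearMap.flip_apply,
      S.locForm_fundForm hc hy, H.symm u, sub_self]
  exact key _

end AlmostHermitianStructure

/-! ### Existence of the Levi-Civita connection and the Koszul formula. -/

section Koszul

variable {E : Type*} [NormedAddCommGroup E] [NormedSpace ℝ E]

/-- Half the Koszul form of a metric with derivative `A`. -/
noncomputable def koszulForm (A : E →L[ℝ] E →L[ℝ] E →L[ℝ] ℝ) : E →L[ℝ] E →L[ℝ] E →L[ℝ] ℝ :=
  (1 / 2 : ℝ) • (A + A.flip
    - ((ContinuousLinearMap.flipₗᵢ ℝ E E ℝ : (E →L[ℝ] E →L[ℝ] ℝ) ≃ₗᵢ[ℝ] (E →L[ℝ] E →L[ℝ] ℝ)) :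
      (E →L[ℝ] E →L[ℝ] ℝ) →L[ℝ] (E →L[ℝ] E →L[ℝ] ℝ)).comp A.flip)

lemma koszulForm_apply (A : E →L[ℝ] E →L[ℝ] E →L[ℝ] ℝ) (u v w : E) :
    koszulForm A u v w = 1 / 2 * (A u v w + A v u w - A w u v) := rfl

/-- The Levi-Civita connection of the metric `G`. -/
noncomputable def leviCivitaConn (G : E → E →L[ℝ] E →L[ℝ] ℝ) (y : E) : E →L[ℝ] E →L[ℝ] E :=
  (ContinuousLinearMap.compL ℝ E (E →L[ℝ] ℝ) E (G y).inverse).comp (koszulForm (fderiv ℝ G y))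

lemma leviCivitaConn_apply (G : E → E →L[ℝ] E →L[ℝ] ℝ) (y u v : E) :
    leviCivitaConn G y u v = (G y).inverse (koszulForm (fderiv ℝ G y) u v) := rfl

variable [FiniteDimensional ℝ E]

lemma isLeviCivita_leviCivitaConn {Ω : Set E} (hΩ : IsOpen Ω) {G : E → E →L[ℝ] E →L[ℝ] ℝ}
    (hG : ContDiffOn ℝ ∞ G Ω) (hsymm : ∀ y ∈ Ω, ∀ u v, G y u v = G y v u)
    (hpos : ∀ y ∈ Ω, ∀ u, u ≠ 0 → 0 < G y u u) : IsLeviCivita Ω G (leviCivitaConn G) := by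
  have hinv : ∀ y ∈ Ω, ∀ u v w, G y (leviCivitaConn G y u v) w
      = 1 / 2 * (fderiv ℝ G y u v w + fderiv ℝ G y v u w - fderiv ℝ G y w u v) := by
    intro y hy u v w
    have h1 := (isInvertible_of_pos (hpos y hy)).self_comp_inverse
    have h2 := congrArg (fun f : (E →L[ℝ] ℝ) →L[ℝ] (E →L[ℝ] ℝ) ↦
      f (koszulForm (fderiv ℝ G y) u v) w) h1
    exact h2
  have hder : ∀ y ∈ Ω, ∀ a u v, fderiv ℝ G y a u v = fderiv ℝ G y a v u := by
    intro y hy a u v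
    have hd := differentiableAt_of_contDiffOn hΩ hG hy
    have h1 : ∀ u v, HasDerivAt (fun t : ℝ ↦ G (y + t • a) u v) (fderiv ℝ G y a u v) 0 := by
      intro u v
      simpa using hasDerivAt_line_apply₂ hd a (hasDerivAt_const (0 : ℝ) u)
        (hasDerivAt_const (0 : ℝ) v)
    exact (hasDerivAt_line_of_eqOn hΩ (f := fun y ↦ G y u v) (g := fun y ↦ G y v u)
      (fun y hy ↦ hsymm y hy u v) hy (h1 u v)).unique (h1 v u)
  refine ⟨hΩ, hG, ?_, hsymm, hpos, fun y hy u v ↦ ?_, fun y hy w u v ↦ ?_⟩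
  · have hK : ContDiffOn ℝ ∞ (fun y ↦ koszulForm (fderiv ℝ G y)) Ω := by
      have hA : ∀ u v w, ContDiffOn ℝ ∞ (fun y ↦ fderiv ℝ G y u v w) Ω := fun u v w ↦
        (((contDiffOn_fderiv hΩ hG).clm_apply contDiffOn_const).clm_apply
          contDiffOn_const).clm_apply contDiffOn_const
      refine contDiffOn_clm_apply.2 fun u ↦ contDiffOn_clm_apply.2 fun v ↦
        contDiffOn_clm_apply.2 fun w ↦ ?_
      simp only [koszulForm_apply]
      exact contDiffOn_const.mul (((hA _ _ _).add (hA _ _ _)).sub (hA _ _ _))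
    refine contDiffOn_clm_apply.2 fun u ↦ contDiffOn_clm_apply.2 fun v ↦ ?_
    simp only [leviCivitaConn_apply]
    refine ContDiffOn.clm_apply (fun y hy ↦ ContDiffAt.contDiffWithinAt ?_)
      ((hK.clm_apply contDiffOn_const).clm_apply contDiffOn_const)
    obtain ⟨e, he⟩ := isInvertible_of_pos (hpos y hy)
    have h1 : ContDiffAt ℝ ∞ ContinuousLinearMap.inverse (G y) := by
      rw [← he]; exact contDiffAt_map_inverse e
    exact h1.comp y (hG.contDiffAt (hΩ.mem_nhds hy))
  · rw [leviCivitaConn_apply, leviCivitaConn_apply]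
    congr 1
    ext w
    rw [koszulForm_apply, koszulForm_apply, hder y hy w u v]
    ring
  · rw [hsymm y hy u, hinv y hy, hinv y hy, hder y hy w v u, hder y hy u w v, hder y hy v w u]
    ring

omit [FiniteDimensional ℝ E] in
lemma IsLeviCivita.koszul {Ω : Set E} {G : E → E →L[ℝ] E →L[ℝ] ℝ} {Γ : E → E →L[ℝ] E →L[ℝ] E}
    (L : IsLeviCivita Ω G Γ) {y : E} (hy : y ∈ Ω) (u v w : E) :
    1 / 2 * (fderiv ℝ G y u v w + fderiv ℝ G y v u w - fderiv ℝ G y w u v)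
      = G y (Γ y u v) w := by
  rw [L.compat y hy, L.compat y hy, L.compat y hy, L.conn_symm y hy v u, L.conn_symm y hy w u,
    L.conn_symm y hy w v, L.metric_symm y hy v, L.metric_symm y hy u]
  ring

end Koszul

/-! ### Agreement of the coordinate formulas with the coordinate-free ones. -/

section Coordinates

variable {m : ℕ}

lemma sum_smul_single (x : Coord m) : ∑ a, x a • EuclideanSpace.single a (1 : ℝ) = x := by
  simpa using (EuclideanSpace.basisFun (Fin m) ℝ).sum_repr x

lemma sum_mul_apply_single (φ : Coord m →L[ℝ] ℝ) (x : Coord m) :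
    ∑ a, x a * φ (EuclideanSpace.single a 1) = φ x := by
  conv_rhs => rw [← sum_smul_single x, map_sum]
  simp

lemma sum_mul_clm_apply_single (φ : Coord m →L[ℝ] Coord m) (x : Coord m) (l : Fin m) :
    ∑ a, x a * φ (EuclideanSpace.single a 1) l = φ x l :=
  sum_mul_apply_single ((EuclideanSpace.proj l).comp φ) x

lemma isUnit_det_of_pos {g : Coord m →L[ℝ] Coord m →L[ℝ] ℝ} (hg : ∀ u, u ≠ 0 → 0 < g u u) :
    IsUnit (Matrix.of fun a b : Fin m ↦
      g (EuclideanSpace.single a 1) (EuclideanSpace.single b 1)).det := by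
  rw [← Matrix.isUnit_iff_isUnit_det, ← Matrix.mulVec_injective_iff_isUnit]
  refine (injective_iff_map_eq_zero (Matrix.mulVecLin _)).2 fun x hx ↦ ?_
  by_contra hne
  have h1 : WithLp.toLp 2 x ≠ 0 := by simpa using hne
  refine (hg _ h1).ne' ?_
  have h2 : ∀ a, g (EuclideanSpace.single a 1) (WithLp.toLp 2 x) = 0 := by
    intro a
    have := congrFun hx a
    simp only [Matrix.mulVecLin_apply, Matrix.mulVec, dotProduct, Matrix.of_apply,
      Pi.zero_apply] at this
    rw [← sum_mul_apply_single, ← this]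
    exact Finset.sum_congr rfl fun b _ ↦ mul_comm _ _
  have h3 := sum_mul_apply_single (g.flip (WithLp.toLp 2 x)) (WithLp.toLp 2 x)
  simp only [ContinuousLinearMap.flip_apply, h2, mul_zero, Finset.sum_const_zero] at h3
  exact h3.symm

variable {M : Type*} [TopologicalSpace M] [ChartedSpace (Coord m) M]
  {c : OpenPartialHomeomorph M (Coord m)} {T : TwoTensor m M} {Ω : Set (Coord m)}
  {Γ : Coord m → Coord m →L[ℝ] Coord m →L[ℝ] Coord m}

lemma pderiv_coeff {y : Coord m} (hT : DifferentiableAt ℝ (locForm T c) y) (k i j : Fin m) :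
    pderiv k (coeff T c i j) y = fderiv ℝ (locForm T c) y (EuclideanSpace.single k 1)
      (EuclideanSpace.single i 1) (EuclideanSpace.single j 1) := by
  have h1 : HasFDerivAt (coeff T c i j) _ y :=
    (hT.hasFDerivAt.clm_apply (hasFDerivAt_const (EuclideanSpace.single i (1 : ℝ)) y)).clm_apply
      (hasFDerivAt_const (EuclideanSpace.single j (1 : ℝ)) y)
  rw [pderiv, h1.fderiv]
  simp
  rfl

namespace IsLeviCivita

variable (L : IsLeviCivita Ω (locForm T c) Γ) {y : Coord m} (hy : y ∈ Ω)
include L hy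

lemma sum_invCoeff (k a : Fin m) :
    ∑ l, invCoeff T c k l y * coeff T c l a y = if k = a then 1 else 0 := by
  have h1 := Matrix.nonsing_inv_mul _ (isUnit_det_of_pos (L.metric_pos y hy))
  have h2 := congrFun (congrFun h1 k) a
  rw [Matrix.mul_apply, Matrix.one_apply] at h2
  exact h2

lemma christoffel_eq (k i j : Fin m) : christoffel T c k i j y
    = Γ y (EuclideanSpace.single i 1) (EuclideanSpace.single j 1) k := by
  have hd := L.differentiableAt_metric hy
  set v := Γ y (EuclideanSpace.single i 1) (EuclideanSpace.single j 1) with hv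
  -- The Koszul formula gives the Christoffel symbol with its index lowered; the inverse matrix then
  -- raises it.
  have h1 : ∀ l, 1 / 2 * (pderiv i (coeff T c j l) y + pderiv j (coeff T c i l) y
      - pderiv l (coeff T c i j) y) = ∑ a, v a * coeff T c l a y := by
    intro l
    rw [pderiv_coeff hd, pderiv_coeff hd, pderiv_coeff hd, L.koszul hy, ← hv,
      L.metric_symm y hy, ← sum_mul_apply_single]
    rfl
  calc christoffel T c k i j y
      = ∑ l, invCoeff T c k l y * ∑ a, v a * coeff T c l a y := by
        rw [christoffel, Finset.mul_sum]
        refine Finset.sum_congr rfl fun l _ ↦ ?_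
        rw [← h1]; ring
    _ = ∑ a, v a * ∑ l, invCoeff T c k l y * coeff T c l a y := by
        simp only [Finset.mul_sum]
        rw [Finset.sum_comm]
        exact Finset.sum_congr rfl fun a _ ↦ Finset.sum_congr rfl fun l _ ↦ by ring
    _ = v k := by simp [L.sum_invCoeff hy]

lemma pderiv_christoffel (l k i j : Fin m) : pderiv l (christoffel T c k i j) y
    = fderiv ℝ Γ y (EuclideanSpace.single l 1) (EuclideanSpace.single i 1)
      (EuclideanSpace.single j 1) k := by
  have h0 : christoffel T c k i j =ᶠ[𝓝 y] fun y ↦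
      (EuclideanSpace.proj k : Coord m →L[ℝ] ℝ)
        (Γ y (EuclideanSpace.single i 1) (EuclideanSpace.single j 1)) := by
    filter_upwards [L.isOpen.mem_nhds hy] with z hz using L.christoffel_eq hz k i j
  have h1 := (EuclideanSpace.proj k : Coord m →L[ℝ] ℝ).hasFDerivAt.comp y
    (((L.differentiableAt_conn hy).hasFDerivAt.clm_apply
    (hasFDerivAt_const (EuclideanSpace.single i (1 : ℝ)) y)).clm_apply
      (hasFDerivAt_const (EuclideanSpace.single j (1 : ℝ)) y))
  have h2 := h1.congr_of_eventuallyEq h0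
  rw [pderiv, h2.fderiv]
  simp

lemma curvUp_eq (l i j k : Fin m) : curvUp T c l i j k y
    = curvOp Γ y (EuclideanSpace.single i 1) (EuclideanSpace.single j 1)
      (EuclideanSpace.single k 1) l := by
  rw [curvUp, L.pderiv_christoffel hy, L.pderiv_christoffel hy, Finset.sum_sub_distrib]
  simp only [L.christoffel_eq hy]
  have h := fun i x ↦ sum_mul_clm_apply_single (Γ y (EuclideanSpace.single i 1)) x l
  simp only [mul_comm (Γ y _ _ l), h, curvOp, PiLp.add_apply, PiLp.sub_apply]
  ring

lemma curvCoeff_eq (i j k l : Fin m) : curvCoeff T c i j k l y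
    = locForm T c y (curvOp Γ y (EuclideanSpace.single i 1) (EuclideanSpace.single j 1)
      (EuclideanSpace.single k 1)) (EuclideanSpace.single l 1) := by
  rw [curvCoeff]
  simp only [L.curvUp_eq hy, coeff_eq]
  exact sum_mul_apply_single ((locForm T c y).flip _) _

-- Multilinearity of `curvOp`: each slot in turn is exhibited as a continuous linear map and summed
-- over the basis.
omit L hy in
lemma sum_curvOp (Γ : Coord m → Coord m →L[ℝ] Coord m →L[ℝ] Coord m)
    (g : Coord m →L[ℝ] Coord m →L[ℝ] ℝ) (y a b d z : Coord m) :
    ∑ i, ∑ j, ∑ k, ∑ l, g (curvOp Γ y (EuclideanSpace.single i 1) (EuclideanSpace.single j 1)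
      (EuclideanSpace.single k 1)) (EuclideanSpace.single l 1) * a i * b j * d k * z l
      = g (curvOp Γ y a b d) z := by
  have h4 : ∀ a b d : Coord m, ∑ l, z l * g (curvOp Γ y a b d) (EuclideanSpace.single l 1)
      = g (curvOp Γ y a b d) z := fun a b d ↦ sum_mul_apply_single _ z
  have h3 : ∀ a b : Coord m, ∑ k, d k * g (curvOp Γ y a b (EuclideanSpace.single k 1)) z
      = g (curvOp Γ y a b d) z := fun a b ↦ by
    have := sum_mul_apply_single ((g.flip z).comp (fderiv ℝ Γ y a b - fderiv ℝ Γ y b a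
      + (Γ y a).comp (Γ y b) - (Γ y b).comp (Γ y a))) d
    exact this
  have h2 : ∀ a : Coord m, ∑ j, b j * g (curvOp Γ y a (EuclideanSpace.single j 1) d) z
      = g (curvOp Γ y a b d) z := fun a ↦ by
    have := sum_mul_apply_single ((g.flip z).comp ((fderiv ℝ Γ y a).flip d
      - ((fderiv ℝ Γ y).flip a).flip d
      + (Γ y a).comp ((Γ y).flip d) - (Γ y).flip (Γ y a d))) b
    exact this
  have h1 : ∑ i, a i * g (curvOp Γ y (EuclideanSpace.single i 1) b d) z
      = g (curvOp Γ y a b d) z := by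
    have := sum_mul_apply_single ((g.flip z).comp (((fderiv ℝ Γ y).flip b).flip d
      - (fderiv ℝ Γ y b).flip d
      + (Γ y).flip (Γ y b d) - (Γ y b).comp ((Γ y).flip d))) a
    exact this
  rw [← h1]
  refine Finset.sum_congr rfl fun i _ ↦ ?_
  rw [← h2, Finset.mul_sum]
  refine Finset.sum_congr rfl fun j _ ↦ ?_
  rw [← h3, Finset.mul_sum, Finset.mul_sum]
  refine Finset.sum_congr rfl fun k _ ↦ ?_
  rw [← h4, Finset.mul_sum, Finset.mul_sum, Finset.mul_sum]
  refine Finset.sum_congr rfl fun l _ ↦ ?_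
  ring

lemma curvature_eq (hΩ : Ω ⊆ c.target) (x v z u : TangentSpace (𝓡 m) (c.symm y)) :
    curvature T c (c.symm y) x v z u
      = locForm T c y (curvOp Γ y (chartComp c (c.symm y) x) (chartComp c (c.symm y) v)
        (chartComp c (c.symm y) z)) (chartComp c (c.symm y) u) := by
  rw [curvature, c.right_inv (hΩ hy), ← sum_curvOp]
  simp only [L.curvCoeff_eq hy]
  rfl

lemma covDerivEnd_eq {J : EndTensor m M} (hJ : DifferentiableAt ℝ (locEnd J c) y)
    (k i j : Fin m) : covDerivEnd T J c k i j y
      = covEnd Γ (locEnd J c) y (EuclideanSpace.single k 1) (EuclideanSpace.single j 1) i := by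
  have h1 : HasFDerivAt (endCoeff J c i j) _ y :=
    (EuclideanSpace.proj i : Coord m →L[ℝ] ℝ).hasFDerivAt.comp y
      (hJ.hasFDerivAt.clm_apply (hasFDerivAt_const (EuclideanSpace.single j (1 : ℝ)) y))
  rw [covDerivEnd, pderiv, h1.fderiv, Finset.sum_sub_distrib]
  have h2 := sum_mul_clm_apply_single (Γ y (EuclideanSpace.single k 1))
    (locEnd J c y (EuclideanSpace.single j 1)) i
  have h3 := sum_mul_clm_apply_single (locEnd J c y)
    (Γ y (EuclideanSpace.single k 1) (EuclideanSpace.single j 1)) i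
  simp only [L.christoffel_eq hy, endCoeff_eq]
  simp only [mul_comm (Γ y _ _ i), h2, h3, covEnd, PiLp.add_apply, PiLp.sub_apply]
  rw [add_sub_assoc]
  congr 1
  simp
  rfl

lemma covDerivForm_eq {F : TwoTensor m M} (hF : DifferentiableAt ℝ (locForm F c) y)
    (k i j : Fin m) : covDerivForm T F c k i j y
      = covForm Γ (locForm F c) y (EuclideanSpace.single k 1) (EuclideanSpace.single i 1)
        (EuclideanSpace.single j 1) := by
  rw [covDerivForm, pderiv_coeff hF, covForm, Finset.sum_add_distrib]
  simp only [L.christoffel_eq hy, coeff_eq]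
  rw [sum_mul_apply_single]
  have h2 := sum_mul_apply_single ((locForm F c y).flip (EuclideanSpace.single j 1))
    (Γ y (EuclideanSpace.single k 1) (EuclideanSpace.single i 1))
  simp only [ContinuousLinearMap.flip_apply] at h2
  rw [h2]
  ring

end IsLeviCivita

end Coordinates

/-! ### Traces through the inverse metric and through orthonormal frames. -/

section Trace

variable {m : ℕ}

/-- With the frame as the rows of `B`, orthonormality reads `B A Bᵀ = 1`. Equal cardinalities allow
the factors to be exchanged, so `A⁻¹ = Bᵀ B`. -/
lemma sum_inv_mul_eq_sum_orthonormal {ι : Type*} [Fintype ι] [DecidableEq ι]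
    (hι : Fintype.card ι = m) {g t : Coord m →L[ℝ] Coord m →L[ℝ] ℝ} {b : ι → Coord m}
    (hb : ∀ r s, g (b r) (b s) = if r = s then 1 else 0) :
    ∑ i, ∑ j, (Matrix.of fun i j : Fin m ↦
        g (EuclideanSpace.single i 1) (EuclideanSpace.single j 1))⁻¹ i j
      * t (EuclideanSpace.single i 1) (EuclideanSpace.single j 1) = ∑ s, t (b s) (b s) := by
  set A : Matrix (Fin m) (Fin m) ℝ := Matrix.of fun i j : Fin m ↦
        g (EuclideanSpace.single i 1) (EuclideanSpace.single j 1) with hA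
  let B : Matrix ι (Fin m) ℝ := Matrix.of fun s i ↦ b s i
  have hexp : ∀ (t : Coord m →L[ℝ] Coord m →L[ℝ] ℝ) (x y : Coord m), ∑ i, ∑ j, x i * y j *
      t (EuclideanSpace.single i 1) (EuclideanSpace.single j 1) = t x y := by
    intro t x y
    refine Eq.trans ?_ (sum_mul_apply_single (t.flip y) x)
    refine Finset.sum_congr rfl fun i _ ↦ ?_
    rw [ContinuousLinearMap.flip_apply, ← sum_mul_apply_single (t _) y, Finset.mul_sum]
    exact Finset.sum_congr rfl fun j _ ↦ by ring
  have h1 : B * (A * B.transpose) = 1 := by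
    ext r s
    rw [Matrix.one_apply, ← hb, ← hexp, Matrix.mul_apply]
    refine Finset.sum_congr rfl fun i _ ↦ ?_
    rw [Matrix.mul_apply, Finset.mul_sum]
    exact Finset.sum_congr rfl fun j _ ↦ by simp [A, B]; ring
  have h2 : A * B.transpose * B = 1 :=
    (Matrix.mul_eq_one_comm_of_card_eq _ _ _ (by simpa using hι)).1 h1
  have h3 : A⁻¹ = B.transpose * B := by
    rw [Matrix.mul_assoc] at h2
    exact Matrix.inv_eq_right_inv h2
  rw [Finset.sum_congr rfl fun s _ ↦ (hexp t (b s) (b s)).symm]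
  simp only [h3, Matrix.mul_apply, Finset.sum_mul]
  rw [Finset.sum_comm_cycle]
  rfl

end Trace

/-! ### The hypotheses of the theorem in a chart. -/

namespace AlmostHermitianStructure

variable {m : ℕ} {M : Type*} [TopologicalSpace M] [ChartedSpace (Coord m) M]
  [IsManifold (𝓡 m) ∞ M] (S : AlmostHermitianStructure m M)
  {c : OpenPartialHomeomorph M (Coord m)} (hc : c ∈ atlas (Coord m) M)

/-- The tensor `P + (f / 2) g`, which satisfies `φ(P + (f / 2) g) = φ(P) + f π₁`. -/
noncomputable def shiftedTensor (P : TwoTensor m M) (f : M → ℝ) : TwoTensor m M :=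
  fun p ↦ P p + (f p / 2) • S.g p

lemma locForm_shiftedTensor (P : TwoTensor m M) (f : M → ℝ) (y : Coord m) :
    locForm (S.shiftedTensor P f) c y
      = locForm P c y + (f (c.symm y) / 2) • locForm S.g c y := rfl

include hc

lemma isLeviCivita : IsLeviCivita c.target (locForm S.g c) (leviCivitaConn (locForm S.g c)) :=
  isLeviCivita_leviCivitaConn c.open_target (contDiffOn_locForm hc S.smooth_g)
    (fun _ hy ↦ (S.isHermitianPair hc hy).symm) (fun _ hy ↦ (S.isHermitianPair hc hy).pos)

lemma hasLocalCurvatureForm {P : TwoTensor m M} (hP : SmoothTwoTensor P)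
    (hPsymm : ∀ (p : M) (x y : TangentSpace (𝓡 m) p), P p x y = P p y x)
    {f h : M → ℝ} (hf : ContMDiff (𝓡 m) 𝓘(ℝ, ℝ) ∞ f) (hh : ContMDiff (𝓡 m) 𝓘(ℝ, ℝ) ∞ h)
    (hR : S.HasCurvatureForm P f h) :
    HasLocalCurvatureForm c.target (locForm S.g c) (leviCivitaConn (locForm S.g c))
      (locEnd S.J c) (locForm (S.shiftedTensor P f) c) (fun y ↦ h (c.symm y)) where
  toIsLeviCivita := S.isLeviCivita hc
  contDiffOn_J := S.contDiffOn_locEnd hc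
  contDiffOn_Q := (contDiffOn_locForm hc hP).add
    (((contDiffOn_comp_chart_symm hc hf).div_const 2).smul (contDiffOn_locForm hc S.smooth_g))
  contDiffOn_h := contDiffOn_comp_chart_symm hc hh
  hermitian _ hy := S.isHermitianPair hc hy
  Q_symm y hy u v := by
    rw [locForm_shiftedTensor]
    simp only [_root_.add_apply, _root_.smul_apply, smul_eq_mul]
    rw [(S.isHermitianPair hc hy).symm u v]
    congr 1
    exact hPsymm _ _ _
  curvature_eq y hy b d w z := by
    have h1 := hR c hc _ (c.map_target hy) (chartVec c y b) (chartVec c y d) (chartVec c y w)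
      (chartVec c y z)
    rw [(S.isLeviCivita hc).curvature_eq hy subset_rfl] at h1
    simp only [chartComp_chartVec hc hy] at h1
    rw [h1, locForm_shiftedTensor, pi2_eq]
    simp only [phi, pi1, pi2, psi, _root_.add_apply, _root_.smul_apply, smul_eq_mul, locForm_apply,
      chartVec_locEnd hc hy]
    ring

end AlmostHermitianStructure

section

variable {m : ℕ} {M : Type*} [TopologicalSpace M] [ChartedSpace (Coord m) M]
  [IsManifold (𝓡 m) ∞ M] {S : AlmostHermitianStructure m M}
  {c : OpenPartialHomeomorph M (Coord m)} {Q : Coord m → Coord m →L[ℝ] Coord m →L[ℝ] ℝ}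
  {Γ : Coord m → Coord m →L[ℝ] Coord m →L[ℝ] Coord m} {h : Coord m → ℝ}

lemma HasLocalCurvatureForm.covForm_fundForm (hc : c ∈ atlas (Coord m) M)
    (C : HasLocalCurvatureForm c.target (locForm S.g c) Γ (locEnd S.J c) Q h)
    {y : Coord m} (hy : y ∈ c.target) (w u v : Coord m) :
    covForm Γ (locForm S.fundForm c) y w u v
      = locForm S.g c y u (covEnd Γ (locEnd S.J c) y w v) := by
  have h1 : HasDerivAt (fun t : ℝ ↦ locForm S.fundForm c (y + t • w) u v)
      (fderiv ℝ (locForm S.fundForm c) y w u v) 0 := by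
    simpa using hasDerivAt_line_apply₂ (differentiableAt_of_contDiffOn C.isOpen
      (S.contDiffOn_locForm_fundForm hc) hy) w (hasDerivAt_const (0 : ℝ) u)
      (hasDerivAt_const (0 : ℝ) v)
  have h2 := hasDerivAt_line_of_eqOn C.isOpen
    (g := fun y ↦ locForm S.g c y u (locEnd S.J c y v))
    (fun z hz ↦ S.locForm_fundForm hc hz u v) hy h1
  rw [covForm, h2.unique (C.hasDerivAt_form hy w u v), S.locForm_fundForm hc hy,
    S.locForm_fundForm hc hy, covEnd, map_sub, map_add]
  ring

lemma HasLocalCurvatureForm.isTraceFree {n : ℕ} (hm : m = 2 * n) (hc : c ∈ atlas (Coord m) M)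
    (C : HasLocalCurvatureForm c.target (locForm S.g c) Γ (locEnd S.J c) Q h)
    (hS : S.IsSemiKahler) : C.IsTraceFree n := by
  intro y hy e he v
  have H := C.hermitian y hy
  -- The trace of `t v` is `-(δF)(v)`. It is computed in the orthonormal basis `e i`, `J (e i)`, for
  -- coordinate vectors `v` at first and then for all `v` by linearity.
  let t : Coord m → Coord m →L[ℝ] Coord m →L[ℝ] ℝ := fun v ↦
    ((locForm S.g c y).flip.comp ((fderiv ℝ (locEnd S.J c) y).flip v
      + (Γ y).flip (locEnd S.J c y v) - (locEnd S.J c y).comp ((Γ y).flip v)))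
  have ht : ∀ v w u, t v w u = locForm S.g c y u (covEnd Γ (locEnd S.J c) y w v) :=
    fun v w u ↦ rfl
  let b : Fin n ⊕ Fin n → Coord m :=
    Sum.elim (fun i ↦ e i) (fun i ↦ locEnd S.J c y (e i))
  have hb : ∀ r s, locForm S.g c y (b r) (b s) = if r = s then 1 else 0 := by
    rintro (r | r) (s | s)
    · simpa [b, Fin.ext_iff] using (he r r.2 s s.2).1
    · simpa [b] using (he r r.2 s s.2).2
    · simpa [b, H.symm (locEnd S.J c y (e r))] using (he s s.2 r r.2).2
    · simpa [b, Fin.ext_iff, H.compat] using (he r r.2 s s.2).1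
  have hcod : ∀ j : Fin m, ∑ s, t (EuclideanSpace.single j 1) (b s) (b s) = 0 := by
    intro j
    have h1 := hS c hc _ (c.map_target hy) j
    rw [c.right_inv hy, coderiv, neg_eq_zero] at h1
    rw [← sum_inv_mul_eq_sum_orthonormal (by simp [hm, two_mul]) hb, ← h1]
    refine Finset.sum_congr rfl fun i _ ↦ Finset.sum_congr rfl fun k _ ↦ ?_
    rw [C.toIsLeviCivita.covDerivForm_eq hy (differentiableAt_of_contDiffOn C.isOpen
      (S.contDiffOn_locForm_fundForm hc) hy), C.covForm_fundForm hc hy, ht]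
    rfl
  have hsum : ∑ s, t v (b s) (b s) = 0 := by
    have h2 : ∀ w u, t v w u = ∑ j, v j * t (EuclideanSpace.single j 1) w u := by
      intro w u
      exact (sum_mul_apply_single ((locForm S.g c y u).comp (fderiv ℝ (locEnd S.J c) y w
        + (Γ y w).comp (locEnd S.J c y) - (locEnd S.J c y).comp (Γ y w))) v).symm
    simp only [h2]
    rw [Finset.sum_comm]
    simp only [← Finset.mul_sum, hcod, mul_zero, Finset.sum_const_zero]
  rw [Fintype.sum_sum_type] at hsum
  rw [Finset.sum_add_distrib, Finset.sum_range, Finset.sum_range]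
  exact hsum

end

/-! ### Behaviour under local isometries. -/

section Pullback

variable {E : Type*} [NormedAddCommGroup E] [NormedSpace ℝ E]
  {Ω Ω₀ : Set E} {G G₀ : E → E →L[ℝ] E →L[ℝ] ℝ} {Γ Γ₀ : E → E →L[ℝ] E →L[ℝ] E} {τ : E → E}

namespace IsLeviCivita

lemma mono (L : IsLeviCivita Ω G Γ) {U : Set E} (hU : IsOpen U) (h : U ⊆ Ω) :
    IsLeviCivita U G Γ :=
  ⟨hU, L.contDiffOn_metric.mono h, L.contDiffOn_conn.mono h, fun y hy ↦ L.metric_symm y (h hy),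
    fun y hy ↦ L.metric_pos y (h hy), fun y hy ↦ L.conn_symm y (h hy),
    fun y hy ↦ L.compat y (h hy)⟩

variable (L : IsLeviCivita Ω G Γ) (L₀ : IsLeviCivita Ω₀ G₀ Γ₀) (hτ : ContDiffOn ℝ ∞ τ Ω)
  (hmap : Set.MapsTo τ Ω Ω₀)
  (hG : ∀ y ∈ Ω, ∀ u v, G y u v = G₀ (τ y) (fderiv ℝ τ y u) (fderiv ℝ τ y v))
include L L₀ hτ hmap hG

omit L₀ hτ hmap in
lemma injective_fderiv_of_isometry {y : E} (hy : y ∈ Ω) :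
    Function.Injective (fderiv ℝ τ y) := by
  refine (injective_iff_map_eq_zero _).2 fun u hu ↦ ?_
  by_contra hne
  have := L.metric_pos y hy u hne
  rw [hG y hy, hu] at this
  simp at this

omit L₀ hτ hmap in
lemma isInvertible_fderiv_of_isometry [FiniteDimensional ℝ E] {y : E} (hy : y ∈ Ω) :
    (fderiv ℝ τ y).IsInvertible :=
  ⟨(LinearEquiv.ofInjectiveEndo (fderiv ℝ τ y : E →ₗ[ℝ] E)
    (L.injective_fderiv_of_isometry hG hy)).toContinuousLinearEquiv, by ext; rfl⟩

lemma fderiv_pullback {y : E} (hy : y ∈ Ω) (u v w : E) :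
    fderiv ℝ G y u v w = fderiv ℝ G₀ (τ y) (fderiv ℝ τ y u) (fderiv ℝ τ y v) (fderiv ℝ τ y w)
      + G₀ (τ y) (fderiv ℝ (fderiv ℝ τ) y u v) (fderiv ℝ τ y w)
      + G₀ (τ y) (fderiv ℝ τ y v) (fderiv ℝ (fderiv ℝ τ) y u w) := by
  have h1 : HasDerivAt (fun t : ℝ ↦ G (y + t • u) v w) (fderiv ℝ G y u v w) 0 := by
    simpa using hasDerivAt_line_apply₂ (L.differentiableAt_metric hy) u
      (hasDerivAt_const (0 : ℝ) v) (hasDerivAt_const (0 : ℝ) w)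
  have h2 := hasDerivAt_line_of_eqOn L.isOpen (fun z hz ↦ hG z hz v w) hy h1
  have hτ1 := hasDerivAt_line (differentiableAt_of_contDiffOn L.isOpen hτ hy) u
  have hτ2 : ∀ v, HasDerivAt (fun t : ℝ ↦ fderiv ℝ τ (y + t • u) v)
      (fderiv ℝ (fderiv ℝ τ) y u v) 0 := fun v ↦ by
    simpa using (hasDerivAt_line (differentiableAt_of_contDiffOn L.isOpen
      (contDiffOn_fderiv L.isOpen hτ) hy) u).clm_apply (hasDerivAt_const (0 : ℝ) v)
  have hG1 : HasFDerivAt G₀ (fderiv ℝ G₀ (τ y)) (τ (y + (0 : ℝ) • u)) := by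
    simpa using (L₀.differentiableAt_metric (hmap hy)).hasFDerivAt
  have hk : HasDerivAt (fun t : ℝ ↦ G₀ (τ (y + t • u))) (fderiv ℝ G₀ (τ y) (fderiv ℝ τ y u)) 0 :=
    hG1.comp_hasDerivAt (0 : ℝ) hτ1
  have h3 : HasDerivAt
      (fun t : ℝ ↦ G₀ (τ (y + t • u)) (fderiv ℝ τ (y + t • u) v) (fderiv ℝ τ (y + t • u) w))
      (fderiv ℝ G₀ (τ y) (fderiv ℝ τ y u) (fderiv ℝ τ y v) (fderiv ℝ τ y w)
      + G₀ (τ y) (fderiv ℝ (fderiv ℝ τ) y u v) (fderiv ℝ τ y w)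
      + G₀ (τ y) (fderiv ℝ τ y v) (fderiv ℝ (fderiv ℝ τ) y u w)) 0 := by
    have := (hk.clm_apply (hτ2 v)).clm_apply (hτ2 w)
    simp only [zero_smul, add_zero, _root_.add_apply] at this
    exact this
  exact h2.unique h3

/-- The transformation law of the Levi-Civita connection under an isometry. -/
lemma fderiv_conn [FiniteDimensional ℝ E] {y : E} (hy : y ∈ Ω) (u v : E) :
    fderiv ℝ τ y (Γ y u v) = fderiv ℝ (fderiv ℝ τ) y u v
      + Γ₀ (τ y) (fderiv ℝ τ y u) (fderiv ℝ τ y v) := by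
  -- The defect of the transformation law, paired with `dτ w`, is symmetric in its first two slots
  -- and skew in the last two.
  let d : E → E → E := fun u v ↦ fderiv ℝ τ y (Γ y u v) - fderiv ℝ (fderiv ℝ τ) y u v
      - Γ₀ (τ y) (fderiv ℝ τ y u) (fderiv ℝ τ y v)
  have h1 : ∀ u v w, G₀ (τ y) (d u v) (fderiv ℝ τ y w) = 0 := by
    refine eq_zero_of_symm_of_skew (fun u v w ↦ ?_) fun u v w ↦ ?_
    · simp only [d, L.conn_symm y hy u v, fderiv_fderiv_comm L.isOpen hτ hy u v,
        L₀.conn_symm _ (hmap hy) (fderiv ℝ τ y u)]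
    · have h2 := L.fderiv_pullback L₀ hτ hmap hG hy u v w
      rw [L.compat y hy, hG y hy, hG y hy, L₀.compat _ (hmap hy)] at h2
      have hs := L₀.metric_symm _ (hmap hy) (fderiv ℝ τ y v)
      rw [← sub_eq_zero, sub_neg_eq_add, add_comm]
      simp only [d, map_sub, _root_.sub_apply]
      rw [hs, hs, hs] at h2
      linarith
  obtain ⟨e, he⟩ := L.isInvertible_fderiv_of_isometry hG hy
  have h3 : d u v = 0 := by
    by_contra hne
    refine (L₀.metric_pos _ (hmap hy) _ hne).ne' ?_
    have h4 := h1 u v (e.symm (d u v))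
    rw [← he] at h4
    simpa using h4
  have h5 : fderiv ℝ τ y (Γ y u v) - fderiv ℝ (fderiv ℝ τ) y u v
      - Γ₀ (τ y) (fderiv ℝ τ y u) (fderiv ℝ τ y v) = 0 := h3
  rw [sub_sub, sub_eq_zero] at h5
  exact h5

/-- Flatness is tested in every chart, whereas the conformal factor is built in one. The gradient is
carried back by the inverse of `dτ`, and the Hessian equation follows from `fderiv_conn`. -/
lemma pullback_conformal_factor [FiniteDimensional ℝ E] {w : E → ℝ} {X : E → E}
    {Q : E → E →L[ℝ] E →L[ℝ] ℝ} (hw : ContDiffOn ℝ ∞ w Ω₀) (hXs : ContDiffOn ℝ ∞ X Ω₀)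
    (hX : ∀ y ∈ Ω₀, ∀ u, G₀ y (X y) u = fderiv ℝ w y u)
    (hess : ∀ y ∈ Ω₀, ∀ u v, G₀ y (fderiv ℝ X y u + Γ₀ y u (X y)) v
      = G₀ y (X y) u * G₀ y (X y) v - 1 / 2 * G₀ y (X y) (X y) * G₀ y u v + Q y u v) :
    ∃ Y : E → E, ContDiffOn ℝ ∞ Y Ω ∧ (∀ y ∈ Ω, ∀ u, G y (Y y) u = fderiv ℝ (w ∘ τ) y u) ∧
      ∀ y ∈ Ω, ∀ u v, G y (fderiv ℝ Y y u + Γ y u (Y y)) v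
        = G y (Y y) u * G y (Y y) v - 1 / 2 * G y (Y y) (Y y) * G y u v
          + Q (τ y) (fderiv ℝ τ y u) (fderiv ℝ τ y v) := by
  have hinv := fun y hy ↦ L.isInvertible_fderiv_of_isometry hG (y := y) hy
  have hY : ∀ y ∈ Ω, fderiv ℝ τ y ((fderiv ℝ τ y).inverse (X (τ y))) = X (τ y) := by
    intro y hy
    exact congrArg (fun f : E →L[ℝ] E ↦ f (X (τ y))) (hinv y hy).self_comp_inverse
  have hYs : ContDiffOn ℝ ∞ (fun y ↦ (fderiv ℝ τ y).inverse (X (τ y))) Ω := by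
    refine ContDiffOn.clm_apply (fun y hy ↦ ContDiffAt.contDiffWithinAt ?_)
      (hXs.comp hτ hmap)
    obtain ⟨e, he⟩ := hinv y hy
    have h1 : ContDiffAt ℝ ∞ ContinuousLinearMap.inverse (fderiv ℝ τ y) := by
      rw [← he]; exact contDiffAt_map_inverse e
    exact h1.comp y ((contDiffOn_fderiv L.isOpen hτ).contDiffAt (L.isOpen.mem_nhds hy))
  refine ⟨fun y ↦ (fderiv ℝ τ y).inverse (X (τ y)), hYs, fun y hy u ↦ ?_, fun y hy u v ↦ ?_⟩
  · rw [hG y hy, hY y hy, hX _ (hmap hy),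
      fderiv_comp y (differentiableAt_of_contDiffOn L₀.isOpen hw (hmap hy))
        (differentiableAt_of_contDiffOn L.isOpen hτ hy)]
    rfl
  · set Y := fun y ↦ (fderiv ℝ τ y).inverse (X (τ y)) with hYdef
    have hY' : ∀ y ∈ Ω, fderiv ℝ τ y (Y y) = X (τ y) := hY
    have h1 := (hasDerivAt_line (differentiableAt_of_contDiffOn L.isOpen
      (contDiffOn_fderiv L.isOpen hτ) hy) u).clm_apply
      (hasDerivAt_line (differentiableAt_of_contDiffOn L.isOpen hYs hy) u)
    have h2 := hasDerivAt_line_of_eqOn L.isOpen hY' hy h1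
    have hX1 : HasFDerivAt X (fderiv ℝ X (τ y)) (τ (y + (0 : ℝ) • u)) := by
      simpa using (differentiableAt_of_contDiffOn L₀.isOpen hXs (hmap hy)).hasFDerivAt
    have h3 := hX1.comp_hasDerivAt 0
      (hasDerivAt_line (differentiableAt_of_contDiffOn L.isOpen hτ hy) u)
    have h4 := h2.unique h3
    simp only [zero_smul, add_zero] at h4
    have h5 : fderiv ℝ τ y (fderiv ℝ Y y u + Γ y u (Y y))
        = fderiv ℝ X (τ y) (fderiv ℝ τ y u) + Γ₀ (τ y) (fderiv ℝ τ y u) (X (τ y)) := by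
      rw [map_add, L.fderiv_conn L₀ hτ hmap hG hy, hY' y hy, ← h4]
      abel
    rw [hG y hy, h5, hess _ (hmap hy), hG y hy, hG y hy, hG y hy, hG y hy, hY' y hy]

end IsLeviCivita

end Pullback

/-! ### Transition maps between charts. -/

section Transition

variable {m : ℕ} {M : Type*} [TopologicalSpace M] [ChartedSpace (Coord m) M]
  [IsManifold (𝓡 m) ∞ M] {c c₀ : OpenPartialHomeomorph M (Coord m)}

lemma contDiffOn_transition (hc : c ∈ atlas (Coord m) M) (hc₀ : c₀ ∈ atlas (Coord m) M) :
    ContDiffOn ℝ ∞ (c₀ ∘ c.symm) (c.target ∩ c.symm ⁻¹' c₀.source) := by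
  rw [← contMDiffOn_iff_contDiffOn]
  exact (contMDiffOn_chart hc₀).comp ((contMDiffOn_chart_symm hc).mono Set.inter_subset_left)
    fun y hy ↦ hy.2

lemma locForm_transition (hc : c ∈ atlas (Coord m) M) (hc₀ : c₀ ∈ atlas (Coord m) M)
    (T : TwoTensor m M) {y : Coord m} (hy : y ∈ c.target ∩ c.symm ⁻¹' c₀.source) (u v : Coord m) :
    locForm T c y u v = locForm T c₀ ((c₀ ∘ c.symm) y) (fderiv ℝ (c₀ ∘ c.symm) y u)
      (fderiv ℝ (c₀ ∘ c.symm) y v) := by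
  have hopen : IsOpen (c.target ∩ c.symm ⁻¹' c₀.source) :=
    c.symm.isOpen_inter_preimage c₀.open_source
  have hp : c₀.symm ((c₀ ∘ c.symm) y) = c.symm y := c₀.left_inv hy.2
  have hev : c₀.symm ∘ (c₀ ∘ c.symm) =ᶠ[𝓝 y] c.symm := by
    filter_upwards [hopen.mem_nhds hy] with z hz using c₀.left_inv hz.2
  have hτ : MDifferentiableAt (𝓡 m) (𝓡 m) (c₀ ∘ c.symm) y :=
    (differentiableAt_of_contDiffOn hopen (contDiffOn_transition hc hc₀) hy).mdifferentiableAt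
  have hs : MDifferentiableAt (𝓡 m) (𝓡 m) c₀.symm ((c₀ ∘ c.symm) y) :=
    (chart_mdifferentiable hc₀).mdifferentiableAt_symm (c₀.map_source hy.2)
  have h1 : ∀ u : Coord m, (chartVec c₀ ((c₀ ∘ c.symm) y) (fderiv ℝ (c₀ ∘ c.symm) y u) : Coord m)
      = (chartVec c y u : Coord m) := by
    intro u
    have h2 := mfderiv_comp y hs hτ
    rw [hev.mfderiv_eq, mfderiv_eq_fderiv] at h2
    exact (congrArg (fun f : Coord m →L[ℝ] Coord m ↦ f u) h2).symm
  -- All tangent spaces are the model space by definition; forgetting the dependence on the point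
  -- lets the base point be rewritten.
  let T' : M → Coord m →L[ℝ] Coord m →L[ℝ] ℝ := T
  change T' (c.symm y) (chartVec c y u : Coord m) (chartVec c y v : Coord m)
    = T' (c₀.symm ((c₀ ∘ c.symm) y))
      (chartVec c₀ ((c₀ ∘ c.symm) y) (fderiv ℝ (c₀ ∘ c.symm) y u) : Coord m)
      (chartVec c₀ ((c₀ ∘ c.symm) y) (fderiv ℝ (c₀ ∘ c.symm) y v) : Coord m)
  rw [h1, h1, hp]

end Transition

/-! ### From charts to the manifold, and the theorem. -/

namespace AlmostHermitianStructure

section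

variable {m : ℕ} {M : Type*} [TopologicalSpace M] [ChartedSpace (Coord m) M]
  [IsManifold (𝓡 m) ∞ M] (S : AlmostHermitianStructure m M)

lemma isLocallyConstant_of_fderiv_eq_zero {h : M → ℝ} (hh : ContMDiff (𝓡 m) 𝓘(ℝ, ℝ) ∞ h)
    (h0 : ∀ c ∈ atlas (Coord m) M, ∀ y ∈ c.target, fderiv ℝ (fun y ↦ h (c.symm y)) y = 0) :
    IsLocallyConstant h := by
  refine (IsLocallyConstant.iff_eventually_eq h).2 fun p ↦ ?_
  set c := chartAt (Coord m) p
  have hc : c ∈ atlas (Coord m) M := chart_mem_atlas _ p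
  have hp : p ∈ c.source := mem_chart_source _ p
  obtain ⟨ε, hε, hb⟩ := Metric.isOpen_iff.1 c.open_target (c p) (c.map_source hp)
  have h1 : ∀ᶠ q in 𝓝 p, c q ∈ Metric.ball (c p) ε :=
    (c.continuousAt hp).eventually (Metric.ball_mem_nhds _ hε)
  filter_upwards [h1, c.open_source.mem_nhds hp] with q hq hqs
  have h2 := Metric.isOpen_ball.is_const_of_fderiv_eq_zero (𝕜 := ℝ)
    (convex_ball (c p) ε).isPreconnected
    (((contDiffOn_comp_chart_symm hc hh).mono hb).differentiableOn (by simp))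
    (fun z hz ↦ h0 c hc z (hb hz)) hq (Metric.mem_ball_self hε)
  simpa only [c.left_inv hqs, c.left_inv hp] using h2

theorem conformallyFlat_of_curvatureForm (hm : 6 ≤ m) {P : TwoTensor m M} (hP : SmoothTwoTensor P)
    (hPsymm : ∀ (p : M) (x y : TangentSpace (𝓡 m) p), P p x y = P p y x)
    {f h : M → ℝ} (hf : ContMDiff (𝓡 m) 𝓘(ℝ, ℝ) ∞ f) (hh : ContMDiff (𝓡 m) 𝓘(ℝ, ℝ) ∞ h)
    (hR : S.HasCurvatureForm P f h) (h0 : ∀ p, h p = 0) : ConformallyFlat S.g := by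
  have C := fun c (hc : c ∈ atlas (Coord m) M) ↦ S.hasLocalCurvatureForm hc hP hPsymm hf hh hR
  have hphi : ∀ c ∈ atlas (Coord m) M, ∀ y ∈ c.target, ∀ b d w z,
      locForm S.g c y (curvOp (leviCivitaConn (locForm S.g c)) y b d w) z
        = phi (locForm S.g c y) (locForm (S.shiftedTensor P f) c y) b d w z := by
    intro c hc y hy b d w z
    rw [(C c hc).curvature_eq y hy, h0, zero_mul, add_zero]
  intro p
  set c₀ := chartAt (Coord m) p
  have hc₀ : c₀ ∈ atlas (Coord m) M := chart_mem_atlas _ p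
  have hp : p ∈ c₀.source := mem_chart_source _ p
  have C₀ := C c₀ hc₀
  obtain ⟨U₀, hU₀, hpU₀, hU₀c, w, X, hw, hX, hgrad, hess⟩ :=
    C₀.toIsLeviCivita.exists_conformal_factor C₀.contDiffOn_Q C₀.Q_symm (hphi c₀ hc₀)
      (fun y hy u v x ↦ C₀.covForm_cotton (by simpa using hm) (fun _ _ ↦ h0 _) hy u v x)
      (c₀.map_source hp)
  have L₀ := C₀.toIsLeviCivita.mono hU₀ hU₀c
  refine ⟨c₀.source ∩ c₀ ⁻¹' U₀, c₀.isOpen_inter_preimage hU₀, ⟨hp, hpU₀⟩, fun q ↦ w (c₀ q), ?_, ?_⟩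
  · exact (contMDiffOn_iff_contDiffOn.2 hw).comp
      ((contMDiffOn_chart hc₀).mono Set.inter_subset_left) fun q hq ↦ hq.2
  rintro c hc p ⟨hpc, hpU⟩
  obtain ⟨y, hy, rfl⟩ : ∃ y ∈ c.target, c.symm y = p := ⟨c p, c.map_source hpc, c.left_inv hpc⟩
  intro a b d z
  -- On this overlap the transition map from `c` to `c₀` is an isometry of the local metrics, and it
  -- carries the factor built in `c₀` to the arbitrary chart `c`.
  set Ω := c.target ∩ c.symm ⁻¹' (c₀.source ∩ c₀ ⁻¹' U₀) with hΩdef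
  have hΩ : IsOpen Ω := c.symm.isOpen_inter_preimage (c₀.isOpen_inter_preimage hU₀)
  have hyΩ : y ∈ Ω := ⟨hy, hpU⟩
  have hΩc : Ω ⊆ c.target := Set.inter_subset_left
  have hΩt : Ω ⊆ c.target ∩ c.symm ⁻¹' c₀.source := fun z hz ↦ ⟨hz.1, hz.2.1⟩
  have hmap : Set.MapsTo (c₀ ∘ c.symm) Ω U₀ := fun z hz ↦ hz.2.2
  have hτ := (contDiffOn_transition hc hc₀).mono hΩt
  have L := (C c hc).toIsLeviCivita.mono hΩ hΩc
  obtain ⟨Y, hYs, hY, hessY⟩ := L.pullback_conformal_factor L₀ hτ hmap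
    (fun z hz ↦ locForm_transition hc hc₀ S.g (hΩt hz)) hw hX hgrad hess
  have hwτ : ContDiffOn ℝ ∞ (w ∘ (c₀ ∘ c.symm)) Ω := hw.comp hτ hmap
  set g' : TwoTensor m M := fun q ↦ Real.exp (2 * w (c₀ q)) • S.g q with hg'
  have hG' : ∀ z ∈ Ω, locForm g' c z
      = Real.exp (2 * (w ∘ (c₀ ∘ c.symm)) z) • locForm S.g c z := fun z _ ↦ rfl
  have L' : IsLeviCivita Ω (locForm g' c) (leviCivitaConn (locForm g' c)) := by
    refine isLeviCivita_leviCivitaConn hΩ ?_ (fun z hz u v ↦ ?_) fun z hz u hu ↦ ?_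
    · exact ((contDiffOn_const.mul hwτ).exp.smul L.contDiffOn_metric).congr hG'
    · rw [hG' z hz, _root_.smul_apply, _root_.smul_apply, _root_.smul_apply, _root_.smul_apply,
        L.metric_symm z hz]
    · rw [hG' z hz, _root_.smul_apply, _root_.smul_apply]
      exact mul_pos (Real.exp_pos _) (L.metric_pos z hz u hu)
  have hflat := L.conformal_flat hwτ L' hG' hYs hY
    (fun z hz ↦ (C c hc).Q_symm z (hΩc hz)) (fun z hz ↦ hphi c hc z (hΩc hz))
    (fun z hz u v ↦ by
      rw [hessY z hz, ← locForm_transition hc hc₀ _ (hΩt hz)]) hyΩ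
  rw [L'.curvature_eq hyΩ hΩc, hflat, map_zero, _root_.zero_apply]

end

section

variable {n : ℕ} {M : Type*} [TopologicalSpace M] [ChartedSpace (Coord (2 * n)) M]
  [IsManifold (𝓡 (2 * n)) ∞ M] (S : AlmostHermitianStructure (2 * n) M) (hn : 2 < n)
  (hS : S.IsSemiKahler) {P : TwoTensor (2 * n) M} (hP : SmoothTwoTensor P)
  (hPsymm : ∀ (p : M) (x y : TangentSpace (𝓡 (2 * n)) p), P p x y = P p y x)
  {f h : M → ℝ} (hf : ContMDiff (𝓡 (2 * n)) 𝓘(ℝ, ℝ) ∞ f)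
  (hh : ContMDiff (𝓡 (2 * n)) 𝓘(ℝ, ℝ) ∞ h) (hR : S.HasCurvatureForm P f h)
include hn hS hP hPsymm hf hh hR

theorem isLocallyConstant_of_curvatureForm : IsLocallyConstant h := by
  refine isLocallyConstant_of_fderiv_eq_zero hh fun c hc y hy ↦ ?_
  have C := S.hasLocalCurvatureForm hc hP hPsymm hf hh hR
  exact C.fderiv_eq_zero hn (by simp) (C.isTraceFree rfl hc hS) hy

lemma covEnd_locEnd_eq_zero (h0 : ∀ p, h p ≠ 0) {c : OpenPartialHomeomorph M (Coord (2 * n))}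
    (hc : c ∈ atlas (Coord (2 * n)) M) {y : Coord (2 * n)} (hy : y ∈ c.target)
    (w u : Coord (2 * n)) :
    covEnd (leviCivitaConn (locForm S.g c)) (locEnd S.J c) y w u = 0 := by
  have C := S.hasLocalCurvatureForm hc hP hPsymm hf hh hR
  exact C.covEnd_eq_zero hn (by simp) (C.isTraceFree rfl hc hS) hy (h0 _) w u

theorem isKahler_of_curvatureForm (h0 : ∀ p, h p ≠ 0) : S.IsKahler := by
  intro c hc p hp k i j
  have hy := c.map_source hp
  rw [(S.isLeviCivita hc).covDerivEnd_eq hy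
      (differentiableAt_of_contDiffOn c.open_target (S.contDiffOn_locEnd hc) hy),
    S.covEnd_locEnd_eq_zero hn hS hP hPsymm hf hh hR h0 hc hy]
  rfl

theorem hasConstHolSectionalCurvature_of_curvatureForm {a : ℝ} (ha : a ≠ 0) (h0 : ∀ p, h p = a) :
    S.HasConstHolSectionalCurvature := by
  refine ⟨4 * a, fun c hc p hp ↦ ?_⟩
  obtain ⟨y, hy, rfl⟩ : ∃ y ∈ c.target, c.symm y = p := ⟨c p, c.map_source hp, c.left_inv hp⟩
  intro x hx
  have C := S.hasLocalCurvatureForm hc hP hPsymm hf hh hR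
  have H := S.isHermitianPair hc hy
  obtain ⟨u, rfl⟩ : ∃ u, chartVec c y u = x := ⟨_, chartVec_chartComp hc hy x⟩
  have hu : u ≠ 0 := by
    rintro rfl
    exact hx (map_zero _)
  have hQ := fun u v ↦ C.Q_eq_of_parallel (by simp; omega)
    (fun z hz ↦ S.covEnd_locEnd_eq_zero hn hS hP hPsymm hf hh hR (fun p ↦ by rwa [h0 p]) hc hz)
    hy u v
  simp only [h0] at hQ
  rw [← hol_sectional_of_eq H hQ hu, ← chartVec_locEnd hc hy,
    (S.isLeviCivita hc).curvature_eq hy subset_rfl]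
  simp only [chartComp_chartVec hc hy]
  rw [C.curvature_eq y hy, h0]
  rfl

end

end AlmostHermitianStructure

end AlmostHermitian

open AlmostHermitian in
theorem theorem1 (n : ℕ) (hn : 2 < n) (M : Type*) [TopologicalSpace M]
    [ChartedSpace (Coord (2 * n)) M] [IsManifold (𝓡 (2 * n)) ∞ M] [ConnectedSpace M]
    (S : AlmostHermitianStructure (2 * n) M) (hS : S.IsSemiKahler)
    (P : TwoTensor (2 * n) M) (hP : SmoothTwoTensor P)
    (hPsymm : ∀ (p : M) (x y : TangentSpace (𝓡 (2 * n)) p), P p x y = P p y x)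
    (f h : M → ℝ) (hf : ContMDiff (𝓡 (2 * n)) 𝓘(ℝ, ℝ) ∞ f)
    (hh : ContMDiff (𝓡 (2 * n)) 𝓘(ℝ, ℝ) ∞ h)
    (hR : S.HasCurvatureForm P f h) :
    ∃ a : ℝ, (∀ p : M, h p = a) ∧
      (a = 0 → ConformallyFlat S.g) ∧
      (a ≠ 0 → S.IsKahler ∧ S.HasConstHolSectionalCurvature) := by
  obtain ⟨p₀⟩ := (inferInstance : Nonempty M)
  have hconst : ∀ p, h p = h p₀ := fun p ↦
    (S.isLocallyConstant_of_curvatureForm hn hS hP hPsymm hf hh hR).apply_eq_of_preconnectedSpace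
      p p₀
  refine ⟨h p₀, hconst, fun h0 ↦ ?_, fun h0 ↦ ⟨?_, ?_⟩⟩
  · exact S.conformallyFlat_of_curvatureForm (by omega) hP hPsymm hf hh hR
      fun p ↦ (hconst p).trans h0
  · exact S.isKahler_of_curvatureForm hn hS hP hPsymm hf hh hR fun p ↦ by rwa [hconst p]
  · exact S.hasConstHolSectionalCurvature_of_curvatureForm hn hS hP hPsymm hf hh hR h0 hconst
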